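/- Let $\Omega\subset\mathbb{R}^2$ be a convex bounded domain with $C^5$ boundary and outer unit normal $n_x$ at $x\in\partial\Omega$, and let $h:\partial\Omega\to(0,\infty)$ be of class $C^{1,\alpha}$ for some $\alpha\in(0,1)$. Then there is a function $\zeta$, depending only on $\Omega$ and $h$, such that the following holds. Let $0<T<\infty$, $0<\mu<1$, and let $f_0\in C^{1,\mu}(\bar\Omega\times\mathbb{R}^2)$ satisfy $\int_{\Omega\times\mathbb{R}^2}f_0\,dx\,dv=\int_{\partial\Omega}h\,dl$. Suppose that $f\ge 0$, $f\in C^{1;1,\lambda}_{t;(x,v)}([0,T]\times\bar\Omega\times\mathbb{R}^2)$ for some $\lambda\in(0,1)$ (that is, $f$ and $\partial_tf$ are continuous and bounded and $\nabla_xf,\nabla_vf$ are Hölder continuous in $(x,v)$ with exponent $\lambda$, uniformly in $t$), with $f(t,x,\cdot)$ integrable, and that $f$ together with a potential $\varphi$ (with $\varphi(t,\cdot)\in C^2(\Omega)\cap C^1(\bar\Omega)$ for each $t\in[0,T]$ and $\nabla_x\varphi$ continuous on $[0,T]\times\bar\Omega$) is a classical solution on $[0,T]$ of the relativistic Vlasov–Poisson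 system with specular reflection and Neumann boundary condition: $$\partial_tf+\frac{v}{\sqrt{1+|v|^2}}\cdot\nabla_xf+\nabla_x\varphi\cdot\nabla_vf=0,\qquad \Delta\varphi=\int_{\mathbb{R}^2}f\,dv\qquad(0<t\le T,\ x\in\Omega,\ v\in\mathbb{R}^2),$$ $$f(0,x,v)=f_0(x,v)\ (x\in\Omega),\qquad f(t,x,v)=f\big(t,x,v-2(n_x\cdot v)n_x\big),\quad \frac{\partial\varphi}{\partial n_x}(t,x)=h(x)\quad(0<t\le T,\ x\in\partial\Omega,\ v\in\mathbb{R}^2).$$ Put $$Q(t)=\sup\{|v|:(x,v)\in\operatorname{supp}f(s),\ 0\le s\le t\}\in[0,\infty],$$ $$\|f_0\|_{C^{1,\mu}}=\sup\frac{|\nabla f_0(x,v)-\nabla f_0(x',v')|}{|x-x'|^\mu+|v-v'|^\mu}+\|f_0\|_{L^\infty},\qquad \nabla=(\nabla_x,\nabla_v),$$ where the suprema are over $\bar\Omega\times\mathbb{R}^2$, and assume that $Q(0)<\infty$. Then $$Q(t)\le\zeta\big(T,Q(0),\|f_0\|_{C^{1,\mu}}\big)<\infty\qquad\text{for all }0\le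 t\le T.$$ -/

import Mathlib

open Set MeasureTheory
open scoped ENNReal

noncomputable section

namespace RVP

/-- The Euclidean plane. -/
abbrev Plane : Type := EuclideanSpace ℝ (Fin 2)

/-- `Ω` is a convex bounded domain of the plane with boundary of class `C^5`, whose boundary is the
simple closed curve with the arc length parametrization `r` and the total length `L`. -/
structure IsConvexC5Domain (Ω : Set Plane) (L : ℝ) (r : ℝ → Plane) : Prop where
  isOpen : IsOpen Ω
  nonempty : Ω.Nonempty
  isBounded : Bornology.IsBounded Ω
  convex : Convex ℝ Ω
  length_pos : 0 < L
  contDiff : ContDiff ℝ 5 r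
  periodic : Function.Periodic r L
  arcLength : ∀ l, ‖deriv r l‖ = 1
  injOn : InjOn r (Ico 0 L)
  range_eq : range r = frontier Ω

/-- `n` is an outer unit normal vector of the convex set `Ω` at its boundary point `x`: the set lies
in the half plane through `x` that `n` points out of. If the boundary is of class `C^1`, there is
exactly one such `n` at every boundary point. -/
def IsOuterUnitNormal (Ω : Set Plane) (x n : Plane) : Prop :=
  ‖n‖ = 1 ∧ ∀ y ∈ Ω, inner ℝ n (y - x) ≤ 0

/-- `h` is of class `C^{1,α}` on the closed curve parametrized by arc length through `r`. -/
def IsC1HolderOnCurve (α : ℝ) (r : ℝ → Plane) (h : Plane → ℝ) : Prop :=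
  ContDiff ℝ 1 (fun l => h (r l)) ∧
    ∃ C : ℝ, ∀ l l' : ℝ,
      |deriv (fun l => h (r l)) l - deriv (fun l => h (r l)) l'| ≤ C * |l - l'| ^ α

/-- The velocity `v / √(1 + |v|²)` of a particle of momentum `v`. -/
def velocity (v : Plane) : Plane := (1 / √(1 + ‖v‖ ^ 2)) • v

/-- The momentum `v - 2 (n · v) n` after specular reflection. -/
def reflect (n v : Plane) : Plane := v - (2 * inner ℝ n v) • n

/-- `∇ₓ g`, up to the boundary of `Ω`. -/
def gradX (Ω : Set Plane) (g : Plane → Plane → ℝ) (x v : Plane) : Plane :=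
  gradientWithin (fun y => g y v) (closure Ω) x

/-- `∇ᵥ g`. -/
def gradV (g : Plane → Plane → ℝ) (x v : Plane) : Plane :=
  gradient (fun w => g x w) v

/-- The supremum norm over `closure Ω × ℝ²`. -/
def supNorm (Ω : Set Plane) (g : Plane → Plane → ℝ) : ℝ≥0∞ :=
  ⨆ x ∈ closure Ω, ⨆ v : Plane, ENNReal.ofReal |g x v|

/-- The Hölder seminorm with exponent `μ` of `∇ g = (∇ₓ g, ∇ᵥ g)` over `closure Ω × ℝ²`. -/
def gradHolderSeminorm (Ω : Set Plane) (μ : ℝ) (g : Plane → Plane → ℝ) : ℝ≥0∞ :=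
  ⨆ x ∈ closure Ω, ⨆ v : Plane, ⨆ x' ∈ closure Ω, ⨆ v' : Plane,
    ENNReal.ofReal
      (√(‖gradX Ω g x v - gradX Ω g x' v'‖ ^ 2 + ‖gradV g x v - gradV g x' v'‖ ^ 2) /
        (‖x - x'‖ ^ μ + ‖v - v'‖ ^ μ))

/-- The norm of `C^{1,μ}(closure Ω × ℝ²)`. -/
def c1HolderNorm (Ω : Set Plane) (μ : ℝ) (g : Plane → Plane → ℝ) : ℝ≥0∞ :=
  gradHolderSeminorm Ω μ g + supNorm Ω g

/-- The partial gradients of `g` in `x` and in `v` exist everywhere on `closure Ω × ℝ²`. -/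
def HasGradients (Ω : Set Plane) (g : Plane → Plane → ℝ) : Prop :=
  ∀ x ∈ closure Ω, ∀ v : Plane,
    DifferentiableWithinAt ℝ (fun y => g y v) (closure Ω) x ∧
      DifferentiableAt ℝ (fun w => g x w) v

/-- `g` belongs to `C^{1,μ}(closure Ω × ℝ²)`. -/
def MemC1Holder (Ω : Set Plane) (μ : ℝ) (g : Plane → Plane → ℝ) : Prop :=
  HasGradients Ω g ∧ c1HolderNorm Ω μ g < ∞

/-- `∂ₜ f` on the time interval `[0, T]` (one-sided at its ends). -/
def timeDeriv (T : ℝ) (f : ℝ → Plane → Plane → ℝ) (t : ℝ) (x v : Plane) : ℝ :=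
  derivWithin (fun s => f s x v) (Icc 0 T) t

/-- `f` belongs to `C^{1;1,lam}` in `(t; (x,v))` on `[0,T] × closure Ω × ℝ²`: `f` and `∂ₜ f` are
continuous and bounded, and `∇ f` is Hölder continuous in `(x,v)` with exponent `lam`, uniformly
in `t`. -/
structure MemC1C1Holder (Ω : Set Plane) (T lam : ℝ) (f : ℝ → Plane → Plane → ℝ) : Prop where
  continuousOn : ContinuousOn (fun p : ℝ × Plane × Plane => f p.1 p.2.1 p.2.2)
    (Icc 0 T ×ˢ closure Ω ×ˢ univ)
  differentiable_time : ∀ t ∈ Icc 0 T, ∀ x ∈ closure Ω, ∀ v : Plane,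
    DifferentiableWithinAt ℝ (fun s => f s x v) (Icc 0 T) t
  continuousOn_timeDeriv :
    ContinuousOn (fun p : ℝ × Plane × Plane => timeDeriv T f p.1 p.2.1 p.2.2)
      (Icc 0 T ×ˢ closure Ω ×ˢ univ)
  hasGradients : ∀ t ∈ Icc 0 T, HasGradients Ω (f t)
  norm_lt_top :
    (⨆ t ∈ Icc 0 T, gradHolderSeminorm Ω lam (f t)) + (⨆ t ∈ Icc 0 T, supNorm Ω (f t))
      + (⨆ t ∈ Icc 0 T, supNorm Ω (timeDeriv T f t)) < ∞

/-- The charge density. -/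
def chargeDensity (f : ℝ → Plane → Plane → ℝ) (t : ℝ) (x : Plane) : ℝ := ∫ v : Plane, f t x v

/-- The field `E = ∇ₓ φ`, up to the boundary of `Ω`. -/
def field (Ω : Set Plane) (φ : ℝ → Plane → ℝ) (t : ℝ) (x : Plane) : Plane :=
  gradientWithin (φ t) (closure Ω) x

/-- `(f, φ)` is a classical solution on `[0,T]` of the relativistic Vlasov-Poisson system in `Ω`
with initial datum `f₀`, specular reflection of `f` at the boundary and the Neumann boundary
condition `∂φ/∂n = h`. The potential is `C²` in `Ω` and `C¹` up to the boundary at all times, and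
its field is continuous on `[0,T] × closure Ω`. -/
structure IsClassicalSolution (Ω : Set Plane) (h : Plane → ℝ) (T : ℝ)
    (f₀ : Plane → Plane → ℝ) (f : ℝ → Plane → Plane → ℝ) (φ : ℝ → Plane → ℝ) : Prop where
  regularity : ∃ lam : ℝ, 0 < lam ∧ lam < 1 ∧ MemC1C1Holder Ω T lam f
  nonneg : ∀ t ∈ Icc 0 T, ∀ x ∈ closure Ω, ∀ v : Plane, 0 ≤ f t x v
  integrable : ∀ t ∈ Icc 0 T, ∀ x ∈ closure Ω, Integrable (fun v : Plane => f t x v)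
  contDiffOn_potential : ∀ t ∈ Icc 0 T, ContDiffOn ℝ 2 (φ t) Ω
  differentiableOn_potential : ∀ t ∈ Icc 0 T, DifferentiableOn ℝ (φ t) (closure Ω)
  continuousOn_field : ContinuousOn (fun p : ℝ × Plane => field Ω φ p.1 p.2)
    (Icc 0 T ×ˢ closure Ω)
  vlasov : ∀ t ∈ Ioc 0 T, ∀ x ∈ Ω, ∀ v : Plane,
    timeDeriv T f t x v + inner ℝ (velocity v) (gradX Ω (f t) x v)
      + inner ℝ (field Ω φ t x) (gradV (f t) x v) = 0
  poisson : ∀ t ∈ Ioc 0 T, ∀ x ∈ Ω, Laplacian.laplacian (φ t) x = chargeDensity f t x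
  initial : ∀ x ∈ Ω, ∀ v : Plane, f 0 x v = f₀ x v
  specular : ∀ t ∈ Ioc 0 T, ∀ x ∈ frontier Ω, ∀ n : Plane, IsOuterUnitNormal Ω x n →
    ∀ v : Plane, f t x v = f t x (reflect n v)
  neumann : ∀ t ∈ Ioc 0 T, ∀ x ∈ frontier Ω, ∀ n : Plane, IsOuterUnitNormal Ω x n →
    inner ℝ (field Ω φ t x) n = h x

/-- The support of `g`, as a function on `closure Ω × ℝ²`. -/
def phaseSupport (Ω : Set Plane) (g : Plane → Plane → ℝ) : Set (Plane × Plane) :=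
  closure {z : Plane × Plane | z.1 ∈ closure Ω ∧ g z.1 z.2 ≠ 0}

/-- `Q(t) = sup {|v| : (x,v) ∈ supp f(s), 0 ≤ s ≤ t}`, possibly infinite. -/
def momentumSupport (Ω : Set Plane) (f : ℝ → Plane → Plane → ℝ) (t : ℝ) : ℝ≥0∞ :=
  ⨆ s ∈ Icc 0 t, ⨆ z ∈ phaseSupport Ω (f s), ENNReal.ofReal ‖z.2‖

end RVP

end

/-!
The momentum of a particle changes at the rate of the field `∇φ`, so the momenta in the support of
`f` are controlled by Gronwall's inequality once the field is at most linear in the largest of them.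
Two facts give this.

*Bounds for `f`.* `f` is constant along the characteristics, reflected at the boundary. The
characteristics themselves are not used, but a maximum principle for the Vlasov equation
(`le_of_vlasov_subsolution`): reflection preserves the energy `√(1 + |v|²)` and reverses the normal
component of the momentum, so no maximum arises at the boundary. Applied to `f` it gives
`f ≤ F := sup f₀`; applied to `f` times a cutoff of the energies below `Y(t)`, where `Y' ≥ |∇φ|`, it
shows that the energies in the support stay below `Y` (`IsClassicalSolution.eq_zero_of_lt_energy`).
If the energies in the support are at most `P`, then `0 ≤ Δφ ≤ π F P²`.

*The gradient bound* `|∇φ| ≤ C √R` for solutions of the Neumann problem with `0 ≤ Δφ ≤ R` and `R`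
large (`exists_gradient_le_sqrt`). It is obtained without a Green function. Let `G := sup |∇φ|`.

* If `φ` oscillates by at most `O` on balls of radius `d`, then `|∇φ| ≤ C (O / d + d R + 1)`, up to
  the boundary. To see this, apply the maximum principle in the variables `(x, y)` jointly to
  `φ x - φ y` minus a concave function of `|x - y|`. Near a boundary point `z` with the normal `n`,
  subtract also `⟨h(z) n, x - y⟩`, which removes the datum up to terms of the size of `|x - z|` and
  `|y - z|`, and for each of the two points a multiple of `⟨x - z, n⟩ |x - z|`, whose normal
  derivative at the boundary is large enough to absorb them (`two_point_estimate`,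
  `exists_boundary_lipschitz`).
* Let `χ` be increasing with values in `[0, π O]` and `χ' ≤ 1`. As `Δφ ≥ 0`, integration by parts
  of `χ(φ) Δφ` gives `∫ |∇ χ(φ)|² ≤ π O ∫ h` up to a constant, independently of `R`
  (`exists_truncation_energy_le`). If `O = |φ x - φ y|`, then `χ(φ)` changes by about `O` along many
  segments parallel to the one from `x` to `y`, and `|φ x - φ y|³ ≤ C |x - y|² G²` follows
  (`exists_oscillation_le`).
* At the scale `d = 1 / √R` the oscillation is thus `O ≤ C (G² / R) ^ (1/3)`. With `X := G / √R` the
  first estimate reads `X ≤ C (O + 1)`, and the second one `O³ ≤ C X²`; so `X` is bounded.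

Hence the field is at most `β P` if the energies are at most `P`, where `β` depends only on the
domain, on `h` and on `F`, and the energies in the support grow at most like `exp (β t)`.
-/

noncomputable section

namespace RVP

open Filter Topology Metric

/-! ### The plane -/

lemma inner_eq_coord (u v : Plane) : inner ℝ u v = u 0 * v 0 + u 1 * v 1 := by
  simp [PiLp.inner_apply, Fin.sum_univ_two, mul_comm]

lemma norm_sq_eq_coord (u : Plane) : ‖u‖ ^ 2 = u 0 ^ 2 + u 1 ^ 2 := by
  rw [← real_inner_self_eq_norm_sq, inner_eq_coord]; ring

/-- The rotation by a right angle. -/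
def rot : Plane →L[ℝ] Plane :=
  LinearMap.toContinuousLinearMap
    { toFun := fun u => !₂[-u 1, u 0]
      map_add' := fun u v => by ext i; fin_cases i <;> simp; ring
      map_smul' := fun c u => by ext i; fin_cases i <;> simp }

@[simp] lemma rot_zero_coord (u : Plane) : rot u 0 = -u 1 := by simp [rot]
@[simp] lemma rot_one_coord (u : Plane) : rot u 1 = u 0 := by simp [rot]

lemma norm_rot (u : Plane) : ‖rot u‖ = ‖u‖ := by
  have h : ‖rot u‖ ^ 2 = ‖u‖ ^ 2 := by
    rw [norm_sq_eq_coord, norm_sq_eq_coord]; simp; ring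
  exact (pow_left_inj₀ (norm_nonneg _) (norm_nonneg _) two_ne_zero).1 h

lemma eq_add_rot {e : Plane} (he : ‖e‖ = 1) (v : Plane) :
    v = inner ℝ v e • e + inner ℝ v (rot e) • rot e := by
  have h : e 0 ^ 2 + e 1 ^ 2 = 1 := by rw [← norm_sq_eq_coord, he]; norm_num
  ext i
  fin_cases i
  · simp [inner_eq_coord]; linear_combination -(v 0) * h
  · simp [inner_eq_coord]; linear_combination -(v 1) * h

lemma eq_or_eq_neg_rot {e n : Plane} (he : ‖e‖ = 1) (hn : ‖n‖ = 1) (hne : inner ℝ n e = 0) :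
    n = rot e ∨ n = -rot e := by
  have h := eq_add_rot he n
  rw [hne, zero_smul, zero_add] at h
  have h1 : |inner ℝ n (rot e)| = 1 := by
    have := congrArg norm h
    rw [norm_smul, norm_rot, he, hn, mul_one, Real.norm_eq_abs] at this
    exact this.symm
  rcases eq_or_eq_neg_of_abs_eq h1 with h2 | h2
  · left; rw [h2, one_smul] at h; exact h
  · right; rw [h2, neg_smul, one_smul] at h; exact h

/-! ### Normals of a convex domain -/

lemma IsOuterUnitNormal.closure_le {Ω : Set Plane} {x n y : Plane} (h : IsOuterUnitNormal Ω x n)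
    (hy : y ∈ closure Ω) : inner ℝ n (y - x) ≤ 0 := by
  have hc : IsClosed {y : Plane | inner ℝ n (y - x) ≤ 0} :=
    isClosed_le (by fun_prop) continuous_const
  exact closure_minimal (fun y hy => h.2 y hy) hc hy

lemma IsOuterUnitNormal.radius_le {Ω : Set Plane} {x n p : Plane} {ρ : ℝ} (hρ : 0 ≤ ρ)
    (h : IsOuterUnitNormal Ω x n) (hp : closedBall p ρ ⊆ Ω) : ρ ≤ inner ℝ n (x - p) := by
  have hy : p + ρ • n ∈ Ω := hp (by simp [norm_smul, h.1, abs_of_nonneg hρ])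
  have h1 := h.2 _ hy
  have h2 : p + ρ • n - x = ρ • n - (x - p) := by abel
  rw [h2, inner_sub_right, inner_smul_right, real_inner_self_eq_norm_sq, h.1] at h1
  linarith

lemma exists_isOuterUnitNormal {Ω : Set Plane} (ho : IsOpen Ω) (hc : Convex ℝ Ω)
    (hne : Ω.Nonempty) {x : Plane} (hx : x ∈ frontier Ω) : ∃ n, IsOuterUnitNormal Ω x n := by
  have hxn : x ∉ Ω := by
    rw [ho.frontier_eq] at hx; exact hx.2
  obtain ⟨f, hf⟩ := geometric_hahn_banach_open_point hc ho hxn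
  set m : Plane := (InnerProductSpace.toDual ℝ Plane).symm f with hm
  have hfm : ∀ y, inner ℝ m y = f y := fun y => by simp [hm]
  have hm0 : m ≠ 0 := by
    intro h0
    obtain ⟨y, hy⟩ := hne
    have h1 := hf y hy
    rw [← hfm, ← hfm, h0] at h1
    simp at h1
  refine ⟨‖m‖⁻¹ • m, ?_, fun y hy => ?_⟩
  · rw [norm_smul, norm_inv, norm_norm, inv_mul_cancel₀ (norm_ne_zero_iff.2 hm0)]
  · rw [real_inner_smul_left, hfm, map_sub]
    exact mul_nonpos_of_nonneg_of_nonpos (by positivity) (by linarith [hf y hy])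

namespace IsConvexC5Domain
variable {Ω : Set Plane} {L : ℝ} {r : ℝ → Plane}

lemma differentiable (hΩ : IsConvexC5Domain Ω L r) : Differentiable ℝ r :=
  hΩ.contDiff.differentiable (by norm_num)

lemma hasDerivAt (hΩ : IsConvexC5Domain Ω L r) (l : ℝ) : HasDerivAt r (deriv r l) l :=
  (hΩ.differentiable l).hasDerivAt

lemma contDiff_deriv (hΩ : IsConvexC5Domain Ω L r) : ContDiff ℝ 1 (deriv r) := by
  have h : ContDiff ℝ (1 + 1) r := hΩ.contDiff.of_le (by norm_num)
  exact (contDiff_succ_iff_deriv.1 h).2.2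

lemma mem_frontier (hΩ : IsConvexC5Domain Ω L r) (l : ℝ) : r l ∈ frontier Ω :=
  hΩ.range_eq ▸ mem_range_self l

lemma mem_closure (hΩ : IsConvexC5Domain Ω L r) (l : ℝ) : r l ∈ closure Ω :=
  frontier_subset_closure (hΩ.mem_frontier l)

lemma periodic_deriv (hΩ : IsConvexC5Domain Ω L r) : Function.Periodic (deriv r) L := by
  intro l
  have h : (fun x => r (x + L)) = r := funext hΩ.periodic
  rw [← deriv_comp_add_const, h]

lemma exists_closedBall (hΩ : IsConvexC5Domain Ω L r) :
    ∃ p : Plane, ∃ ρ : ℝ, 0 < ρ ∧ closedBall p ρ ⊆ Ω := by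
  obtain ⟨p, hp⟩ := hΩ.nonempty
  obtain ⟨ρ, hρ, h⟩ := Metric.nhds_basis_closedBall.mem_iff.1 (hΩ.isOpen.mem_nhds hp)
  exact ⟨p, ρ, hρ, h⟩

lemma isCompact_closure (hΩ : IsConvexC5Domain Ω L r) : IsCompact (closure Ω) :=
  hΩ.isBounded.isCompact_closure

lemma mem_or_frontier (hΩ : IsConvexC5Domain Ω L r) {x : Plane} (hx : x ∈ closure Ω) :
    x ∈ Ω ∨ x ∈ frontier Ω := by
  by_cases h : x ∈ Ω
  · exact Or.inl h
  · right; rw [hΩ.isOpen.frontier_eq]; exact ⟨hx, h⟩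

lemma inner_normal_deriv (hΩ : IsConvexC5Domain Ω L r) {l : ℝ} {n : Plane}
    (hn : IsOuterUnitNormal Ω (r l) n) : inner ℝ n (deriv r l) = 0 := by
  have hd : HasDerivAt (fun s => inner ℝ n (r s - r l)) (inner ℝ n (deriv r l)) l := by
    have h1 : HasDerivAt (fun s => r s - r l) (deriv r l) l := (hΩ.hasDerivAt l).sub_const _
    simpa using (hasDerivAt_const l n).inner ℝ h1
  have hmax : IsLocalMax (fun s => inner ℝ n (r s - r l)) l := by
    refine Eventually.of_forall fun s => ?_
    simpa using hn.closure_le (hΩ.mem_closure s)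
  exact hmax.hasDerivAt_eq_zero hd

/-- The outer unit normal is the tangent rotated by a right angle, in a direction that is the same
along the whole boundary curve. -/
lemma exists_orientation (hΩ : IsConvexC5Domain Ω L r) :
    ∃ σ : ℝ, (σ = 1 ∨ σ = -1) ∧ ∀ l, IsOuterUnitNormal Ω (r l) (σ • rot (deriv r l)) ∧
      ∀ n, IsOuterUnitNormal Ω (r l) n → n = σ • rot (deriv r l) := by
  obtain ⟨p, ρ, hρ, hp⟩ := hΩ.exists_closedBall
  have key : ∀ l n, IsOuterUnitNormal Ω (r l) n →
      n = rot (deriv r l) ∨ n = -rot (deriv r l) := fun l n hn =>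
    eq_or_eq_neg_rot (hΩ.arcLength l) hn.1 (hΩ.inner_normal_deriv hn)
  have hex : ∀ l, ∃ n, IsOuterUnitNormal Ω (r l) n := fun l =>
    exists_isOuterUnitNormal hΩ.isOpen hΩ.convex hΩ.nonempty (hΩ.mem_frontier l)
  -- the sign of `D l` decides between the two unit vectors orthogonal to the tangent; it is
  -- constant, as `|D l|` is at least the radius of a ball around `p`
  set D : ℝ → ℝ := fun l => inner ℝ (rot (deriv r l)) (r l - p) with hD
  have hDc : Continuous D := by
    have := hΩ.contDiff_deriv.continuous
    have := hΩ.differentiable.continuous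
    fun_prop
  have hpos : ∀ l, 0 < D l → ∀ n, IsOuterUnitNormal Ω (r l) n → n = rot (deriv r l) := by
    intro l hl n hn
    rcases key l n hn with h | h
    · exact h
    · have h2 := hn.radius_le hρ.le hp
      rw [h, inner_neg_left] at h2
      simp only [hD] at hl; linarith
  have hneg : ∀ l, D l < 0 → ∀ n, IsOuterUnitNormal Ω (r l) n → n = -rot (deriv r l) := by
    intro l hl n hn
    rcases key l n hn with h | h
    · have h2 := hn.radius_le hρ.le hp
      rw [h] at h2
      simp only [hD] at hl; linarith
    · exact h
  have hne : ∀ l, D l ≠ 0 := by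
    intro l hl
    obtain ⟨n, hn⟩ := hex l
    have h2 := hn.radius_le hρ.le hp
    simp only [hD] at hl
    rcases key l n hn with h | h <;> rw [h] at h2
    · linarith
    · rw [inner_neg_left] at h2; linarith
  have hsign : (∀ l, 0 < D l) ∨ ∀ l, D l < 0 := by
    by_contra hcon
    push Not at hcon
    obtain ⟨⟨a, ha⟩, b, hb⟩ := hcon
    obtain ⟨c, hc⟩ := mem_range_of_exists_le_of_exists_ge hDc ⟨a, ha⟩ ⟨b, hb⟩
    exact hne c hc
  rcases hsign with h | h
  · refine ⟨1, Or.inl rfl, fun l => ?_⟩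
    obtain ⟨n, hn⟩ := hex l
    rw [one_smul]
    exact ⟨hpos l (h l) n hn ▸ hn, hpos l (h l)⟩
  · refine ⟨-1, Or.inr rfl, fun l => ?_⟩
    obtain ⟨n, hn⟩ := hex l
    rw [neg_one_smul]
    exact ⟨hneg l (h l) n hn ▸ hn, hneg l (h l)⟩

/-- The arc length parameters of a boundary point differ by multiples of the length. -/
lemma exists_eq_add_mul (hΩ : IsConvexC5Domain Ω L r) {a b : ℝ} (hab : r a = r b) :
    ∃ k : ℤ, a - b = k * L := by
  have hL := hΩ.length_pos
  have hmod : ∀ s, r (toIcoMod hL 0 s) = r s := fun s => by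
    have := hΩ.periodic.sub_zsmul_eq (x := s) (toIcoDiv hL 0 s)
    rwa [self_sub_toIcoDiv_zsmul] at this
  have hm : ∀ s, toIcoMod hL 0 s ∈ Ico 0 L := fun s => toIcoMod_mem_Ico' hL s
  have h := hΩ.injOn (hm a) (hm b) (by rw [hmod, hmod, hab])
  refine ⟨toIcoDiv hL 0 a - toIcoDiv hL 0 b, ?_⟩
  have h1 := self_sub_toIcoDiv_zsmul hL 0 a
  have h2 := self_sub_toIcoDiv_zsmul hL 0 b
  simp only [zsmul_eq_mul] at h1 h2
  push_cast
  linarith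

lemma exists_lipschitz_deriv (hΩ : IsConvexC5Domain Ω L r) :
    ∃ K, 0 ≤ K ∧ ∀ l l', ‖deriv r l - deriv r l'‖ ≤ K * |l - l'| := by
  have hper : Function.Periodic (deriv (deriv r)) L := by
    intro l
    have h : (fun x => deriv r (x + L)) = deriv r := funext hΩ.periodic_deriv
    rw [← deriv_comp_add_const, h]
  have hc : Continuous (deriv (deriv r)) := hΩ.contDiff_deriv.continuous_deriv (by norm_num)
  obtain ⟨K, hK⟩ := (hper.isBounded_of_continuous hΩ.length_pos.ne' hc).exists_norm_le
  have hK' : ∀ l, ‖deriv (deriv r) l‖ ≤ K := fun l => hK _ (mem_range_self l)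
  refine ⟨K, (norm_nonneg _).trans (hK' 0), fun l l' => ?_⟩
  have := Convex.norm_image_sub_le_of_norm_deriv_le (f := deriv r) (s := univ) (C := K)
    (fun s _ => (hΩ.contDiff_deriv.differentiable (by norm_num)) s) (fun s _ => hK' s) convex_univ
    (mem_univ l') (mem_univ l)
  simpa using this

/-- Nearby boundary points are joined by an arc of at most twice their distance. -/
lemma exists_chord_arc (hΩ : IsConvexC5Domain Ω L r) :
    ∃ c > 0, ∀ x ∈ frontier Ω, ∀ z ∈ frontier Ω, ‖x - z‖ < c →
      ∃ l l', r l = x ∧ r l' = z ∧ |l - l'| ≤ 2 * ‖x - z‖ := by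
  have hL := hΩ.length_pos
  obtain ⟨K, hK, hKd⟩ := hΩ.exists_lipschitz_deriv
  set ε : ℝ := 1 / (2 * K + 1) with hεdef
  have hε : 0 < ε := by positivity
  have hεd : ∀ s l', |s - l'| < ε → ‖deriv r s - deriv r l'‖ ≤ 1 / 2 := by
    intro s l' hs
    refine (hKd s l').trans ?_
    have h1 : K * |s - l'| ≤ K * ε := mul_le_mul_of_nonneg_left hs.le hK
    have h2 : K * ε ≤ 1 / 2 := by
      rw [hεdef, mul_one_div, div_le_div_iff₀ (by positivity) (by norm_num)]
      linarith
    exact h1.trans h2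
  -- on arcs shorter than `ε` the tangent turns by at most `1 / 2`, so they are almost straight
  have hshort : ∀ l l', |l - l'| < ε → |l - l'| ≤ 2 * ‖r l - r l'‖ := by
    intro l l' hll
    have h1 : ‖(r l - l • deriv r l') - (r l' - l' • deriv r l')‖ ≤ 1 / 2 * ‖l - l'‖ := by
      refine Convex.norm_image_sub_le_of_norm_hasDerivWithin_le
        (f := fun s => r s - s • deriv r l') (f' := fun s => deriv r s - deriv r l')
        (s := ball l' ε) (fun s _ => ?_) (fun s hs => ?_) (convex_ball l' ε)
        (mem_ball_self hε) (by simpa [Real.dist_eq] using hll)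
      · have h := (hΩ.hasDerivAt s).sub ((hasDerivAt_id s).smul_const (deriv r l'))
        rw [one_smul] at h
        exact h.hasDerivWithinAt
      · exact hεd s l' (by simpa [Real.dist_eq] using hs)
    have h2 : (r l - l • deriv r l') - (r l' - l' • deriv r l')
        = (r l - r l') - (l - l') • deriv r l' := by rw [sub_smul]; abel
    have h3 : ‖(l - l') • deriv r l'‖ ≤ ‖r l - r l'‖ + ‖(r l - r l') - (l - l') • deriv r l'‖ := by
      have := norm_sub_le (r l - r l') ((r l - r l') - (l - l') • deriv r l')
      rwa [sub_sub_cancel] at this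
    rw [norm_smul, hΩ.arcLength, mul_one, Real.norm_eq_abs] at h3
    rw [h2, Real.norm_eq_abs] at h1
    linarith
  -- points with both arcs between them longer than `ε` are far apart, as the curve is simple
  have hcomp : IsCompact (Icc 0 L ×ˢ Icc ε (L - ε)) := isCompact_Icc.prod isCompact_Icc
  have hrc : Continuous r := hΩ.differentiable.continuous
  obtain ⟨c, hc, hcK⟩ := hcomp.exists_forall_le' (f := fun q : ℝ × ℝ => ‖r (q.1 + q.2) - r q.1‖)
    (a := 0) (by fun_prop) (by
      rintro ⟨l, d⟩ ⟨-, hd⟩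
      rw [norm_pos_iff, sub_ne_zero]
      intro heq
      obtain ⟨k, hk⟩ := hΩ.exists_eq_add_mul heq
      simp only [add_sub_cancel_left] at hk
      simp only [mem_Icc] at hd
      have h0 : (0 : ℝ) < k := by
        by_contra hn
        push Not at hn
        nlinarith
      have h1 : (k : ℝ) < 1 := by
        by_contra hn
        push Not at hn
        nlinarith
      have h0' : 0 < k := by exact_mod_cast h0
      have h1' : k < 1 := by exact_mod_cast h1
      omega)
  refine ⟨c, hc, fun x hx z hz hxz => ?_⟩
  rw [← hΩ.range_eq] at hx hz
  obtain ⟨l₀, rfl⟩ := hx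
  obtain ⟨l₁, rfl⟩ := hz
  have hmod : ∀ b s, r (toIcoMod hL b s) = r s := fun b s => by
    have := hΩ.periodic.sub_zsmul_eq (x := s) (toIcoDiv hL b s)
    rwa [self_sub_toIcoDiv_zsmul] at this
  set l' := toIcoMod hL 0 l₁
  set l := toIcoMod hL l' l₀
  have hl' : l' ∈ Ico 0 L := toIcoMod_mem_Ico' hL l₁
  have hl : l ∈ Ico l' (l' + L) := toIcoMod_mem_Ico hL l' l₀
  have e1 : r l' = r l₁ := hmod 0 l₁
  have e0 : r l = r l₀ := hmod l' l₀
  simp only [mem_Ico] at hl hl'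
  rcases lt_or_ge (l - l') ε with h | h
  · refine ⟨l, l', e0, e1, ?_⟩
    rw [← e0, ← e1]
    exact hshort _ _ (by rw [abs_of_nonneg (by linarith)]; exact h)
  · rcases lt_or_ge (L - ε) (l - l') with h2 | h2
    · have e2 : r (l - L) = r l := hΩ.periodic.sub_eq l
      refine ⟨l - L, l', by rw [e2, e0], e1, ?_⟩
      rw [← e0, ← e1, ← e2]
      refine hshort _ _ ?_
      rw [abs_of_nonpos (by linarith)]
      linarith
    · exfalso
      have := hcK (l', l - l') ⟨⟨hl'.1, hl'.2.le⟩, h, h2⟩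
      simp only [add_sub_cancel, e0, e1] at this
      linarith

lemma exists_lipschitz_boundary (hΩ : IsConvexC5Domain Ω L r) {h : Plane → ℝ}
    (hh : ContDiff ℝ 1 fun l => h (r l)) :
    ∃ K, 0 ≤ K ∧ ∀ l l', |h (r l) - h (r l')| ≤ K * |l - l'| := by
  have hp0 : Function.Periodic (fun l => h (r l)) L := fun l => by simp only [hΩ.periodic l]
  have hper : Function.Periodic (deriv fun l => h (r l)) L := by
    intro l
    have e : (fun x => (fun l => h (r l)) (x + L)) = fun l => h (r l) := funext hp0
    rw [← deriv_comp_add_const, e]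
  have hc : Continuous (deriv fun l => h (r l)) := hh.continuous_deriv (by norm_num)
  obtain ⟨K, hK⟩ := (hper.isBounded_of_continuous hΩ.length_pos.ne' hc).exists_norm_le
  have hK' : ∀ l, ‖deriv (fun l => h (r l)) l‖ ≤ K := fun l => hK _ (mem_range_self l)
  refine ⟨K, (norm_nonneg _).trans (hK' 0), fun l l' => ?_⟩
  have := Convex.norm_image_sub_le_of_norm_deriv_le (f := fun l => h (r l)) (s := univ) (C := K)
    (fun s _ => (hh.differentiable (by norm_num)) s) (fun s _ => hK' s) convex_univ
    (mem_univ l') (mem_univ l)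
  simpa using this

/-- The normal and the boundary datum are Lipschitz continuous along the boundary, with respect to
the distance in the plane. -/
lemma exists_lipschitz_normal (hΩ : IsConvexC5Domain Ω L r) {h : Plane → ℝ}
    (hh : ContDiff ℝ 1 fun l => h (r l)) :
    ∃ c > 0, ∃ K > 0, ∀ x ∈ frontier Ω, ∀ z ∈ frontier Ω, ‖x - z‖ < c →
      ∀ n m, IsOuterUnitNormal Ω x n → IsOuterUnitNormal Ω z m →
        ‖n - m‖ ≤ K * ‖x - z‖ ∧ |h x - h z| ≤ K * ‖x - z‖ := by
  obtain ⟨σ, hσ, hn⟩ := hΩ.exists_orientation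
  obtain ⟨c, hc, hca⟩ := hΩ.exists_chord_arc
  obtain ⟨K₁, hK₁, h₁⟩ := hΩ.exists_lipschitz_deriv
  obtain ⟨K₂, hK₂, h₂⟩ := hΩ.exists_lipschitz_boundary hh
  refine ⟨c, hc, 2 * (K₁ + K₂ + 1), by positivity, fun x hx z hz hxz n m hxn hzm => ?_⟩
  obtain ⟨l, l', rfl, rfl, hll⟩ := hca x hx z hz hxz
  have hσ1 : |σ| = 1 := by rcases hσ with h | h <;> simp [h]
  have hN := norm_nonneg (r l - r l')
  constructor
  · rw [(hn l).2 n hxn, (hn l').2 m hzm, ← smul_sub, ← map_sub, norm_smul, norm_rot,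
      Real.norm_eq_abs, hσ1, one_mul]
    refine (h₁ l l').trans ?_
    nlinarith
  · refine (h₂ l l').trans ?_
    nlinarith

/-- At a boundary maximum of a function on the closed domain, the gradient is a nonnegative multiple
of the outer normal. -/
lemma gradient_of_isLocalMaxOn (hΩ : IsConvexC5Domain Ω L r) {F : Plane → ℝ} {x n g : Plane}
    (hx : x ∈ frontier Ω) (hn : IsOuterUnitNormal Ω x n)
    (hF : HasGradientWithinAt F g (closure Ω) x) (hmax : IsLocalMaxOn F (closure Ω) x) :
    ∃ c : ℝ, 0 ≤ c ∧ g = c • n := by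
  obtain ⟨p, ρ, hρ, hp⟩ := hΩ.exists_closedBall
  have hrange := hx
  rw [← hΩ.range_eq] at hrange
  obtain ⟨l, rfl⟩ := hrange
  have hFd : HasFDerivWithinAt F (InnerProductSpace.toDual ℝ Plane g) (closure Ω) (r l) := hF
  have htan : inner ℝ g (deriv r l) = 0 := by
    have hd : HasDerivAt (F ∘ r) (InnerProductSpace.toDual ℝ Plane g (deriv r l)) l :=
      hFd.comp_hasDerivAt l (hΩ.hasDerivAt l) (Eventually.of_forall hΩ.mem_closure)
    have hm : IsLocalMax (F ∘ r) l := by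
      have ht : Tendsto r (𝓝 l) (𝓝[closure Ω] (r l)) :=
        tendsto_nhdsWithin_iff.2 ⟨(hΩ.hasDerivAt l).continuousAt,
          Eventually.of_forall hΩ.mem_closure⟩
      exact ht.eventually hmax
    simpa using hm.hasDerivAt_eq_zero hd
  have hg : g = inner ℝ g n • n := by
    have h1 := eq_add_rot (hΩ.arcLength l) g
    rw [htan, zero_smul, zero_add] at h1
    rcases eq_or_eq_neg_rot (hΩ.arcLength l) hn.1 (hΩ.inner_normal_deriv hn) with h | h
    · rw [h]; exact h1
    · rw [h, inner_neg_right, neg_smul, smul_neg, neg_neg]; exact h1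
  refine ⟨inner ℝ g n, ?_, hg⟩
  have hcone : p - r l ∈ posTangentConeAt (closure Ω) (r l) := by
    refine mem_posTangentConeAt_of_segment_subset ?_
    rw [add_sub_cancel]
    exact hΩ.convex.closure.segment_subset (hΩ.mem_closure l)
      (subset_closure (hp (mem_closedBall_self hρ.le)))
  have h2 := hmax.hasFDerivWithinAt_nonpos hFd hcone
  rw [InnerProductSpace.toDual_apply_apply, hg, real_inner_smul_left] at h2
  have h3 := hn.radius_le hρ.le hp
  have h4 : inner ℝ n (p - r l) = -inner ℝ n (r l - p) := by rw [← inner_neg_right, neg_sub]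
  rw [h4] at h2
  nlinarith

end IsConvexC5Domain

/-! ### A two-point maximum principle -/

lemma hasFDerivAt_norm_sub {x y : Plane} (hxy : x ≠ y) :
    HasFDerivAt (fun u : Plane => ‖u - y‖) (innerSL ℝ (‖x - y‖⁻¹ • (x - y))) x := by
  have hpos : 0 < ‖x - y‖ := norm_pos_iff.2 (sub_ne_zero.2 hxy)
  have h1 : HasFDerivAt (fun u : Plane => ‖u - y‖ ^ 2) (2 • innerSL ℝ (x - y)) x := by
    exact (hasStrictFDerivAt_norm_sq (x - y)).hasFDerivAt.comp x
      ((hasFDerivAt_id x).sub_const y)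
  have h2 := h1.sqrt (by positivity)
  have h3 : (fun u : Plane => √(‖u - y‖ ^ 2)) = fun u => ‖u - y‖ := by
    ext u; exact Real.sqrt_sq (norm_nonneg _)
  rw [h3] at h2
  refine h2.congr_fderiv ?_
  ext v
  simp [Real.sqrt_sq hpos.le]
  field_simp

/-- The second derivative test, for a maximum. -/
lemma second_deriv_nonpos {g g' : ℝ → ℝ} {a : ℝ} (hg : ∀ᶠ s in 𝓝 0, HasDerivAt g (g' s) s)
    (hg' : HasDerivAt g' a 0) (hmax : IsLocalMax g 0) : a ≤ 0 := by
  by_contra! ha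
  have hd : deriv g =ᶠ[𝓝 0] g' := hg.mono fun s hs => hs.deriv
  have hdd : deriv (deriv g) 0 = a := by rw [hd.deriv_eq, hg'.deriv]
  have hmin : IsLocalMin g 0 :=
    isLocalMin_of_deriv_deriv_pos (by rw [hdd]; exact ha) hmax.deriv_eq_zero
      hg.self_of_nhds.continuousAt
  have hconst : g =ᶠ[𝓝 0] fun _ => g 0 := by
    filter_upwards [hmin, hmax] with s h1 h2 using le_antisymm h2 h1
  have h0 : deriv (deriv g) 0 = 0 := by
    rw [hconst.deriv.deriv_eq]; simp
  linarith

lemma hasDerivAt_line {φ : Plane → ℝ} {x : Plane} (hφ : ContDiffAt ℝ 2 φ x) (v : Plane) :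
    (∀ᶠ s in 𝓝 (0 : ℝ), HasDerivAt (fun s : ℝ => φ (x + s • v)) (fderiv ℝ φ (x + s • v) v) s) ∧
      HasDerivAt (fun s : ℝ => fderiv ℝ φ (x + s • v) v) (fderiv ℝ (fderiv ℝ φ) x v v) 0 := by
  have hline : ∀ s : ℝ, HasDerivAt (fun s : ℝ => x + s • v) v s := fun s => by
    simpa using ((hasDerivAt_id s).smul_const v).const_add x
  have hx0 : x + (0 : ℝ) • v = x := by simp
  constructor
  · have h1 : ∀ᶠ y in 𝓝 x, DifferentiableAt ℝ φ y :=
      (hφ.eventually (by simp)).mono fun y hy => hy.differentiableAt (by norm_num)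
    have ht : Tendsto (fun s : ℝ => x + s • v) (𝓝 0) (𝓝 x) := by
      have := (hline 0).continuousAt.tendsto
      rwa [hx0] at this
    filter_upwards [ht.eventually h1] with s hs
    exact hs.hasFDerivAt.comp_hasDerivAt s (hline s)
  · have h2 : DifferentiableAt ℝ (fderiv ℝ φ) (x + (0 : ℝ) • v) := by
      rw [hx0]
      exact (hφ.fderiv_right (m := 1) (by norm_num)).differentiableAt (by norm_num)
    have h3 := h2.hasFDerivAt.comp_hasDerivAt (0 : ℝ) (hline 0)
    have h4 := h3.clm_apply (hasDerivAt_const (0 : ℝ) v)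
    simpa using h4

lemma laplacian_eq_frame (φ : Plane → ℝ) (x : Plane) {e : Plane} (he : ‖e‖ = 1) :
    Laplacian.laplacian φ x = fderiv ℝ (fderiv ℝ φ) x e e
      + fderiv ℝ (fderiv ℝ φ) x (rot e) (rot e) := by
  rw [InnerProductSpace.laplacian_eq_iteratedFDeriv_orthonormalBasis φ
    (EuclideanSpace.basisFun (Fin 2) ℝ)]
  simp only [Fin.sum_univ_two, iteratedFDeriv_two_apply]
  set D := fderiv ℝ (fderiv ℝ φ) x
  set b0 : Plane := EuclideanSpace.basisFun (Fin 2) ℝ 0 with hb0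
  set b1 : Plane := EuclideanSpace.basisFun (Fin 2) ℝ 1 with hb1
  have h : e 0 ^ 2 + e 1 ^ 2 = 1 := by rw [← norm_sq_eq_coord, he]; norm_num
  have e1 : e = e 0 • b0 + e 1 • b1 := by
    ext i; fin_cases i <;> simp [hb0, hb1]
  have e2 : rot e = (-e 1) • b0 + e 0 • b1 := by
    ext i; fin_cases i <;> simp [hb0, hb1]
  rw [e2]
  nth_rewrite 1 [e1]
  nth_rewrite 3 [e1]
  simp only [map_add, map_smul, add_apply, smul_apply,
    smul_eq_mul, Matrix.cons_val_zero, Matrix.cons_val_one]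
  linear_combination -(D b0 b0 + D b1 b1) * h

/-- The second-order condition at a maximum of `φ x - φ y - ω |x - y| - ⋯` in the interior. -/
lemma laplacian_sub_le {φ : Plane → ℝ} {x y e : Plane} (hx : ContDiffAt ℝ 2 φ x)
    (hy : ContDiffAt ℝ 2 φ y) (he : ‖e‖ = 1) {c : ℝ}
    (hmax : ∀ᶠ s in 𝓝 (0 : ℝ),
      φ (x + s • e) + φ (x + s • (-e)) + φ (x + s • rot e) + φ (x + s • (-rot e))
        - (φ (y + s • e) + φ (y + s • (-e)) + φ (y + s • rot e) + φ (y + s • (-rot e)))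
        + c * s ^ 2 ≤ 4 * φ x - 4 * φ y) :
    Laplacian.laplacian φ x - Laplacian.laplacian φ y + c ≤ 0 := by
  have hx1 := hasDerivAt_line hx e
  have hx2 := hasDerivAt_line hx (-e)
  have hx3 := hasDerivAt_line hx (rot e)
  have hx4 := hasDerivAt_line hx (-rot e)
  have hy1 := hasDerivAt_line hy e
  have hy2 := hasDerivAt_line hy (-e)
  have hy3 := hasDerivAt_line hy (rot e)
  have hy4 := hasDerivAt_line hy (-rot e)
  have hc : ∀ s : ℝ, HasDerivAt (fun s : ℝ => c * s ^ 2) (c * (2 * s)) s := fun s => by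
    simpa using (hasDerivAt_pow 2 s).const_mul c
  have hc' : HasDerivAt (fun s : ℝ => c * (2 * s)) (c * (2 * 1)) 0 :=
    ((hasDerivAt_id (0 : ℝ)).const_mul 2).const_mul c
  have h2 := ((((hx1.2.add hx2.2).add hx3.2).add hx4.2).sub
    (((hy1.2.add hy2.2).add hy3.2).add hy4.2)).add hc'
  have h := second_deriv_nonpos (g := fun s : ℝ =>
      φ (x + s • e) + φ (x + s • (-e)) + φ (x + s • rot e) + φ (x + s • (-rot e))
        - (φ (y + s • e) + φ (y + s • (-e)) + φ (y + s • rot e) + φ (y + s • (-rot e)))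
        + c * s ^ 2) (by
    filter_upwards [hx1.1, hx2.1, hx3.1, hx4.1, hy1.1, hy2.1, hy3.1, hy4.1]
      with s a1 a2 a3 a4 b1 b2 b3 b4
    exact ((((a1.add a2).add a3).add a4).sub (((b1.add b2).add b3).add b4)).add (hc s)) h2 (by
    filter_upwards [hmax] with s hs
    refine hs.trans (le_of_eq ?_)
    simp; ring)
  simp only [map_neg, neg_apply, neg_neg] at h
  rw [laplacian_eq_frame φ x he, laplacian_eq_frame φ y he]
  linarith

namespace IsConvexC5Domain
variable {Ω : Set Plane} {L : ℝ} {r : ℝ → Plane}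

lemma fderivWithin_normal_nonneg (hΩ : IsConvexC5Domain Ω L r) {F : Plane → ℝ} {x n : Plane}
    {F' : Plane →L[ℝ] ℝ} (hx : x ∈ frontier Ω) (hn : IsOuterUnitNormal Ω x n)
    (hF : HasFDerivWithinAt F F' (closure Ω) x) (hmax : IsLocalMaxOn F (closure Ω) x) :
    0 ≤ F' n := by
  obtain ⟨c, hc, hg⟩ := hΩ.gradient_of_isLocalMaxOn
    (g := (InnerProductSpace.toDual ℝ Plane).symm F') hx hn
    (by
      rw [HasGradientWithinAt, HasGradientAtFilter, LinearIsometryEquiv.apply_symm_apply]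
      exact hF) hmax
  have h1 : F' n = inner ℝ ((InnerProductSpace.toDual ℝ Plane).symm F') n := by simp
  rw [h1, hg, real_inner_smul_left, real_inner_self_eq_norm_sq, hn.1]
  simpa using hc

end IsConvexC5Domain

/-- `φ` is a classical solution of `0 ≤ Δφ ≤ R` in `Ω` with the Neumann datum `h`. -/
structure IsNeumannSolution (Ω : Set Plane) (h : Plane → ℝ) (R : ℝ) (φ : Plane → ℝ) : Prop where
  contDiffOn : ContDiffOn ℝ 2 φ Ω
  differentiableOn : DifferentiableOn ℝ φ (closure Ω)
  continuousOn_gradient : ContinuousOn (gradientWithin φ (closure Ω)) (closure Ω)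
  laplacian_nonneg : ∀ x ∈ Ω, 0 ≤ Laplacian.laplacian φ x
  laplacian_le : ∀ x ∈ Ω, Laplacian.laplacian φ x ≤ R
  neumann : ∀ x ∈ frontier Ω, ∀ n, IsOuterUnitNormal Ω x n →
    inner ℝ (gradientWithin φ (closure Ω) x) n = h x

lemma IsNeumannSolution.hasFDerivWithinAt {Ω : Set Plane} {h φ : Plane → ℝ} {R : ℝ}
    (hφ : IsNeumannSolution Ω h R φ) {x : Plane} (hx : x ∈ closure Ω) :
    HasFDerivWithinAt φ (innerSL ℝ (gradientWithin φ (closure Ω) x)) (closure Ω) x :=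
  (hφ.differentiableOn x hx).hasGradientWithinAt

/-- The modulus of continuity of a solution of the Neumann problem near `z`, by doubling the
variables: the maximum of
`φ x - φ y - (4 B δ |x - y| - B |x - y| ^ 2) - ⟨b, x - y⟩ - P x - P y`
over pairs of points at distance at most `δ` from `z` is not positive. The penalty `P` keeps it
away from the sphere around `z`, and outweighs the datum `h` at the boundary of `Ω`. -/
lemma two_point_estimate {Ω : Set Plane} {L : ℝ} {r : ℝ → Plane} (hΩ : IsConvexC5Domain Ω L r)
    {h φ P : Plane → ℝ} {R Λ B O δ : ℝ} {z b : Plane} (hφ : IsNeumannSolution Ω h R φ)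
    (hδ : 0 < δ) (hB : 0 < B) (hRB : R + 4 * Λ < 8 * B) (hPc : Continuous P)
    (hP0 : ∀ x ∈ closure Ω, ‖x - z‖ ≤ δ → 0 ≤ P x)
    (hPs : ∀ x ∈ closure Ω, ‖x - z‖ = δ → O + 2 * δ * ‖b‖ ≤ P x)
    (hO : ∀ x ∈ closure Ω, ∀ y ∈ closure Ω, ‖x - z‖ ≤ δ → ‖y - z‖ ≤ δ → φ x - φ y ≤ O)
    (hPd : ∀ u v, P (u + v) + P (u - v) - 2 * P u ≤ Λ * ‖v‖ ^ 2)
    (hPb : ∀ x ∈ frontier Ω, ‖x - z‖ < δ → ∃ P' : Plane →L[ℝ] ℝ, HasFDerivAt P P' x ∧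
      ∀ n, IsOuterUnitNormal Ω x n → |h x - inner ℝ b n| < P' n)
    {x₁ y₁ : Plane} (hx₁ : x₁ ∈ closure Ω) (hy₁ : y₁ ∈ closure Ω) (hx₁z : ‖x₁ - z‖ ≤ δ)
    (hy₁z : ‖y₁ - z‖ ≤ δ) :
    φ x₁ - φ y₁ ≤ 4 * B * δ * ‖x₁ - y₁‖ - B * ‖x₁ - y₁‖ ^ 2 + inner ℝ b (x₁ - y₁)
      + P x₁ + P y₁ := by
  set Z : Plane × Plane → ℝ := fun q =>
    φ q.1 - φ q.2 - (4 * B * δ * ‖q.1 - q.2‖ - B * ‖q.1 - q.2‖ ^ 2) - inner ℝ b (q.1 - q.2)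
      - P q.1 - P q.2 with hZ
  set K : Set Plane := closure Ω ∩ {x | ‖x - z‖ ≤ δ} with hK
  have hKc : IsCompact K := by
    refine hΩ.isCompact_closure.inter_right (isClosed_le (by fun_prop) continuous_const)
  have hφc : ContinuousOn φ (closure Ω) := hφ.differentiableOn.continuousOn
  have hZc : ContinuousOn Z (K ×ˢ K) := by
    have h1 : ContinuousOn (fun q : Plane × Plane => φ q.1) (K ×ˢ K) :=
      hφc.comp continuousOn_fst fun q hq => hq.1.1
    have h2 : ContinuousOn (fun q : Plane × Plane => φ q.2) (K ×ˢ K) :=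
      hφc.comp continuousOn_snd fun q hq => hq.2.1
    have h3 : ContinuousOn (fun q : Plane × Plane =>
        (4 * B * δ * ‖q.1 - q.2‖ - B * ‖q.1 - q.2‖ ^ 2) + inner ℝ b (q.1 - q.2) + P q.1 + P q.2)
        (K ×ˢ K) := by fun_prop
    refine ((h1.sub h2).sub h3).congr fun q _ => ?_
    simp only [hZ, Pi.sub_apply]
    ring
  obtain ⟨⟨x, y⟩, ⟨⟨hx, hxz⟩, hy, hyz⟩, hmax⟩ := (hKc.prod hKc).exists_isMaxOn
    ⟨(x₁, y₁), ⟨hx₁, hx₁z⟩, hy₁, hy₁z⟩ hZc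
  simp only [mem_ofPred_eq] at hx hxz hy hyz
  suffices hle : Z (x, y) ≤ 0 by
    have := hmax (show (x₁, y₁) ∈ K ×ˢ K from ⟨⟨hx₁, hx₁z⟩, hy₁, hy₁z⟩)
    simp only [mem_ofPred_eq] at this
    have h2 := this.trans hle
    simp only [hZ] at h2
    linarith
  by_contra! hpos
  have hxy : x ≠ y := by
    rintro rfl
    have := hP0 x hx hxz
    simp only [hZ, sub_self, norm_zero, inner_zero_right] at hpos
    nlinarith
  have hd0 : 0 < ‖x - y‖ := norm_pos_iff.2 (sub_ne_zero.2 hxy)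
  have hd2 : ‖x - y‖ ≤ 2 * δ := by
    have := norm_sub_le (x - z) (y - z)
    rw [sub_sub_sub_cancel_right] at this
    linarith
  have hω : 0 ≤ 4 * B * δ * ‖x - y‖ - B * ‖x - y‖ ^ 2 := by
    have : B * ‖x - y‖ ^ 2 ≤ B * (4 * δ * ‖x - y‖) := by
      refine mul_le_mul_of_nonneg_left ?_ hB.le
      nlinarith
    linarith
  have hbxy : -inner ℝ b (x - y) ≤ 2 * δ * ‖b‖ := by
    have h1 := abs_real_inner_le_norm b (x - y)
    have h2 := neg_abs_le (inner ℝ b (x - y))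
    have h3 := mul_le_mul_of_nonneg_left hd2 (norm_nonneg b)
    linarith
  have hosc := hO x hx y hy hxz hyz
  have hpos' := hpos
  simp only [hZ] at hpos'
  have hxz' : ‖x - z‖ < δ := by
    refine lt_of_le_of_ne hxz fun heq => ?_
    have h1 := hPs x hx heq
    have h2 := hP0 y hy hyz
    linarith
  have hyz' : ‖y - z‖ < δ := by
    refine lt_of_le_of_ne hyz fun heq => ?_
    have h1 := hPs y hy heq
    have h2 := hP0 x hx hxz
    linarith
  have hnear : ∀ u : Plane, ‖u - z‖ < δ → ∀ᶠ v in 𝓝 u, ‖v - z‖ ≤ δ := fun u hu => by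
    have : ∀ᶠ v in 𝓝 u, ‖v - z‖ < δ :=
      (show Continuous fun v : Plane => ‖v - z‖ by fun_prop).continuousAt.eventually_lt
        continuousAt_const hu
    exact this.mono fun v hv => hv.le
  have hω' : 0 ≤ 4 * B * δ - B * (2 * ‖x - y‖) := by nlinarith
  -- the point `x` is not on the boundary
  have hxΩ : x ∈ Ω := by
    refine (hΩ.mem_or_frontier hx).resolve_right fun hxf => ?_
    obtain ⟨n, hn⟩ := exists_isOuterUnitNormal hΩ.isOpen hΩ.convex hΩ.nonempty hxf
    obtain ⟨P', hP', hPn⟩ := hPb x hxf hxz'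
    have hder := ((((hφ.hasFDerivWithinAt hx).sub_const (φ y)).sub
      (((hasFDerivAt_norm_sub hxy).const_mul (4 * B * δ)).sub
        (((hasFDerivAt_norm_sub hxy).pow 2).const_mul B)).hasFDerivWithinAt).sub
      (((innerSL ℝ b).hasFDerivAt.comp x ((hasFDerivAt_id x).sub_const y)).hasFDerivWithinAt)).sub
      (hP'.hasFDerivWithinAt) |>.sub_const (P y)
    have hm : IsLocalMaxOn (fun u => Z (u, y)) (closure Ω) x := by
      filter_upwards [self_mem_nhdsWithin, nhdsWithin_le_nhds (hnear x hxz')] with u hu huz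
      exact hmax (show (u, y) ∈ K ×ˢ K from ⟨⟨hu, huz⟩, hy, hyz⟩)
    have h0 := hΩ.fderivWithin_normal_nonneg hxf hn hder hm
    have hneu : (fderivWithin ℝ φ (closure Ω) x) n = h x := by simpa using hφ.neumann x hxf n hn
    simp only [inner_gradientWithin_left, sub_apply, smul_apply, innerSL_apply_apply, hneu,
      real_inner_smul_left, ContinuousLinearMap.comp_apply, ContinuousLinearMap.id_apply,
      smul_eq_mul, nsmul_eq_mul] at h0
    have h1 := (abs_lt.1 (hPn n hn)).2
    have h2 : 0 ≤ inner ℝ (x - y) n := by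
      have := hn.closure_le hy
      rw [← neg_sub, inner_neg_right, real_inner_comm] at this
      linarith
    have h3 : 0 ≤ (4 * B * δ - B * (2 * ‖x - y‖)) * (‖x - y‖⁻¹ * inner ℝ (x - y) n) := by
      positivity
    norm_num at h0
    linarith
  -- the point `y` is not on the boundary
  have hyΩ : y ∈ Ω := by
    refine (hΩ.mem_or_frontier hy).resolve_right fun hyf => ?_
    obtain ⟨n, hn⟩ := exists_isOuterUnitNormal hΩ.isOpen hΩ.convex hΩ.nonempty hyf
    obtain ⟨P', hP', hPn⟩ := hPb y hyf hyz'
    have hder := ((((hφ.hasFDerivWithinAt hy).const_sub (φ x)).sub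
      (((hasFDerivAt_norm_sub hxy.symm).const_mul (4 * B * δ)).sub
        (((hasFDerivAt_norm_sub hxy.symm).pow 2).const_mul B)).hasFDerivWithinAt).sub
      (((innerSL ℝ b).hasFDerivAt.comp y ((hasFDerivAt_id y).const_sub x)).hasFDerivWithinAt))
      |>.sub_const (P x) |>.sub (hP'.hasFDerivWithinAt)
    have hm : IsLocalMaxOn (fun u => Z (x, u)) (closure Ω) y := by
      filter_upwards [self_mem_nhdsWithin, nhdsWithin_le_nhds (hnear y hyz')] with u hu huz
      exact hmax (show (x, u) ∈ K ×ˢ K from ⟨⟨hx, hxz⟩, hu, huz⟩)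
    have h0 := hΩ.fderivWithin_normal_nonneg hyf hn
      (HasFDerivWithinAt.congr' (f₁ := fun u => Z (x, u)) hder
        (fun u _ => by simp only [hZ, norm_sub_rev x u]; rfl) hy) hm
    have hneu : (fderivWithin ℝ φ (closure Ω) y) n = h y := by simpa using hφ.neumann y hyf n hn
    simp only [inner_gradientWithin_left, sub_apply, neg_apply, smul_apply, innerSL_apply_apply,
      hneu, real_inner_smul_left, ContinuousLinearMap.comp_apply, ContinuousLinearMap.id_apply,
      smul_eq_mul, nsmul_eq_mul, inner_neg_right] at h0
    have h1 := (abs_lt.1 (hPn n hn)).1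
    have h2 : 0 ≤ inner ℝ (y - x) n := by
      have := hn.closure_le hx
      rw [← neg_sub, inner_neg_right, real_inner_comm] at this
      linarith
    rw [norm_sub_rev] at hω'
    have h3 : 0 ≤ (4 * B * δ - B * (2 * ‖y - x‖)) * (‖y - x‖⁻¹ * inner ℝ (y - x) n) := by
      positivity
    norm_num at h0
    linarith
  -- the second-order condition
  set d := ‖x - y‖ with hd
  set e : Plane := d⁻¹ • (x - y) with he
  have he1 : ‖e‖ = 1 := by
    rw [he, norm_smul, norm_inv, Real.norm_eq_abs, abs_of_pos hd0, ← hd, inv_mul_cancel₀ hd0.ne']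
  have hxye : x - y = d • e := by rw [he, smul_smul, mul_inv_cancel₀ hd0.ne', one_smul]
  have hmem : ∀ u ∈ Ω, ‖u - z‖ < δ → ∀ v : Plane, ∀ᶠ s in 𝓝 (0 : ℝ), u + s • v ∈ K := by
    intro u hu huz v
    have ht : Tendsto (fun s : ℝ => u + s • v) (𝓝 0) (𝓝 u) := by
      have : Continuous fun s : ℝ => u + s • v := by fun_prop
      simpa using this.tendsto 0
    filter_upwards [ht.eventually (hΩ.isOpen.mem_nhds hu), ht.eventually (hnear u huz)]
      with s h1 h2 using ⟨subset_closure h1, h2⟩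
  have hsmall : ∀ᶠ s in 𝓝 (0 : ℝ), |s| < d / 2 := by
    have : ∀ᶠ s in 𝓝 (0 : ℝ), s ∈ ball (0 : ℝ) (d / 2) := ball_mem_nhds _ (by positivity)
    simpa using this
  have hfin := laplacian_sub_le (c := 8 * B - 4 * Λ)
    (hφ.contDiffOn.contDiffAt (hΩ.isOpen.mem_nhds hxΩ))
    (hφ.contDiffOn.contDiffAt (hΩ.isOpen.mem_nhds hyΩ)) he1 (by
    filter_upwards [hsmall, hmem x hxΩ hxz' e, hmem x hxΩ hxz' (-e), hmem x hxΩ hxz' (rot e),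
      hmem x hxΩ hxz' (-rot e), hmem y hyΩ hyz' e, hmem y hyΩ hyz' (-e), hmem y hyΩ hyz' (rot e),
      hmem y hyΩ hyz' (-rot e)] with s hs a1 a2 a3 a4 b1 b2 b3 b4
    have m1 := hmax (mk_mem_prod a1 b2)
    have m2 := hmax (mk_mem_prod a2 b1)
    have m3 := hmax (mk_mem_prod a3 b3)
    have m4 := hmax (mk_mem_prod a4 b4)
    have d1 : x + s • e - (y + s • (-e)) = (d + 2 * s) • e := by
      rw [add_smul, ← hxye, mul_smul, two_smul, smul_neg]; abel
    have d2 : x + s • (-e) - (y + s • e) = (d - 2 * s) • e := by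
      rw [sub_smul, ← hxye, mul_smul, two_smul, smul_neg]; abel
    have d3 : x + s • rot e - (y + s • rot e) = d • e := by rw [← hxye]; abel
    have d4 : x + s • (-rot e) - (y + s • (-rot e)) = d • e := by rw [← hxye]; abel
    have hs' := abs_lt.1 hs
    simp only [hZ, mem_ofPred_eq, d1, d2, d3, d4, hxye, norm_smul, he1, mul_one, Real.norm_eq_abs,
      inner_smul_right, abs_of_pos hd0, abs_of_pos (show 0 < d + 2 * s by linarith [hs'.1]),
      abs_of_pos (show 0 < d - 2 * s by linarith [hs'.2])] at m1 m2 m3 m4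
    have p1 := hPd x (s • e)
    have p2 := hPd x (s • rot e)
    have p3 := hPd y (s • e)
    have p4 := hPd y (s • rot e)
    simp only [norm_smul, norm_rot, he1, mul_one, Real.norm_eq_abs, sq_abs] at p1 p2 p3 p4
    simp only [smul_neg, ← sub_eq_add_neg] at m1 m2 m3 m4 ⊢
    linarith)
  have hl1 := hφ.laplacian_nonneg x hxΩ
  have hl2 := hφ.laplacian_le y hyΩ
  linarith

/-! ### Local gradient bounds for the Neumann problem -/

lemma norm_sq_second_difference (u v : Plane) :
    ‖u + v‖ ^ 2 + ‖u - v‖ ^ 2 - 2 * ‖u‖ ^ 2 = 2 * ‖v‖ ^ 2 := by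
  have := parallelogram_law_with_norm ℝ u v
  nlinarith

/-- The function `⟨u, m⟩ |u|` has bounded second differences, although it is not of class `C^2` at
the origin. -/
lemma inner_mul_norm_second_difference {m : Plane} (hm : ‖m‖ = 1) (u v : Plane) :
    inner ℝ (u + v) m * ‖u + v‖ + inner ℝ (u - v) m * ‖u - v‖ - 2 * (inner ℝ u m * ‖u‖)
      ≤ 3 * ‖v‖ ^ 2 := by
  have hpar := norm_sq_second_difference u v
  have hu := norm_nonneg u
  have hv := norm_nonneg v
  have ha := norm_nonneg (u + v)
  have hb := norm_nonneg (u - v)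
  have hiu : |inner ℝ u m| ≤ ‖u‖ := by simpa [hm] using abs_real_inner_le_norm u m
  have hiv : |inner ℝ v m| ≤ ‖v‖ := by simpa [hm] using abs_real_inner_le_norm v m
  have htri : 2 * ‖u‖ ≤ ‖u + v‖ + ‖u - v‖ := by
    have h1 := norm_add_le (u + v) (u - v)
    have h2 : u + v + (u - v) = (2 : ℝ) • u := by rw [two_smul]; abel
    rw [h2, norm_smul] at h1
    simpa using h1
  have hdiff : |‖u + v‖ - ‖u - v‖| ≤ 2 * ‖v‖ := by
    refine (abs_norm_sub_norm_le _ _).trans ?_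
    have h2 : u + v - (u - v) = (2 : ℝ) • v := by rw [two_smul]; abel
    rw [h2, norm_smul]
    simp
  have hconv : ‖u‖ * (‖u + v‖ + ‖u - v‖ - 2 * ‖u‖) ≤ ‖v‖ ^ 2 := by
    nlinarith [sq_nonneg (‖u + v‖ - ‖u - v‖), sq_nonneg (‖u + v‖ + ‖u - v‖ - 2 * ‖u‖)]
  have h1 : inner ℝ u m * (‖u + v‖ + ‖u - v‖ - 2 * ‖u‖)
      ≤ ‖u‖ * (‖u + v‖ + ‖u - v‖ - 2 * ‖u‖) :=
    mul_le_mul_of_nonneg_right ((le_abs_self _).trans hiu) (by linarith)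
  have h2 : inner ℝ v m * (‖u + v‖ - ‖u - v‖) ≤ ‖v‖ * (2 * ‖v‖) := by
    refine (le_abs_self _).trans ?_
    rw [abs_mul]
    exact mul_le_mul hiv hdiff (abs_nonneg _) hv
  rw [inner_add_left, inner_sub_left]
  nlinarith

lemma hasFDerivAt_norm_sub_sq (x z : Plane) :
    HasFDerivAt (fun u : Plane => ‖u - z‖ ^ 2) (2 • innerSL ℝ (x - z)) x := by
  exact (hasStrictFDerivAt_norm_sq (x - z)).hasFDerivAt.comp x ((hasFDerivAt_id x).sub_const z)

lemma hasFDerivAt_inner_mul_norm (x z m : Plane) :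
    HasFDerivAt (fun u : Plane => inner ℝ (u - z) m * ‖u - z‖)
      (‖x - z‖ • innerSL ℝ m + (inner ℝ (x - z) m * ‖x - z‖⁻¹) • innerSL ℝ (x - z)) x := by
  have hlin : HasFDerivAt (fun u : Plane => inner ℝ (u - z) m) (innerSL ℝ m) x := by
    have := (innerSL ℝ m).hasFDerivAt.comp x ((hasFDerivAt_id x).sub_const z)
    refine this.congr_of_eventuallyEq (Eventually.of_forall fun u => ?_)
    simp [real_inner_comm]
  by_cases hxz : x = z
  · subst hxz
    simp only [sub_self, norm_zero, zero_smul, inner_zero_left, zero_mul, add_zero]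
    rw [hasFDerivAt_iff_isLittleO]
    simp only [sub_self, inner_zero_left, zero_mul, sub_zero, zero_apply]
    refine Asymptotics.IsBigO.trans_isLittleO (g := fun u : Plane => ‖u - x‖ ^ 2)
      (Asymptotics.IsBigO.of_bound ‖m‖ (Eventually.of_forall fun u => ?_)) ?_
    · rw [norm_mul, norm_norm, Real.norm_eq_abs, norm_pow, norm_norm]
      have := abs_real_inner_le_norm (u - x) m
      nlinarith [norm_nonneg (u - x)]
    · have h0 : Tendsto (fun u : Plane => u - x) (𝓝 x) (𝓝 0) := by
        have : Continuous fun u : Plane => u - x := by fun_prop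
        simpa using this.tendsto x
      exact (Asymptotics.isLittleO_norm_pow_id (E' := Plane) one_lt_two).comp_tendsto h0
  · have h := hlin.mul (hasFDerivAt_norm_sub hxz)
    refine h.congr_fderiv ?_
    ext v
    simp [inner_sub_left]
    ring

lemma le_of_forall_pos_le_add_mul {a b c : ℝ} (h : ∀ η > 0, a ≤ b + η * c) : a ≤ b := by
  have ht : Tendsto (fun η : ℝ => b + η * c) (𝓝[>] 0) (𝓝 b) := by
    have hc : Continuous fun η : ℝ => b + η * c := by fun_prop
    have := hc.tendsto 0
    simp only [zero_mul, add_zero] at this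
    exact this.mono_left nhdsWithin_le_nhds
  exact ge_of_tendsto ht (eventually_mem_nhdsWithin.mono fun η hη => h η hη)

/-- The interior gradient bound. The penalty `k |x - z|²` suffices, as the ball does not meet the
boundary. -/
lemma IsNeumannSolution.gradient_le_of_ball {Ω : Set Plane} {L : ℝ} {r : ℝ → Plane}
    (hΩ : IsConvexC5Domain Ω L r) {h φ : Plane → ℝ} {R O d : ℝ} {z : Plane}
    (hφ : IsNeumannSolution Ω h R φ) (hR : 0 < R) (hd : 0 < d) (hz : closedBall z d ⊆ Ω)
    (hO0 : 0 ≤ O)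
    (hO : ∀ x ∈ closedBall z d, ∀ y ∈ closedBall z d, φ x - φ y ≤ O) :
    ‖gradientWithin φ (closure Ω) z‖ ≤ 4 * R * d + 9 * (O / d) := by
  set k := O / d ^ 2 with hk
  have hk0 : 0 ≤ k := by positivity
  have hkd : k * d = O / d := by rw [hk]; field_simp
  have hzΩ : z ∈ Ω := hz (mem_closedBall_self hd.le)
  have key : ∀ x₁ ∈ closure Ω, ∀ y₁ ∈ closure Ω, ‖x₁ - z‖ ≤ d → ‖y₁ - z‖ ≤ d →
      φ x₁ - φ y₁ ≤ 4 * (R + 2 * k) * d * ‖x₁ - y₁‖ - (R + 2 * k) * ‖x₁ - y₁‖ ^ 2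
        + inner ℝ (0 : Plane) (x₁ - y₁) + k * ‖x₁ - z‖ ^ 2 + k * ‖y₁ - z‖ ^ 2 := by
    intro x₁ hx₁ y₁ hy₁ hxz hyz
    refine two_point_estimate hΩ (P := fun x => k * ‖x - z‖ ^ 2) (Λ := 2 * k) (O := O) hφ hd
      (by positivity) (by linarith) (by fun_prop) (fun x _ _ => by positivity) ?_ ?_ ?_ ?_
      hx₁ hy₁ hxz hyz
    · intro x _ hx
      rw [hx, hk]
      simp
      field_simp
      exact le_rfl
    · intro x _ y _ hx hy
      exact hO x (by simpa [dist_eq_norm] using hx) y (by simpa [dist_eq_norm] using hy)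
    · intro u v
      have := norm_sq_second_difference (u - z) v
      rw [← add_sub_right_comm, sub_right_comm] at this
      linear_combination k * this
    · intro x hx hxz
      exfalso
      have : x ∈ Ω := hz (by simpa [dist_eq_norm] using hxz.le)
      rw [hΩ.isOpen.frontier_eq] at hx
      exact hx.2 this
  have hF : HasFDerivAt φ (innerSL ℝ (gradientWithin φ (closure Ω) z)) z :=
    (hφ.hasFDerivWithinAt (subset_closure hzΩ)).hasFDerivAt
      (mem_of_superset (hΩ.isOpen.mem_nhds hzΩ) subset_closure)
  have hb := hF.le_of_lip' (C := 4 * R * d + 9 * (O / d)) (by positivity) (by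
    filter_upwards [closedBall_mem_nhds z hd] with x hx
    have hxc : x ∈ closure Ω := subset_closure (hz hx)
    have hxz : ‖x - z‖ ≤ d := by simpa [dist_eq_norm] using hx
    have h1 := key x hxc z (subset_closure hzΩ) hxz (by simpa using hd.le)
    have h2 := key z (subset_closure hzΩ) x hxc (by simpa using hd.le) hxz
    rw [norm_sub_rev z x] at h2
    simp only [inner_zero_left, sub_self, norm_zero] at h1 h2
    have h3 : k * ‖x - z‖ ^ 2 ≤ k * d * ‖x - z‖ := by
      rw [mul_assoc]
      refine mul_le_mul_of_nonneg_left ?_ hk0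
      nlinarith [norm_nonneg (x - z)]
    have h4 : 0 ≤ (R + 2 * k) * ‖x - z‖ ^ 2 := by positivity
    rw [← hkd, Real.norm_eq_abs, abs_le]
    constructor <;> nlinarith)
  rwa [innerSL_apply_norm] at hb

lemma IsConvexC5Domain.exists_bound_boundary {Ω : Set Plane} {L : ℝ} {r : ℝ → Plane}
    (hΩ : IsConvexC5Domain Ω L r) {h : Plane → ℝ} (hh : ContDiff ℝ 1 fun l => h (r l)) :
    ∃ H, 0 ≤ H ∧ ∀ x ∈ frontier Ω, |h x| ≤ H := by
  obtain ⟨H, hH⟩ := isCompact_Icc.exists_bound_of_continuousOn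
    (hh.continuous.continuousOn (s := Icc 0 L))
  have hL := hΩ.length_pos
  refine ⟨H, (norm_nonneg _).trans (hH 0 ⟨le_rfl, hL.le⟩), fun x hx => ?_⟩
  rw [← hΩ.range_eq] at hx
  obtain ⟨l, rfl⟩ := hx
  have e : r (toIcoMod hL 0 l) = r l := by
    have := hΩ.periodic.sub_zsmul_eq (x := l) (toIcoDiv hL 0 l)
    rwa [self_sub_toIcoDiv_zsmul] at this
  rw [← e]
  exact hH _ (Ico_subset_Icc_self (toIcoMod_mem_Ico' hL l))

/-- With `m` and `n` the normals at the boundary points `z` and `x`, the normal derivative at `x` of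
`⟨x - z, m⟩ |x - z|` is `N a + s t / N`, where `N = |x - z|`, `s = ⟨x - z, m⟩`, `t = ⟨x - z, n⟩` and
`a = ⟨m, n⟩`. -/
lemma half_le_normal_derivative {N K a s t : ℝ} (hN : 0 ≤ N) (ha : |1 - a| ≤ K * N)
    (hNK : N * (4 * K) ≤ 1) (hs : s ≤ 0) (hs' : -(K * N ^ 2) ≤ s) (ht : 0 ≤ t) (ht' : t ≤ N) :
    1 / 2 * N ≤ N * a + s * N⁻¹ * t := by
  rcases eq_or_lt_of_le hN with h0 | h0
  · rw [← h0]; simp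
  · have h2 : N⁻¹ * t ≤ 1 := by
      rw [inv_mul_le_iff₀ h0, mul_one]; exact ht'
    have h3 : 0 ≤ N⁻¹ * t := by positivity
    have h4 : s ≤ s * (N⁻¹ * t) := by nlinarith
    have h5 : 1 - K * N ≤ a := by linarith [(abs_le.1 ha).2]
    have h6 := mul_le_mul_of_nonneg_left h5 hN
    have h7 := mul_le_mul_of_nonneg_left hNK hN
    rw [mul_assoc s]
    nlinarith

set_option maxHeartbeats 1000000 in
/-- The gradient bound at a boundary point `z`, in integrated form. The penalty contains a large
multiple of `⟨x - z, m⟩ |x - z|`, where `m` is the normal at `z`: its normal derivative at the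
boundary is comparable to `|x - z|`, so it outweighs the variation of the datum and of the normal. A
multiple `k` of `|x - z|²` makes the penalty nonnegative, and large at the distance `δ` from `z`.
The term `η |x - p|²` makes the inequality at the boundary strict also at `z` itself; at the end `η`
tends to `0`. -/
lemma exists_boundary_lipschitz {Ω : Set Plane} {L : ℝ} {r : ℝ → Plane}
    (hΩ : IsConvexC5Domain Ω L r) {h : Plane → ℝ} (hh : ContDiff ℝ 1 fun l => h (r l)) :
    ∃ c > 0, ∃ C > 0, ∀ (φ : Plane → ℝ) (R O δ : ℝ) (z : Plane), IsNeumannSolution Ω h R φ →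
      0 < R → 0 < δ → δ ≤ c → z ∈ frontier Ω → 0 ≤ O →
      (∀ x ∈ closure Ω, ∀ y ∈ closure Ω, ‖x - z‖ ≤ δ → ‖y - z‖ ≤ δ → φ x - φ y ≤ O) →
      ∀ x ∈ closure Ω, ‖x - z‖ ≤ δ →
        |φ x - φ z| ≤ (4 * R * δ + 9 * (O / δ) + C) * ‖x - z‖ := by
  obtain ⟨c, hc, K, hK, hlip⟩ := hΩ.exists_lipschitz_normal hh
  obtain ⟨p, ρ, hρ, hp⟩ := hΩ.exists_closedBall
  obtain ⟨H, hH0, hH⟩ := hΩ.exists_bound_boundary hh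
  set κ : ℝ := 2 * (K * (1 + H)) with hκ
  have hκ0 : 0 < κ := by positivity
  obtain ⟨D, hD⟩ := hΩ.isCompact_closure.isBounded.subset_closedBall p
  set c' : ℝ := min (c / 2) (1 / (4 * K)) with hc'
  have hc'0 : 0 < c' := by positivity
  refine ⟨c', hc'0, 21 * κ * c' + 19 * H + 1, by positivity, ?_⟩
  intro φ R O δ z hφ hR hδ hδc hz hO0 hO x₀ hx₀ hx₀z
  have hzc : z ∈ closure Ω := frontier_subset_closure hz
  obtain ⟨m, hm⟩ := exists_isOuterUnitNormal hΩ.isOpen hΩ.convex hΩ.nonempty hz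
  have hδK : δ * (4 * K) ≤ 1 := by
    have := hδc.trans (min_le_right _ _)
    rwa [le_div_iff₀ (by positivity)] at this
  set b : Plane := h z • m with hb
  have hbH : ‖b‖ ≤ H := by rw [hb, norm_smul, hm.1, mul_one]; exact hH z hz
  set k : ℝ := κ + (O + 2 * δ * ‖b‖) / δ ^ 2 with hk
  have hk0 : 0 < k := by positivity
  have hkδ : k * δ = κ * δ + O / δ + 2 * ‖b‖ := by rw [hk]; field_simp; ring
  have him : ∀ x ∈ closure Ω, inner ℝ (x - z) m ≤ 0 := fun x hx => by
    rw [real_inner_comm]; exact hm.closure_le hx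
  have key : ∀ η > 0, ∀ x₁ ∈ closure Ω, ∀ y₁ ∈ closure Ω, ‖x₁ - z‖ ≤ δ → ‖y₁ - z‖ ≤ δ →
      φ x₁ - φ y₁ ≤ 4 * (R + (3 * κ + 2 * k + 2 * η)) * δ * ‖x₁ - y₁‖
        - (R + (3 * κ + 2 * k + 2 * η)) * ‖x₁ - y₁‖ ^ 2 + inner ℝ b (x₁ - y₁)
        + (κ * (inner ℝ (x₁ - z) m * ‖x₁ - z‖) + k * ‖x₁ - z‖ ^ 2 + η * ‖x₁ - p‖ ^ 2)
        + (κ * (inner ℝ (y₁ - z) m * ‖y₁ - z‖) + k * ‖y₁ - z‖ ^ 2 + η * ‖y₁ - p‖ ^ 2) := by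
    intro η hη x₁ hx₁ y₁ hy₁ hxz hyz
    have hPlow : ∀ x, (k - κ) * ‖x - z‖ ^ 2 ≤
        κ * (inner ℝ (x - z) m * ‖x - z‖) + k * ‖x - z‖ ^ 2 + η * ‖x - p‖ ^ 2 := by
      intro x
      have h1 : -‖x - z‖ ≤ inner ℝ (x - z) m := by
        have := abs_real_inner_le_norm (x - z) m
        rw [hm.1, mul_one] at this
        exact (abs_le.1 this).1
      have h2 : -‖x - z‖ * ‖x - z‖ ≤ inner ℝ (x - z) m * ‖x - z‖ :=
        mul_le_mul_of_nonneg_right h1 (norm_nonneg _)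
      have h3 := mul_le_mul_of_nonneg_left h2 hκ0.le
      have h4 : 0 ≤ η * ‖x - p‖ ^ 2 := by positivity
      nlinarith
    have hkκ : (k - κ) * δ ^ 2 = O + 2 * δ * ‖b‖ := by rw [hk]; field_simp; ring
    refine two_point_estimate hΩ
      (P := fun x => κ * (inner ℝ (x - z) m * ‖x - z‖) + k * ‖x - z‖ ^ 2 + η * ‖x - p‖ ^ 2)
      (Λ := 3 * κ + 2 * k + 2 * η) (O := O) hφ hδ (by positivity) (by
        have : 0 < 3 * κ + 2 * k + 2 * η := by positivity
        linarith) (by fun_prop) ?_ ?_ hO ?_ ?_ hx₁ hy₁ hxz hyz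
    · intro x _ _
      refine le_trans ?_ (hPlow x)
      have : 0 ≤ k - κ := by rw [hk, add_sub_cancel_left]; positivity
      positivity
    · intro x _ hx
      have := hPlow x
      rw [hx, hkκ] at this
      simpa only [hx] using this
    · intro u v
      have h1 := norm_sq_second_difference (u - z) v
      have h2 := norm_sq_second_difference (u - p) v
      have h3 := inner_mul_norm_second_difference hm.1 (u - z) v
      have e1 : u - z + v = u + v - z := by abel
      have e2 : u - z - v = u - v - z := by abel
      have e3 : u - p + v = u + v - p := by abel
      have e4 : u - p - v = u - v - p := by abel
      rw [e1, e2] at h1 h3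
      rw [e3, e4] at h2
      nlinarith
    · intro x hx hxz
      refine ⟨_, (((hasFDerivAt_inner_mul_norm x z m).const_mul κ).add
        ((hasFDerivAt_norm_sub_sq x z).const_mul k)).add
        ((hasFDerivAt_norm_sub_sq x p).const_mul η), fun n hn => ?_⟩
      have hxc : ‖x - z‖ < c := by
        have := hδc.trans (min_le_left _ _)
        linarith
      obtain ⟨hnm, hhx⟩ := hlip x hx z hz hxc n m hn hm
      have hmn : |1 - inner ℝ m n| ≤ K * ‖x - z‖ := by
        have h1 : 1 - inner ℝ m n = inner ℝ (n - m) n := by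
          rw [inner_sub_left, real_inner_self_eq_norm_sq, hn.1]; norm_num
        rw [h1]
        refine (abs_real_inner_le_norm _ _).trans ?_
        rw [hn.1, mul_one]
        exact hnm
      have hdatum : |h x - inner ℝ b n| ≤ κ / 2 * ‖x - z‖ := by
        have h1 : h x - inner ℝ b n = (h x - h z) + h z * (1 - inner ℝ m n) := by
          rw [hb, real_inner_smul_left]; ring
        rw [h1]
        refine (abs_add_le _ _).trans ?_
        rw [abs_mul]
        have h2 := mul_le_mul (hH z hz) hmn (abs_nonneg _) hH0
        rw [hκ]
        linarith
      have hun : 0 ≤ inner ℝ (x - z) n := by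
        have := hn.closure_le hzc
        rw [← neg_sub, inner_neg_right, real_inner_comm] at this
        linarith
      have hun' : inner ℝ (x - z) n ≤ ‖x - z‖ := by
        have := real_inner_le_norm (x - z) n
        rwa [hn.1, mul_one] at this
      have hum : -(K * ‖x - z‖ ^ 2) ≤ inner ℝ (x - z) m := by
        have h1 : inner ℝ (x - z) m = inner ℝ (x - z) n - inner ℝ (x - z) (n - m) := by
          rw [inner_sub_right]; ring
        have h2 := real_inner_le_norm (x - z) (n - m)
        have h3 := mul_le_mul_of_nonneg_left hnm (norm_nonneg (x - z))
        rw [h1]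
        nlinarith
      have hpn : ρ ≤ inner ℝ (x - p) n := by
        rw [real_inner_comm]
        exact hn.radius_le hρ.le hp
      have hNK : ‖x - z‖ * (4 * K) ≤ 1 :=
        (mul_le_mul_of_nonneg_right hxz.le (by positivity)).trans hδK
      have hq := half_le_normal_derivative (norm_nonneg (x - z)) hmn hNK
        (him x (frontier_subset_closure hx)) hum hun hun'
      simp only [add_apply, smul_apply, innerSL_apply_apply, smul_eq_mul, nsmul_eq_mul]
      have h1 : 0 ≤ k * inner ℝ (x - z) n := by positivity
      have h2 : 0 < η * inner ℝ (x - p) n := by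
        have := hρ.trans_le hpn
        positivity
      have h3 := mul_le_mul_of_nonneg_left hq hκ0.le
      push_cast
      linarith
  have hfar : ∀ x ∈ closure Ω, ‖x - p‖ ^ 2 ≤ D ^ 2 := fun x hx => by
    have := hD hx
    rw [mem_closedBall, dist_eq_norm] at this
    exact pow_le_pow_left₀ (norm_nonneg _) this 2
  have hN := norm_nonneg (x₀ - z)
  have hkx : k * ‖x₀ - z‖ ^ 2 ≤ k * δ * ‖x₀ - z‖ := by
    rw [mul_assoc]
    refine mul_le_mul_of_nonneg_left ?_ hk0.le
    nlinarith
  have hmx : κ * (inner ℝ (x₀ - z) m * ‖x₀ - z‖) ≤ 0 := by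
    have := mul_nonpos_of_nonpos_of_nonneg (him x₀ hx₀) hN
    nlinarith
  have hbx : |inner ℝ b (x₀ - z)| ≤ H * ‖x₀ - z‖ :=
    (abs_real_inner_le_norm _ _).trans (mul_le_mul_of_nonneg_right hbH hN)
  have hfin : (4 * (R + (3 * κ + 2 * k)) * δ + H + k * δ) * ‖x₀ - z‖ ≤
      (4 * R * δ + 9 * (O / δ) + (21 * κ * c' + 19 * H + 1)) * ‖x₀ - z‖ := by
    refine mul_le_mul_of_nonneg_right ?_ hN
    have h1 : κ * δ ≤ κ * c' := mul_le_mul_of_nonneg_left hδc hκ0.le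
    linarith
  refine le_trans ?_ hfin
  rw [abs_le]
  constructor
  · suffices hs : φ z - φ x₀ ≤ (4 * (R + (3 * κ + 2 * k)) * δ + H + k * δ) * ‖x₀ - z‖ by linarith
    refine le_of_forall_pos_le_add_mul (c := 8 * δ * ‖x₀ - z‖ + 2 * D ^ 2) fun η hη => ?_
    have h1 := key η hη z hzc x₀ hx₀ (by simpa using hδ.le) hx₀z
    rw [norm_sub_rev z x₀, ← neg_sub x₀ z, inner_neg_right] at h1
    simp only [sub_self, norm_zero, inner_zero_left] at h1
    have h2 := mul_le_mul_of_nonneg_left (hfar x₀ hx₀) hη.le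
    have h3 := mul_le_mul_of_nonneg_left (hfar z hzc) hη.le
    have h4 : 0 ≤ (R + (3 * κ + 2 * k + 2 * η)) * ‖x₀ - z‖ ^ 2 := by positivity
    have h5 := (abs_le.1 hbx).1
    linarith
  · refine le_of_forall_pos_le_add_mul (c := 8 * δ * ‖x₀ - z‖ + 2 * D ^ 2) fun η hη => ?_
    have h1 := key η hη x₀ hx₀ z hzc hx₀z (by simpa using hδ.le)
    simp only [sub_self, norm_zero, inner_zero_left] at h1
    have h2 := mul_le_mul_of_nonneg_left (hfar x₀ hx₀) hη.le
    have h3 := mul_le_mul_of_nonneg_left (hfar z hzc) hη.le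
    have h4 : 0 ≤ (R + (3 * κ + 2 * k + 2 * η)) * ‖x₀ - z‖ ^ 2 := by positivity
    have h5 := (abs_le.1 hbx).2
    linarith

/-! ### Flux through the boundary in ray coordinates -/

/-- The point at the fraction `q.1` of the way from `p` to the boundary point `r q.2`. -/
def rayMap (p : Plane) (r : ℝ → Plane) (q : ℝ × ℝ) : Plane := p + q.1 • (r q.2 - p)

/-- The first unit vector. -/
def e₀ : Plane := EuclideanSpace.single 0 1

lemma norm_e₀ : ‖e₀‖ = 1 := by simp [e₀]

/-- The trace of an endomorphism of the plane. -/
def divg (A : Plane →L[ℝ] Plane) : ℝ := inner ℝ (A e₀) e₀ + inner ℝ (A (rot e₀)) (rot e₀)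

lemma inner_rot_sub_eq_divg (A : Plane →L[ℝ] Plane) (u w : Plane) :
    inner ℝ (A u) (rot w) - inner ℝ (A w) (rot u) = divg A * inner ℝ u (rot w) := by
  have hu := eq_add_rot norm_e₀ u
  have hw := eq_add_rot norm_e₀ w
  have a1 : inner ℝ u e₀ = u 0 := by simp [inner_eq_coord, e₀]
  have a2 : inner ℝ u (rot e₀) = u 1 := by simp [inner_eq_coord, e₀]
  have a3 : inner ℝ w e₀ = w 0 := by simp [inner_eq_coord, e₀]
  have a4 : inner ℝ w (rot e₀) = w 1 := by simp [inner_eq_coord, e₀]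
  have hAu : A u = u 0 • A e₀ + u 1 • A (rot e₀) := by
    rw [← a1, ← a2, ← map_smul, ← map_smul, ← map_add, ← hu]
  have hAw : A w = w 0 • A e₀ + w 1 • A (rot e₀) := by
    rw [← a3, ← a4, ← map_smul, ← map_smul, ← map_add, ← hw]
  rw [hAu, hAw, divg]
  simp [inner_eq_coord, e₀]
  ring

/-- The derivative of `rayMap`. -/
def rayMapDeriv (p : Plane) (r : ℝ → Plane) (q : ℝ × ℝ) : ℝ × ℝ →L[ℝ] Plane :=
  (ContinuousLinearMap.fst ℝ ℝ ℝ).smulRight (r q.2 - p)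
    + (ContinuousLinearMap.snd ℝ ℝ ℝ).smulRight (q.1 • deriv r q.2)

lemma measurePreserving_coord :
    MeasurePreserving (fun y : ℝ × ℝ => (!₂[y.1, y.2] : Plane)) volume volume := by
  have h1 := (volume_preserving_finTwoArrow ℝ).symm
  have h2 := (EuclideanSpace.volume_preserving_symm_measurableEquiv_toLp (Fin 2)).symm
  exact h2.comp h1

lemma measurableEmbedding_coord :
    MeasurableEmbedding (fun y : ℝ × ℝ => (!₂[y.1, y.2] : Plane)) := by
  have h1 := (MeasurableEquiv.finTwoArrow (α := ℝ)).symm.measurableEmbedding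
  have h2 := (MeasurableEquiv.toLp 2 (Fin 2 → ℝ)).measurableEmbedding
  exact h2.comp h1

namespace IsConvexC5Domain
variable {Ω : Set Plane} {L : ℝ} {r : ℝ → Plane}

lemma hasFDerivAt_rayMap (hΩ : IsConvexC5Domain Ω L r) (p : Plane) (q : ℝ × ℝ) :
    HasFDerivAt (rayMap p r) (rayMapDeriv p r q) q := by
  have h1 : HasFDerivAt (fun q : ℝ × ℝ => r q.2 - p)
      ((ContinuousLinearMap.snd ℝ ℝ ℝ).smulRight (deriv r q.2)) q := by
    have := ((hΩ.hasDerivAt q.2).hasFDerivAt.comp q hasFDerivAt_snd).sub_const p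
    refine this.congr_fderiv ?_
    ext <;> simp
  have h2 := (((hasFDerivAt_fst (𝕜 := ℝ) (p := q)).smul h1).const_add p)
  refine h2.congr_fderiv ?_
  ext v <;> simp [rayMapDeriv]

lemma continuous_rayMap (hΩ : IsConvexC5Domain Ω L r) (p : Plane) : Continuous (rayMap p r) :=
  continuous_iff_continuousAt.2 fun q => (hΩ.hasFDerivAt_rayMap p q).continuousAt

lemma rayMap_mem (hΩ : IsConvexC5Domain Ω L r) {p : Plane} (hp : p ∈ Ω) {q : ℝ × ℝ}
    (h0 : 0 ≤ q.1) (h1 : q.1 < 1) : rayMap p r q ∈ Ω := by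
  have h := hΩ.convex.combo_interior_closure_mem_interior (x := p) (y := r q.2)
    (by rwa [hΩ.isOpen.interior_eq]) (hΩ.mem_closure _) (a := 1 - q.1) (b := q.1)
    (by linarith) h0 (by ring)
  rw [hΩ.isOpen.interior_eq] at h
  have e : rayMap p r q = (1 - q.1) • p + q.1 • r q.2 := by
    rw [rayMap, smul_sub, sub_smul, one_smul]; abel
  rwa [e]

lemma rayMap_mem_closure (hΩ : IsConvexC5Domain Ω L r) {p : Plane} (hp : p ∈ Ω) {q : ℝ × ℝ}
    (h0 : 0 ≤ q.1) (h1 : q.1 ≤ 1) : rayMap p r q ∈ closure Ω := by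
  rcases h1.lt_or_eq with h | h
  · exact subset_closure (hΩ.rayMap_mem hp h0 h)
  · simp [rayMap, h, hΩ.mem_closure]

lemma gauge_rayMap (hΩ : IsConvexC5Domain Ω L r) {p : Plane} (hp : p ∈ Ω) {q : ℝ × ℝ}
    (h0 : 0 ≤ q.1) : gauge ((fun x => x + p) ⁻¹' Ω) (rayMap p r q - p) = q.1 := by
  have hconv : Convex ℝ ((fun x => x + p) ⁻¹' Ω) := hΩ.convex.translate_preimage_left p
  have hnhds : (fun x => x + p) ⁻¹' Ω ∈ 𝓝 (0 : Plane) :=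
    (by fun_prop : Continuous fun x : Plane => x + p).continuousAt.preimage_mem_nhds
      (by simpa using hΩ.isOpen.mem_nhds hp)
  have h1 : gauge ((fun x => x + p) ⁻¹' Ω) (r q.2 - p) = 1 := by
    rw [gauge_eq_one_iff_mem_frontier hconv hnhds]
    have := (Homeomorph.addRight p).preimage_frontier Ω
    simp only [Homeomorph.coe_addRight] at this
    rw [← this]
    simpa using hΩ.mem_frontier q.2
  rw [rayMap, add_sub_cancel_left, gauge_smul_of_nonneg h0, h1]
  simp

lemma injOn_rayMap (hΩ : IsConvexC5Domain Ω L r) {p : Plane} (hp : p ∈ Ω) :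
    InjOn (rayMap p r) (Ioi 0 ×ˢ Ico 0 L) := by
  rintro q ⟨hq1, hq2⟩ q' ⟨hq1', hq2'⟩ heq
  have h1 := hΩ.gauge_rayMap hp (q := q) (le_of_lt hq1)
  rw [heq, hΩ.gauge_rayMap hp (le_of_lt hq1')] at h1
  have h2 : r q.2 = r q'.2 := by
    simp only [rayMap, h1] at heq
    exact sub_left_injective (smul_right_injective _ (ne_of_gt hq1) (add_right_injective _ heq))
  exact Prod.ext h1.symm (hΩ.injOn hq2 hq2' h2)

/-- A compact subset of the domain is reached by rays that stay away from the boundary. -/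
lemma exists_subset_image_rayMap (hΩ : IsConvexC5Domain Ω L r) {p : Plane} (hp : p ∈ Ω)
    {K : Set Plane} (hK : IsCompact K) (hKΩ : K ⊆ Ω) :
    ∃ s₁ < 1, ∀ s ≥ s₁, K ⊆ insert p (rayMap p r '' (Ioc 0 s ×ˢ Ico 0 L)) := by
  set G : Set Plane := (fun x => x + p) ⁻¹' Ω with hG
  have hconv : Convex ℝ G := hΩ.convex.translate_preimage_left p
  have hnhds : G ∈ 𝓝 (0 : Plane) :=
    (by fun_prop : Continuous fun x : Plane => x + p).continuousAt.preimage_mem_nhds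
      (by simpa using hΩ.isOpen.mem_nhds hp)
  have hGo : IsOpen G := hΩ.isOpen.preimage (by fun_prop)
  have hGb : Bornology.IsVonNBounded ℝ G := by
    rw [NormedSpace.isVonNBounded_iff]
    have : G = (fun x => x - p) '' Ω := by
      ext x; simp only [hG, mem_preimage, mem_image]
      exact ⟨fun h => ⟨_, h, by simp⟩, fun ⟨y, hy, hyx⟩ => by rw [← hyx]; simpa using hy⟩
    rw [this]
    obtain ⟨D, hD⟩ := hΩ.isBounded.exists_norm_le
    refine isBounded_iff_forall_norm_le.2 ⟨D + ‖p‖, ?_⟩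
    rintro _ ⟨y, hy, rfl⟩
    exact (norm_sub_le _ _).trans (by linarith [hD y hy])
  have hgc : Continuous (gauge G) := continuous_gauge hconv hnhds
  obtain ⟨s₁, hs₁, hle⟩ : ∃ s₁ < 1, ∀ x ∈ K, gauge G (x - p) ≤ s₁ := by
    rcases K.eq_empty_or_nonempty with rfl | hne
    · exact ⟨0, one_pos, by simp⟩
    · obtain ⟨x₀, hx₀, hmax⟩ := hK.exists_isMaxOn hne
        (f := fun x => gauge G (x - p)) (by fun_prop)
      exact ⟨_, gauge_lt_one_of_mem_of_isOpen hGo (by simpa [hG] using hKΩ hx₀), hmax⟩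
  refine ⟨s₁, hs₁, fun s hs x hx => ?_⟩
  by_cases hxp : x = p
  · exact Or.inl hxp
  right
  set g := gauge G (x - p) with hg
  have hg0 : 0 < g := (gauge_pos (absorbent_nhds_zero hnhds) hGb).2 (sub_ne_zero.2 hxp)
  have hfr : g⁻¹ • (x - p) ∈ frontier G := by
    rw [← gauge_eq_one_iff_mem_frontier hconv hnhds, gauge_smul_of_nonneg (by positivity), ← hg,
      smul_eq_mul, inv_mul_cancel₀ hg0.ne']
  have hfr' : g⁻¹ • (x - p) + p ∈ frontier Ω := by
    have := (Homeomorph.addRight p).preimage_frontier Ω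
    simp only [Homeomorph.coe_addRight] at this
    rw [hG, ← this] at hfr
    exact hfr
  rw [← hΩ.range_eq] at hfr'
  obtain ⟨l, hl⟩ := hfr'
  have hL := hΩ.length_pos
  have e : r (toIcoMod hL 0 l) = r l := by
    have := hΩ.periodic.sub_zsmul_eq (x := l) (toIcoDiv hL 0 l)
    rwa [self_sub_toIcoDiv_zsmul] at this
  refine ⟨(g, toIcoMod hL 0 l), ⟨⟨hg0, (hle x hx).trans hs⟩, toIcoMod_mem_Ico' hL l⟩, ?_⟩
  rw [rayMap, e, hl, add_sub_cancel_right, smul_smul, mul_inv_cancel₀ hg0.ne', one_smul]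
  abel

/-- The change of variables to ray coordinates. -/
lemma lintegral_image_rayMap (hΩ : IsConvexC5Domain Ω L r) {p : Plane} (hp : p ∈ Ω) {s : ℝ}
    (g : Plane → ℝ≥0∞) :
    ∫⁻ x in rayMap p r '' (Ioc 0 s ×ˢ Ico 0 L), g x
      = ∫⁻ q in Ioc 0 s ×ˢ Ico 0 L,
        ENNReal.ofReal (q.1 * |inner ℝ (r q.2 - p) (rot (deriv r q.2))|) * g (rayMap p r q) := by
  set S : Set (ℝ × ℝ) := Ioc 0 s ×ˢ Ico 0 L with hS
  set ι : ℝ × ℝ → Plane := fun y => !₂[y.1, y.2] with hι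
  set Y : ℝ × ℝ → ℝ × ℝ := fun q => (rayMap p r q 0, rayMap p r q 1) with hY
  have hιY : ∀ q, ι (Y q) = rayMap p r q := fun q => by
    ext i; fin_cases i <;> simp [hι, hY]
  have hpre : ι ⁻¹' (rayMap p r '' S) = Y '' S := by
    ext y
    simp only [mem_preimage, mem_image]
    constructor
    · rintro ⟨q, hq, hqy⟩
      exact ⟨q, hq, by simp [hY, hqy, hι]⟩
    · rintro ⟨q, hq, rfl⟩
      exact ⟨q, hq, (hιY q).symm⟩
  rw [← measurePreserving_coord.setLIntegral_comp_preimage_emb measurableEmbedding_coord]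
  change ∫⁻ y in ι ⁻¹' (rayMap p r '' S), g (ι y) = _
  rw [hpre]
  set Y' : ℝ × ℝ → ℝ × ℝ →L[ℝ] ℝ × ℝ := fun q =>
    ((EuclideanSpace.proj 0 : Plane →L[ℝ] ℝ).comp (rayMapDeriv p r q)).prod
      ((EuclideanSpace.proj 1 : Plane →L[ℝ] ℝ).comp (rayMapDeriv p r q)) with hY'
  have hYd : ∀ q, HasFDerivAt Y (Y' q) q := fun q => by
    have h := hΩ.hasFDerivAt_rayMap p q
    exact ((EuclideanSpace.proj 0 : Plane →L[ℝ] ℝ).hasFDerivAt.comp q h).prodMk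
      ((EuclideanSpace.proj 1 : Plane →L[ℝ] ℝ).hasFDerivAt.comp q h)
  have hinj : InjOn Y S := by
    intro q hq q' hq' heq
    refine hΩ.injOn_rayMap hp ⟨hq.1.1, hq.2⟩ ⟨hq'.1.1, hq'.2⟩ ?_
    rw [← hιY, ← hιY, heq]
  rw [lintegral_image_eq_lintegral_abs_det_fderiv_mul volume
    (measurableSet_Ioc.prod measurableSet_Ico) (fun q _ => (hYd q).hasFDerivWithinAt) hinj]
  refine setLIntegral_congr_fun (measurableSet_Ioc.prod measurableSet_Ico) fun q hq => ?_
  simp only [hιY]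
  congr 2
  have hdet : (Y' q).det =
      q.1 * ((r q.2 - p) 0 * deriv r q.2 1 - (r q.2 - p) 1 * deriv r q.2 0) := by
    rw [ContinuousLinearMap.det, ← LinearMap.det_toMatrix (Module.Basis.finTwoProd ℝ),
      Matrix.det_fin_two]
    simp [LinearMap.toMatrix_apply, hY', rayMapDeriv]
    ring
  rw [hdet, abs_mul, abs_of_pos hq.1.1, inner_eq_coord, ← abs_neg]
  congr 2
  simp
  ring

end IsConvexC5Domain

namespace IsConvexC5Domain
variable {Ω : Set Plane} {L : ℝ} {r : ℝ → Plane}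

/-- The divergence theorem on the domain shrunk by the factor `s₀` towards `p`, written in ray
coordinates. It is the divergence theorem on the rectangle `[0, s₀] × [0, L]`, applied to the
pullback of `F`, that is to the fluxes of `F` through the two families of coordinate curves. No
second derivatives of `rayMap` remain, as those of the two terms cancel. -/
lemma integral_divg_rayMap (hΩ : IsConvexC5Domain Ω L r) {p : Plane} (hp : p ∈ Ω) (σ : ℝ)
    {F : Plane → Plane} (hF : ContDiffOn ℝ 1 F Ω) {s₀ : ℝ} (h0 : 0 ≤ s₀) (h1 : s₀ < 1) :
    IntegrableOn (fun q : ℝ × ℝ => q.1 * inner ℝ (r q.2 - p) (σ • rot (deriv r q.2))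
        * divg (fderiv ℝ F (rayMap p r q))) (Icc 0 s₀ ×ˢ Icc 0 L) ∧
    ∫ q in Icc 0 s₀ ×ˢ Icc 0 L, q.1 * inner ℝ (r q.2 - p) (σ • rot (deriv r q.2))
        * divg (fderiv ℝ F (rayMap p r q))
      = s₀ * ∫ l in (0 : ℝ)..L, inner ℝ (F (rayMap p r (s₀, l))) (σ • rot (deriv r l)) := by
  have hL := hΩ.length_pos
  set S : Set (ℝ × ℝ) := Icc 0 s₀ ×ˢ Icc 0 L with hS
  have hXΩ : ∀ q ∈ S, rayMap p r q ∈ Ω := fun q hq =>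
    hΩ.rayMap_mem hp hq.1.1 (hq.1.2.trans_lt h1)
  have hXc := hΩ.continuous_rayMap p
  have hrc : Continuous r := hΩ.differentiable.continuous
  have hr'c : Continuous (deriv r) := hΩ.contDiff_deriv.continuous
  have hFd : ∀ x ∈ Ω, HasFDerivAt F (fderiv ℝ F x) x := fun x hx =>
    ((hF.contDiffAt (hΩ.isOpen.mem_nhds hx)).differentiableAt (by norm_num)).hasFDerivAt
  have hFX : ContinuousOn (fun q => F (rayMap p r q)) S :=
    hF.continuousOn.comp hXc.continuousOn hXΩ
  have hF'X : ContinuousOn (fun q => fderiv ℝ F (rayMap p r q)) S :=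
    (hF.continuousOn_fderiv_of_isOpen hΩ.isOpen (by norm_num)).comp hXc.continuousOn hXΩ
  have hdc : ContinuousOn (fun q : ℝ × ℝ => q.1 * inner ℝ (r q.2 - p) (σ • rot (deriv r q.2))
        * divg (fderiv ℝ F (rayMap p r q))) S := by
    have a1 : ContinuousOn (fun q => fderiv ℝ F (rayMap p r q) e₀) S :=
      hF'X.clm_apply continuousOn_const
    have a2 : ContinuousOn (fun q => fderiv ℝ F (rayMap p r q) (rot e₀)) S :=
      hF'X.clm_apply continuousOn_const
    have a3 : ContinuousOn (fun q => divg (fderiv ℝ F (rayMap p r q))) S :=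
      (a1.inner continuousOn_const).add (a2.inner continuousOn_const)
    refine ContinuousOn.mul (Continuous.continuousOn ?_) a3
    fun_prop
  have hint := hdc.integrableOn_compact (μ := volume) (isCompact_Icc.prod isCompact_Icc)
  refine ⟨hint, ?_⟩
  -- the derivative of the field along the rays
  have hFXd : ∀ q ∈ S, HasFDerivAt (fun q => F (rayMap p r q))
      ((fderiv ℝ F (rayMap p r q)).comp (rayMapDeriv p r q)) q := fun q hq =>
    (hFd _ (hXΩ q hq)).comp q (hΩ.hasFDerivAt_rayMap p q)
  have hud : ∀ q : ℝ × ℝ, HasFDerivAt (fun q : ℝ × ℝ => σ • rot (r q.2 - p))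
      ((ContinuousLinearMap.snd ℝ ℝ ℝ).smulRight (σ • rot (deriv r q.2))) q := fun q => by
    have h := (((hΩ.hasDerivAt q.2).hasFDerivAt.comp q hasFDerivAt_snd).sub_const p)
    have h2 := ((σ • rot).hasFDerivAt (x := r q.2 - p)).comp q h
    refine h2.congr_fderiv ?_
    ext <;> simp
  have hnd : ∀ q : ℝ × ℝ, HasFDerivAt (fun q : ℝ × ℝ => q.1 • (σ • rot (deriv r q.2)))
      ((ContinuousLinearMap.fst ℝ ℝ ℝ).smulRight (σ • rot (deriv r q.2))
        + (ContinuousLinearMap.snd ℝ ℝ ℝ).smulRight (q.1 • σ • rot (deriv (deriv r) q.2))) q :=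
      fun q => by
    have hd : HasDerivAt (deriv r) (deriv (deriv r) q.2) q.2 :=
      ((hΩ.contDiff_deriv.differentiable (by norm_num)) q.2).hasDerivAt
    have h := hd.hasFDerivAt.comp q (hasFDerivAt_snd (𝕜 := ℝ) (p := q))
    have h2 := ((σ • rot).hasFDerivAt (x := deriv r q.2)).comp q h
    refine ((hasFDerivAt_fst (𝕜 := ℝ) (p := q)).smul h2).congr_fderiv ?_
    ext v <;> simp
  have hsub : Ioo 0 s₀ ×ˢ Ioo 0 L ⊆ S :=
    prod_mono Ioo_subset_Icc_self Ioo_subset_Icc_self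
  have hdiv := integral_divergence_prod_Icc_of_hasFDerivAt_of_le
    (fun q : ℝ × ℝ => inner ℝ (F (rayMap p r q)) (q.1 • (σ • rot (deriv r q.2))))
    (fun q : ℝ × ℝ => -inner ℝ (F (rayMap p r q)) (σ • rot (r q.2 - p)))
    (fun q => (fderivInnerCLM ℝ (F (rayMap p r q), q.1 • (σ • rot (deriv r q.2)))).comp
      (((fderiv ℝ F (rayMap p r q)).comp (rayMapDeriv p r q)).prod
      ((ContinuousLinearMap.fst ℝ ℝ ℝ).smulRight (σ • rot (deriv r q.2))
        + (ContinuousLinearMap.snd ℝ ℝ ℝ).smulRight (q.1 • σ • rot (deriv (deriv r) q.2)))))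
    (fun q => -(fderivInnerCLM ℝ (F (rayMap p r q), σ • rot (r q.2 - p))).comp
      (((fderiv ℝ F (rayMap p r q)).comp (rayMapDeriv p r q)).prod
      ((ContinuousLinearMap.snd ℝ ℝ ℝ).smulRight (σ • rot (deriv r q.2)))))
    (0, 0) (s₀, L) ⟨h0, hL.le⟩
    (by
      rw [← Icc_prod_Icc]
      exact hFX.inner (Continuous.continuousOn (by fun_prop)))
    (by
      rw [← Icc_prod_Icc]
      exact (hFX.inner (Continuous.continuousOn (by fun_prop))).neg)
    (fun q hq => (hFXd q (hsub hq)).inner ℝ (hnd q))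
    (fun q hq => ((hFXd q (hsub hq)).inner ℝ (hud q)).neg)
  have hpt : ∀ q : ℝ × ℝ,
      ((fderivInnerCLM ℝ (F (rayMap p r q), q.1 • (σ • rot (deriv r q.2)))).comp
      (((fderiv ℝ F (rayMap p r q)).comp (rayMapDeriv p r q)).prod
      ((ContinuousLinearMap.fst ℝ ℝ ℝ).smulRight (σ • rot (deriv r q.2))
        + (ContinuousLinearMap.snd ℝ ℝ ℝ).smulRight (q.1 • σ • rot (deriv (deriv r) q.2)))))
        (1, 0) +
      (-(fderivInnerCLM ℝ (F (rayMap p r q), σ • rot (r q.2 - p))).comp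
      (((fderiv ℝ F (rayMap p r q)).comp (rayMapDeriv p r q)).prod
      ((ContinuousLinearMap.snd ℝ ℝ ℝ).smulRight (σ • rot (deriv r q.2))))) (0, 1)
      = q.1 * inner ℝ (r q.2 - p) (σ • rot (deriv r q.2))
        * divg (fderiv ℝ F (rayMap p r q)) := by
    intro q
    have h := inner_rot_sub_eq_divg (fderiv ℝ F (rayMap p r q)) (r q.2 - p) (deriv r q.2)
    simp only [rayMapDeriv, ContinuousLinearMap.comp_apply, ContinuousLinearMap.prod_apply,
      add_apply, neg_apply, ContinuousLinearMap.smulRight_apply, ContinuousLinearMap.coe_fst',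
      ContinuousLinearMap.coe_snd', fderivInnerCLM_apply, one_smul, zero_smul, add_zero, zero_add,
      map_smul, inner_smul_right, real_inner_smul_left]
    linear_combination (q.1 * σ) * h
  simp only [hpt] at hdiv
  rw [← Icc_prod_Icc] at hdiv
  rw [hdiv hint]
  -- the sides `l = 0` and `l = L` cancel by periodicity, and at `s = 0` the flux is zero
  have hper : ∀ s, inner ℝ (F (rayMap p r (s, L))) (σ • rot (r L - p))
      = inner ℝ (F (rayMap p r (s, 0))) (σ • rot (r 0 - p)) := fun s => by
    have : r L = r 0 := by simpa using hΩ.periodic 0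
    simp only [rayMap, this]
  simp only [hper, sub_self, zero_smul, inner_zero_right, intervalIntegral.integral_zero, sub_zero,
    zero_add, inner_smul_right, intervalIntegral.integral_const_mul]

end IsConvexC5Domain

/-! ### The energy of truncations -/

/-- A smooth truncation of height `π O` at the level `c`, with derivative between `0` and `1`. -/
def truncation (O c u : ℝ) : ℝ := O * (Real.pi / 2 + Real.arctan ((u - c) / O))

lemma hasDerivAt_truncation {O : ℝ} (hO : 0 < O) (c u : ℝ) :
    HasDerivAt (truncation O c) (1 / (1 + ((u - c) / O) ^ 2)) u := by
  have h1 : HasDerivAt (fun u : ℝ => (u - c) / O) (1 / O) u :=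
    ((hasDerivAt_id u).sub_const c).div_const O
  have h2 := (h1.arctan.const_add (Real.pi / 2)).const_mul O
  refine h2.congr_deriv ?_
  field_simp

lemma truncation_nonneg {O : ℝ} (hO : 0 < O) (c u : ℝ) : 0 ≤ truncation O c u := by
  have := (Real.arctan_mem_Ioo ((u - c) / O)).1
  exact mul_nonneg hO.le (by linarith)

lemma truncation_le {O : ℝ} (hO : 0 < O) (c u : ℝ) : truncation O c u ≤ Real.pi * O := by
  have := (Real.arctan_mem_Ioo ((u - c) / O)).2
  rw [truncation, mul_comm]
  exact mul_le_mul_of_nonneg_right (by linarith) hO.le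

lemma contDiff_truncation (O c : ℝ) : ContDiff ℝ 2 (truncation O c) := by
  have h : ContDiff ℝ 2 fun u : ℝ => Real.arctan ((u - c) / O) :=
    Real.contDiff_arctan.comp (by fun_prop)
  exact contDiff_const.mul (contDiff_const.add h)

lemma norm_sq_fderiv_eq {φ : Plane → ℝ} (x : Plane) {e : Plane} (he : ‖e‖ = 1) :
    ‖fderiv ℝ φ x‖ ^ 2 = fderiv ℝ φ x e ^ 2 + fderiv ℝ φ x (rot e) ^ 2 := by
  set G := (InnerProductSpace.toDual ℝ Plane).symm (fderiv ℝ φ x) with hG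
  have h1 : ∀ v, fderiv ℝ φ x v = inner ℝ G v := fun v => by simp [hG]
  have h2 : ‖fderiv ℝ φ x‖ = ‖G‖ := by rw [hG, LinearIsometryEquiv.norm_map]
  have h3 := eq_add_rot he G
  have h4 : inner ℝ G G = inner ℝ G e * inner ℝ G e + inner ℝ G (rot e) * inner ℝ G (rot e) := by
    nth_rewrite 2 [h3]
    rw [inner_add_right, inner_smul_right, inner_smul_right]
  rw [h1, h1, h2, ← real_inner_self_eq_norm_sq, h4]
  ring

/-- The vector field `T(φ) ∇φ`, where `T` is a truncation. -/
def truncatedField (O c : ℝ) (φ : Plane → ℝ) (x : Plane) : Plane :=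
  truncation O c (φ x) • (InnerProductSpace.toDual ℝ Plane).symm (fderiv ℝ φ x)

lemma contDiffOn_truncatedField {Ω : Set Plane} (ho : IsOpen Ω) {φ : Plane → ℝ}
    (hφ : ContDiffOn ℝ 2 φ Ω) (O c : ℝ) : ContDiffOn ℝ 1 (truncatedField O c φ) Ω := by
  have h1 : ContDiffOn ℝ 1 (fun x => truncation O c (φ x)) Ω :=
    ((contDiff_truncation O c).of_le (by norm_num)).comp_contDiffOn (hφ.of_le (by norm_num))
  have h2 : ContDiffOn ℝ 1 (fderiv ℝ φ) Ω := hφ.fderiv_of_isOpen ho (by norm_num)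
  exact h1.smul ((InnerProductSpace.toDual ℝ Plane).symm.contDiff.comp_contDiffOn h2)

/-- The divergence is `T'(φ) |∇φ|² + T(φ) Δφ`, and `T' ^ 2 ≤ T'`. -/
lemma norm_sq_fderiv_truncation_le {φ : Plane → ℝ} {x : Plane} (hφ : ContDiffAt ℝ 2 φ x)
    (hlap : 0 ≤ Laplacian.laplacian φ x) {O : ℝ} (hO : 0 < O) (c : ℝ) :
    ‖fderiv ℝ (fun x => truncation O c (φ x)) x‖ ^ 2
      ≤ divg (fderiv ℝ (truncatedField O c φ) x) := by
  set T' : ℝ := 1 / (1 + ((φ x - c) / O) ^ 2) with hT'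
  have hT0 : 0 ≤ T' := by positivity
  have hT1 : T' ≤ 1 := by
    rw [hT', div_le_one (by positivity)]
    linarith [sq_nonneg ((φ x - c) / O)]
  have hd1 : HasFDerivAt (fun x => truncation O c (φ x)) (T' • fderiv ℝ φ x) x :=
    (hasDerivAt_truncation hO c (φ x)).comp_hasFDerivAt x
      (hφ.differentiableAt (by norm_num)).hasFDerivAt
  have hd2 : HasFDerivAt (fderiv ℝ φ) (fderiv ℝ (fderiv ℝ φ) x) x :=
    ((hφ.fderiv_right (m := 1) (by norm_num)).differentiableAt (by norm_num)).hasFDerivAt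
  set J := (InnerProductSpace.toDual ℝ Plane).symm with hJ
  have hd3 : HasFDerivAt (truncatedField O c φ) _ x :=
    hd1.smul (J.toContinuousLinearEquiv.toContinuousLinearMap.hasFDerivAt.comp x hd2)
  have hJi : ∀ (A : Plane →L[ℝ] ℝ) v, inner ℝ (J A) v = A v := fun A v => by simp [hJ]
  have hJi' : ∀ (A : Plane →L[ℝ] ℝ) v,
      inner ℝ ((InnerProductSpace.toDual ℝ Plane).symm A) v = A v := hJi
  rw [hd1.fderiv, hd3.fderiv, norm_smul, mul_pow, norm_sq_fderiv_eq x norm_e₀, divg]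
  rw [laplacian_eq_frame φ x norm_e₀] at hlap
  simp only [add_apply, smul_apply, ContinuousLinearMap.smulRight_apply, inner_add_left,
    real_inner_smul_left, ContinuousLinearMap.comp_apply,
    ContinuousLinearEquiv.coe_coe, LinearIsometryEquiv.coe_toContinuousLinearEquiv, hJi, hJi',
    smul_eq_mul, Real.norm_eq_abs, sq_abs]
  have h1 := mul_nonneg (truncation_nonneg hO c (φ x)) hlap
  have h2 : T' ^ 2 ≤ T' := by nlinarith
  have h3 := mul_le_mul_of_nonneg_right h2
    (add_nonneg (sq_nonneg (fderiv ℝ φ x e₀)) (sq_nonneg (fderiv ℝ φ x (rot e₀))))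
  linarith

/-- The energy of a truncation of a solution of the Neumann problem is at most a constant times the
height of the truncation. Neither a bound of `Δφ` nor one of the total mass `∫ Δφ` enters: the
truncation is nonnegative, so the term with `Δφ` has a good sign, and the flux through the boundary
is given by the datum. -/
lemma exists_truncation_energy_le {Ω : Set Plane} {L : ℝ} {r : ℝ → Plane}
    (hΩ : IsConvexC5Domain Ω L r) {h : Plane → ℝ} (hh : ContDiff ℝ 1 fun l => h (r l)) :
    ∃ M > 0, ∀ (φ : Plane → ℝ) (R O c : ℝ), IsNeumannSolution Ω h R φ → 0 < O →
      ∀ K : Set Plane, IsCompact K → K ⊆ Ω →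
        ∫⁻ x in K, ENNReal.ofReal (‖fderiv ℝ (fun x => truncation O c (φ x)) x‖ ^ 2)
          ≤ ENNReal.ofReal (M * O) := by
  obtain ⟨p, ρ, hρ, hpρ⟩ := hΩ.exists_closedBall
  have hp : p ∈ Ω := hpρ (mem_closedBall_self hρ.le)
  obtain ⟨σ, hσ, hn⟩ := hΩ.exists_orientation
  obtain ⟨H, hH0, hH⟩ := hΩ.exists_bound_boundary hh
  have hL := hΩ.length_pos
  refine ⟨(H + 1) * Real.pi * L, by have := Real.pi_pos; positivity, ?_⟩
  intro φ R O c hφ hO K hK hKΩ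
  have hXc := hΩ.continuous_rayMap p
  have hrc : Continuous r := hΩ.differentiable.continuous
  have hr'c : Continuous (deriv r) := hΩ.contDiff_deriv.continuous
  -- the normal component of the gradient along the shrunk boundary
  set k : ℝ × ℝ → ℝ := fun q =>
    inner ℝ (gradientWithin φ (closure Ω) (rayMap p r q)) (σ • rot (deriv r q.2)) with hk
  have hkc : ContinuousOn k (Icc 0 1 ×ˢ Icc 0 L) := by
    refine ContinuousOn.inner ?_ (Continuous.continuousOn (by fun_prop))
    exact hφ.continuousOn_gradient.comp hXc.continuousOn
      fun q hq => hΩ.rayMap_mem_closure hp hq.1.1 hq.1.2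
  have huc := (isCompact_Icc.prod isCompact_Icc).uniformContinuousOn_of_continuous hkc
  obtain ⟨ε, hε, hkε⟩ := Metric.uniformContinuousOn_iff.1 huc 1 one_pos
  obtain ⟨s₁, hs₁, hKs⟩ := hΩ.exists_subset_image_rayMap hp hK hKΩ
  -- shrink the domain so little that it still contains `K` and that `k ≤ H + 1` on its boundary
  obtain ⟨s₀, h0, h1, hs10, hsε⟩ : ∃ s₀ : ℝ, 0 ≤ s₀ ∧ s₀ < 1 ∧ s₁ ≤ s₀ ∧ 1 - ε < s₀ :=
    ⟨max (max 0 s₁) (1 - ε / 2), le_max_of_le_left (le_max_left _ _),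
      max_lt (max_lt one_pos hs₁) (by linarith), le_max_of_le_left (le_max_right _ _),
      lt_max_of_lt_right (by linarith)⟩
  have hkle : ∀ l ∈ Icc 0 L, k (s₀, l) ≤ H + 1 := by
    intro l hl
    have h2 := hkε (s₀, l) ⟨⟨h0, h1.le⟩, hl⟩ (1, l) ⟨⟨zero_le_one, le_rfl⟩, hl⟩ (by
      rw [Prod.dist_eq, dist_self, Real.dist_eq, abs_of_neg (by simpa using h1)]
      simp only [neg_sub]
      exact max_lt (by linarith) hε)
    have h3 : k (1, l) = h (r l) := by
      simp only [hk, rayMap, one_smul, add_sub_cancel]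
      exact hφ.neumann _ (hΩ.mem_frontier l) _ (hn l).1
    rw [Real.dist_eq, h3] at h2
    have h4 := (abs_lt.1 h2).2
    have h5 := (abs_le.1 (hH _ (hΩ.mem_frontier l))).2
    linarith
  have hXΩ : ∀ l, rayMap p r (s₀, l) ∈ Ω := fun l => hΩ.rayMap_mem hp h0 h1
  have hflux : s₀ * ∫ l in (0 : ℝ)..L,
      inner ℝ (truncatedField O c φ (rayMap p r (s₀, l))) (σ • rot (deriv r l))
      ≤ (H + 1) * Real.pi * L * O := by
    have hb : ∫ l in (0 : ℝ)..L,
        inner ℝ (truncatedField O c φ (rayMap p r (s₀, l))) (σ • rot (deriv r l))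
        ≤ ∫ l in (0 : ℝ)..L, (Real.pi * O) * (H + 1) := by
      refine intervalIntegral.integral_mono_on hL.le ?_ intervalIntegrable_const fun l hl => ?_
      · refine Continuous.intervalIntegrable ?_ _ _
        refine Continuous.inner ?_ (by fun_prop)
        exact (contDiffOn_truncatedField hΩ.isOpen hφ.contDiffOn O c).continuousOn.comp_continuous
          (by fun_prop) hXΩ
      · have hgrad : (InnerProductSpace.toDual ℝ Plane).symm (fderiv ℝ φ (rayMap p r (s₀, l)))
            = gradientWithin φ (closure Ω) (rayMap p r (s₀, l)) := by
          rw [gradientWithin, fderivWithin_of_mem_nhds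
            (mem_of_superset (hΩ.isOpen.mem_nhds (hXΩ l)) subset_closure)]
        rw [truncatedField, real_inner_smul_left, hgrad]
        have h2 := hkle l hl
        simp only [hk] at h2
        exact (mul_le_mul_of_nonneg_left h2 (truncation_nonneg hO _ _)).trans
          (mul_le_mul_of_nonneg_right (truncation_le hO _ _) (by linarith))
    rw [intervalIntegral.integral_const, smul_eq_mul, sub_zero] at hb
    have hpos : 0 ≤ L * (Real.pi * O * (H + 1)) := by have := Real.pi_pos; positivity
    nlinarith
  obtain ⟨hint, hdiv⟩ := hΩ.integral_divg_rayMap hp σ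
    (contDiffOn_truncatedField hΩ.isOpen hφ.contDiffOn O c) h0 h1
  rw [← hdiv] at hflux
  have hjac : ∀ l, |inner ℝ (r l - p) (rot (deriv r l))|
      = inner ℝ (r l - p) (σ • rot (deriv r l)) := by
    intro l
    have hpos : 0 ≤ inner ℝ (r l - p) (σ • rot (deriv r l)) := by
      rw [real_inner_comm]
      exact hρ.le.trans ((hn l).1.radius_le hρ.le hpρ)
    rw [← abs_of_nonneg hpos, inner_smul_right, abs_mul]
    rcases hσ with h2 | h2 <;> simp [h2]
  have hjac0 : ∀ l, 0 ≤ inner ℝ (r l - p) (σ • rot (deriv r l)) := fun l => by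
    rw [← hjac]; exact abs_nonneg _
  have hle : ∀ q ∈ Icc 0 s₀ ×ˢ Icc 0 L,
      ‖fderiv ℝ (fun x => truncation O c (φ x)) (rayMap p r q)‖ ^ 2
        ≤ divg (fderiv ℝ (truncatedField O c φ) (rayMap p r q)) := fun q hq => by
    have hq' : rayMap p r q ∈ Ω := hΩ.rayMap_mem hp hq.1.1 (hq.1.2.trans_lt h1)
    exact norm_sq_fderiv_truncation_le (hφ.contDiffOn.contDiffAt (hΩ.isOpen.mem_nhds hq'))
      (hφ.laplacian_nonneg _ hq') hO c
  set g : Plane → ℝ≥0∞ := fun x =>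
    ENNReal.ofReal (‖fderiv ℝ (fun x => truncation O c (φ x)) x‖ ^ 2) with hg
  calc ∫⁻ x in K, g x
      ≤ ∫⁻ x in insert p (rayMap p r '' (Ioc 0 s₀ ×ˢ Ico 0 L)), g x :=
        lintegral_mono_set (hKs s₀ hs10)
    _ = ∫⁻ x in rayMap p r '' (Ioc 0 s₀ ×ˢ Ico 0 L), g x := by
        refine setLIntegral_congr ?_
        exact insert_ae_eq_self _ _
    _ = ∫⁻ q in Ioc 0 s₀ ×ˢ Ico 0 L,
          ENNReal.ofReal (q.1 * |inner ℝ (r q.2 - p) (rot (deriv r q.2))|) * g (rayMap p r q) :=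
        hΩ.lintegral_image_rayMap hp g
    _ ≤ ∫⁻ q in Ioc 0 s₀ ×ˢ Ico 0 L,
          ENNReal.ofReal (q.1 * inner ℝ (r q.2 - p) (σ • rot (deriv r q.2))
            * divg (fderiv ℝ (truncatedField O c φ) (rayMap p r q))) := by
        refine setLIntegral_mono' (measurableSet_Ioc.prod measurableSet_Ico) fun q hq => ?_
        have hq0 : 0 ≤ q.1 := hq.1.1.le
        rw [hjac, hg, ← ENNReal.ofReal_mul (mul_nonneg hq0 (hjac0 _))]
        refine ENNReal.ofReal_le_ofReal (mul_le_mul_of_nonneg_left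
          (hle q ⟨Ioc_subset_Icc_self hq.1, Ico_subset_Icc_self hq.2⟩)
          (mul_nonneg hq0 (hjac0 _)))
    _ ≤ ∫⁻ q in Icc 0 s₀ ×ˢ Icc 0 L,
          ENNReal.ofReal (q.1 * inner ℝ (r q.2 - p) (σ • rot (deriv r q.2))
            * divg (fderiv ℝ (truncatedField O c φ) (rayMap p r q))) :=
        lintegral_mono_set (prod_mono Ioc_subset_Icc_self Ico_subset_Icc_self)
    _ = ENNReal.ofReal (∫ q in Icc 0 s₀ ×ˢ Icc 0 L,
          q.1 * inner ℝ (r q.2 - p) (σ • rot (deriv r q.2))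
            * divg (fderiv ℝ (truncatedField O c φ) (rayMap p r q))) := by
        rw [ofReal_integral_eq_lintegral_ofReal hint]
        refine (ae_restrict_iff' (measurableSet_Icc.prod measurableSet_Icc)).2
          (Eventually.of_forall fun q hq => ?_)
        exact mul_nonneg (mul_nonneg hq.1.1 (hjac0 _)) ((sq_nonneg _).trans (hle q hq))
    _ ≤ ENNReal.ofReal ((H + 1) * Real.pi * L * O) := ENNReal.ofReal_le_ofReal hflux

/-! ### The gradient bound for the Neumann problem -/

lemma sq_sub_le_lintegral {k k' : ℝ → ℝ} (hk : ∀ s ∈ Icc (0 : ℝ) 1, HasDerivAt k (k' s) s)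
    (hk' : ContinuousOn k' (Icc 0 1)) :
    ENNReal.ofReal ((k 1 - k 0) ^ 2) ≤ ∫⁻ s in Icc (0 : ℝ) 1, ENNReal.ofReal (k' s ^ 2) := by
  have hu : uIcc (0 : ℝ) 1 = Icc 0 1 := uIcc_of_le zero_le_one
  have hi : IntervalIntegrable k' volume 0 1 := (hu ▸ hk').intervalIntegrable
  have hi2 : IntervalIntegrable (fun s => k' s ^ 2) volume 0 1 :=
    ContinuousOn.intervalIntegrable (hu ▸ hk'.pow 2)
  have hftc : ∫ s in (0 : ℝ)..1, k' s = k 1 - k 0 :=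
    intervalIntegral.integral_eq_sub_of_hasDerivAt (fun s hs => hk s (hu ▸ hs)) hi
  set m := k 1 - k 0 with hm
  have h1 : ∫ s in (0 : ℝ)..1, (2 * m * k' s - m ^ 2) ≤ ∫ s in (0 : ℝ)..1, k' s ^ 2 := by
    refine intervalIntegral.integral_mono_on zero_le_one
      ((hi.const_mul _).sub intervalIntegrable_const) hi2 fun s _ => ?_
    nlinarith [sq_nonneg (k' s - m)]
  rw [intervalIntegral.integral_sub (hi.const_mul _) intervalIntegrable_const,
    intervalIntegral.integral_const_mul, hftc] at h1
  simp only [intervalIntegral.integral_const, sub_zero, one_smul] at h1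
  have h2 : m ^ 2 ≤ ∫ s in Icc (0 : ℝ) 1, k' s ^ 2 := by
    rw [integral_Icc_eq_integral_Ioc, ← intervalIntegral.integral_of_le zero_le_one]
    nlinarith
  refine (ENNReal.ofReal_le_ofReal h2).trans (le_of_eq ?_)
  exact ofReal_integral_eq_lintegral_ofReal (hk'.pow 2).integrableOn_Icc
    (Eventually.of_forall fun s => sq_nonneg _)

lemma lintegral_closedBall_comp_affine (g : Plane → ℝ≥0∞) (a p : Plane) (ρ : ℝ) {τ : ℝ}
    (hτ : 0 < τ) :
    ENNReal.ofReal (τ ^ 2) * ∫⁻ w in closedBall p ρ, g (a + τ • w)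
      = ∫⁻ x in (fun w => a + τ • w) '' closedBall p ρ, g x := by
  have hd : ∀ w : Plane, HasFDerivAt (fun w : Plane => a + τ • w)
      (τ • ContinuousLinearMap.id ℝ Plane) w := fun w =>
    ((hasFDerivAt_id w).const_smul τ).const_add a
  rw [lintegral_image_eq_lintegral_abs_det_fderiv_mul volume measurableSet_closedBall
    (f' := fun _ => τ • ContinuousLinearMap.id ℝ Plane)
    (fun w _ => (hd w).hasFDerivWithinAt)
    (fun w _ w' _ h => smul_right_injective _ hτ.ne' (add_right_injective a h))]
  have hdet : (τ • ContinuousLinearMap.id ℝ Plane).det = τ ^ 2 := by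
    rw [ContinuousLinearMap.det, ContinuousLinearMap.toLinearMap_smul, LinearMap.det_smul]
    simp
  simp only [hdet, abs_of_nonneg (sq_nonneg τ)]
  rw [lintegral_const_mul' _ _ ENNReal.ofReal_ne_top]

lemma IsNeumannSolution.lipschitz {Ω : Set Plane} {L : ℝ} {r : ℝ → Plane}
    (hΩ : IsConvexC5Domain Ω L r) {h φ : Plane → ℝ} {R G : ℝ} (hφ : IsNeumannSolution Ω h R φ)
    (hG : ∀ x ∈ closure Ω, ‖gradientWithin φ (closure Ω) x‖ ≤ G) {x y : Plane}
    (hx : x ∈ closure Ω) (hy : y ∈ closure Ω) : |φ x - φ y| ≤ G * ‖x - y‖ :=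
  hΩ.convex.closure.norm_image_sub_le_of_norm_hasFDerivWithin_le
    (fun z hz => hφ.hasFDerivWithinAt hz)
    (fun z hz => by rw [innerSL_apply_norm]; exact hG z hz) hy hx

/-- The oscillation of a solution between two points, interpolated between the energy of its
truncations and its Lipschitz constant `G`: if `φ x - φ y = O`, contract the segment from `y` to `x`
towards the points `w` of a ball in `Ω`, by the ratio `1 - τ` with `τ` comparable to `O / G`. This
moves the ends so little that `φ` still differs by at least `O / 2` between them, and for fixed `s`
the points with the parameter `s` on these segments fill a ball with radius comparable to `τ`. -/
lemma exists_oscillation_le {Ω : Set Plane} {L : ℝ} {r : ℝ → Plane}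
    (hΩ : IsConvexC5Domain Ω L r) {h : Plane → ℝ} (hh : ContDiff ℝ 1 fun l => h (r l)) :
    ∃ C > 0, ∀ (φ : Plane → ℝ) (R G : ℝ), IsNeumannSolution Ω h R φ →
      (∀ x ∈ closure Ω, ‖gradientWithin φ (closure Ω) x‖ ≤ G) →
      ∀ x ∈ closure Ω, ∀ y ∈ closure Ω, |φ x - φ y| ^ 3 ≤ C * ‖x - y‖ ^ 2 * G ^ 2 := by
  obtain ⟨p, ρ, hρ, hpρ⟩ := hΩ.exists_closedBall
  obtain ⟨M, hM, hen⟩ := exists_truncation_energy_le hΩ hh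
  obtain ⟨D, hD0, hD⟩ : ∃ D > 0, ∀ x ∈ closure Ω, ∀ y ∈ closure Ω, ‖x - y‖ ≤ D :=
    ⟨diam (closure Ω) + 1, by positivity, fun x hx y hy => by
      have := dist_le_diam_of_mem hΩ.isCompact_closure.isBounded hx hy
      rw [dist_eq_norm] at this
      linarith⟩
  set V : ℝ := volume.real (closedBall p ρ) with hV
  have hV0 : 0 < V := ENNReal.toReal_pos (measure_closedBall_pos _ _ hρ).ne'
    measure_closedBall_lt_top.ne
  set m : ℝ := 2 * Real.arctan (1 / 4) with hm
  have hm0 : 0 < m := by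
    have := Real.arctan_pos.2 (show (0 : ℝ) < 1 / 4 by norm_num)
    positivity
  refine ⟨16 * M * D ^ 2 / (V * m ^ 2), by positivity, ?_⟩
  intro φ R G hφ hG
  have hG0 : 0 ≤ G :=
    (norm_nonneg _).trans (hG p (subset_closure (hpρ (mem_closedBall_self hρ.le))))
  suffices key : ∀ x ∈ closure Ω, ∀ y ∈ closure Ω, 0 < φ x - φ y →
      (φ x - φ y) ^ 3 ≤ 16 * M * D ^ 2 / (V * m ^ 2) * ‖x - y‖ ^ 2 * G ^ 2 by
    intro x hx y hy
    rcases lt_trichotomy (φ x - φ y) 0 with h0 | h0 | h0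
    · rw [abs_of_neg h0, neg_sub, norm_sub_rev]
      exact key y hy x hx (by linarith)
    · rw [h0, abs_zero, zero_pow three_ne_zero]
      positivity
    · rw [abs_of_pos h0]
      exact key x hx y hy h0
  intro x hx y hy hO
  set O := φ x - φ y with hOdef
  have hOG : O ≤ G * ‖x - y‖ := (le_abs_self _).trans (hφ.lipschitz hΩ hG hx hy)
  have hGpos : 0 < G := by
    rcases hG0.lt_or_eq with h1 | h1
    · exact h1
    · rw [← h1, zero_mul] at hOG; linarith
  set τ : ℝ := O / (4 * D * G) with hτ
  have hτ0 : 0 < τ := by positivity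
  have hτ1 : τ ≤ 1 / 4 := by
    rw [hτ, div_le_iff₀ (by positivity)]
    have := mul_le_mul_of_nonneg_left (hD x hx y hy) hGpos.le
    linarith
  have hτDG : G * (τ * D) = O / 4 := by rw [hτ]; field_simp
  -- truncate around the mean value, where the truncation is steep
  set c : ℝ := (φ x + φ y) / 2 with hc
  set ψ : Plane → ℝ := fun x => truncation O c (φ x) with hψ
  set B : Set Plane := closedBall p ρ with hB
  have hmemB : ∀ u ∈ closure Ω, ∀ w ∈ B, (1 - τ) • u + τ • w ∈ Ω := by
    intro u hu w hw
    have := hΩ.convex.combo_closure_interior_mem_interior hu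
      (by rw [hΩ.isOpen.interior_eq]; exact hpρ hw) (a := 1 - τ) (b := τ) (by linarith) hτ0
      (by ring)
    rwa [hΩ.isOpen.interior_eq] at this
  have hclose : ∀ u ∈ closure Ω, ∀ w ∈ B, |φ ((1 - τ) • u + τ • w) - φ u| ≤ O / 4 := by
    intro u hu w hw
    refine (hφ.lipschitz hΩ hG (subset_closure (hmemB u hu w hw)) hu).trans ?_
    have e : (1 - τ) • u + τ • w - u = τ • (w - u) := by
      rw [sub_smul, one_smul, smul_sub]; abel
    rw [← hτDG, e, norm_smul, Real.norm_eq_abs, abs_of_pos hτ0]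
    exact mul_le_mul_of_nonneg_left
      (mul_le_mul_of_nonneg_left (hD w (subset_closure (hpρ hw)) u hu) hτ0.le) hG0
  set d : Plane := (1 - τ) • (x - y) with hd
  have hdn : ‖d‖ ≤ ‖x - y‖ := by
    rw [hd, norm_smul, Real.norm_eq_abs, abs_of_nonneg (by linarith)]
    exact mul_le_of_le_one_left (norm_nonneg _) (by linarith)
  have hseg : ∀ w ∈ B, ∀ s ∈ Icc (0 : ℝ) 1, ((1 - τ) • y + s • d) + τ • w ∈ Ω := by
    intro w hw s hs
    have h1 := hΩ.convex (hmemB y hy w hw) (hmemB x hx w hw) (a := 1 - s) (b := s)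
      (by linarith [hs.2]) hs.1 (by ring)
    convert h1 using 1
    rw [hd]
    module
  have hjump : ∀ w ∈ B, m * O ≤ ψ (((1 - τ) • y + (1 : ℝ) • d) + τ • w)
      - ψ (((1 - τ) • y + (0 : ℝ) • d) + τ • w) := by
    intro w hw
    have e1 : ((1 - τ) • y + (1 : ℝ) • d) + τ • w = (1 - τ) • x + τ • w := by
      rw [hd]; module
    have e0 : ((1 - τ) • y + (0 : ℝ) • d) + τ • w = (1 - τ) • y + τ • w := by
      rw [zero_smul, add_zero]
    rw [e1, e0]
    have h1 := (abs_le.1 (hclose x hx w hw)).1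
    have h0 := (abs_le.1 (hclose y hy w hw)).2
    have a1 : 1 / 4 ≤ (φ ((1 - τ) • x + τ • w) - c) / O := by
      rw [le_div_iff₀ hO]; linarith
    have a0 : (φ ((1 - τ) • y + τ • w) - c) / O ≤ -(1 / 4) := by
      rw [div_le_iff₀ hO]; linarith
    have b1 := Real.arctan_strictMono.monotone a1
    have b0 := Real.arctan_strictMono.monotone a0
    rw [Real.arctan_neg] at b0
    simp only [hψ, truncation]
    rw [hm]
    nlinarith
  have hψd : ContDiffOn ℝ 1 ψ Ω :=
    ((contDiff_truncation O c).of_le (by norm_num)).comp_contDiffOn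
      (hφ.contDiffOn.of_le (by norm_num))
  set g : Plane → ℝ≥0∞ := fun x => ENNReal.ofReal (‖fderiv ℝ ψ x‖ ^ 2) with hg
  have hgm : Measurable g := by
    have := measurable_fderiv ℝ ψ
    fun_prop
  have hpt : ∀ w ∈ B, ENNReal.ofReal ((m * O) ^ 2) ≤
      ∫⁻ s in Icc (0 : ℝ) 1, ENNReal.ofReal (‖x - y‖ ^ 2) * g (((1 - τ) • y + s • d) + τ • w) := by
    intro w hw
    have hline : ∀ s : ℝ, HasDerivAt (fun s : ℝ => ((1 - τ) • y + s • d) + τ • w) d s := fun s => by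
      simpa using (((hasDerivAt_id s).smul_const d).const_add ((1 - τ) • y)).add_const (τ • w)
    have h1 := sq_sub_le_lintegral (k := fun s => ψ (((1 - τ) • y + s • d) + τ • w))
      (k' := fun s => fderiv ℝ ψ (((1 - τ) • y + s • d) + τ • w) d)
      (fun s hs => by
        have hs' := ((hψd.contDiffAt (hΩ.isOpen.mem_nhds (hseg w hw s hs))).differentiableAt
          (by norm_num)).hasFDerivAt
        exact hs'.comp_hasDerivAt s (hline s))
      (((hψd.continuousOn_fderiv_of_isOpen hΩ.isOpen (by norm_num)).comp
        (Continuous.continuousOn (by fun_prop)) (fun s hs => hseg w hw s hs)).clm_apply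
        continuousOn_const)
    refine (ENNReal.ofReal_le_ofReal ?_).trans (h1.trans (lintegral_mono fun s => ?_))
    · exact pow_le_pow_left₀ (by positivity) (hjump w hw) 2
    · rw [hg, ← ENNReal.ofReal_mul (by positivity), ← mul_pow]
      refine ENNReal.ofReal_le_ofReal ?_
      rw [sq_le_sq, abs_of_nonneg (by positivity : 0 ≤ ‖x - y‖ * _), mul_comm]
      exact ((fderiv ℝ ψ _).le_opNorm d).trans
        (mul_le_mul_of_nonneg_left hdn (norm_nonneg _))
  have himg : ∀ s ∈ Icc (0 : ℝ) 1,
      ENNReal.ofReal (τ ^ 2) * ∫⁻ w in B, g (((1 - τ) • y + s • d) + τ • w)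
        ≤ ENNReal.ofReal (M * O) := by
    intro s hs
    rw [lintegral_closedBall_comp_affine g _ p ρ hτ0]
    refine hen φ R O c hφ hO _ ((isCompact_closedBall p ρ).image (by fun_prop)) ?_
    rintro _ ⟨w, hw, rfl⟩
    exact hseg w hw s hs
  have hmeas : Measurable fun q : Plane × ℝ =>
      ENNReal.ofReal (‖x - y‖ ^ 2) * g (((1 - τ) • y + q.2 • d) + τ • q.1) := by
    have : Measurable fun q : Plane × ℝ => ((1 - τ) • y + q.2 • d) + τ • q.1 := by fun_prop
    exact (hgm.comp this).const_mul _
  have hfin : ENNReal.ofReal (τ ^ 2 * ((m * O) ^ 2 * V))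
      ≤ ENNReal.ofReal (‖x - y‖ ^ 2 * (M * O)) := by
    calc ENNReal.ofReal (τ ^ 2 * ((m * O) ^ 2 * V))
        = ENNReal.ofReal (τ ^ 2) * ∫⁻ w in B, ENNReal.ofReal ((m * O) ^ 2) := by
          rw [setLIntegral_const, ENNReal.ofReal_mul (by positivity),
            ENNReal.ofReal_mul (by positivity), hV, measureReal_def,
            ENNReal.ofReal_toReal measure_closedBall_lt_top.ne]
      _ ≤ ENNReal.ofReal (τ ^ 2) * ∫⁻ w in B, ∫⁻ s in Icc (0 : ℝ) 1,
            ENNReal.ofReal (‖x - y‖ ^ 2) * g (((1 - τ) • y + s • d) + τ • w) :=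
          mul_le_mul_right (setLIntegral_mono' measurableSet_closedBall hpt) _
      _ = ENNReal.ofReal (τ ^ 2) * ∫⁻ s in Icc (0 : ℝ) 1, ∫⁻ w in B,
            ENNReal.ofReal (‖x - y‖ ^ 2) * g (((1 - τ) • y + s • d) + τ • w) := by
          rw [lintegral_lintegral_swap]
          exact hmeas.aemeasurable
      _ = ∫⁻ s in Icc (0 : ℝ) 1, ENNReal.ofReal (‖x - y‖ ^ 2) * (ENNReal.ofReal (τ ^ 2) *
            ∫⁻ w in B, g (((1 - τ) • y + s • d) + τ • w)) := by
          rw [← lintegral_const_mul' _ _ ENNReal.ofReal_ne_top]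
          refine lintegral_congr fun s => ?_
          rw [lintegral_const_mul' _ _ ENNReal.ofReal_ne_top]
          ring
      _ ≤ ∫⁻ s in Icc (0 : ℝ) 1, ENNReal.ofReal (‖x - y‖ ^ 2) * ENNReal.ofReal (M * O) :=
          setLIntegral_mono' measurableSet_Icc fun s hs => mul_le_mul_right (himg s hs) _
      _ = ENNReal.ofReal (‖x - y‖ ^ 2 * (M * O)) := by
          rw [setLIntegral_const, ENNReal.ofReal_mul (sq_nonneg ‖x - y‖), Real.volume_Icc, sub_zero,
            ENNReal.ofReal_one, mul_one]
  rw [ENNReal.ofReal_le_ofReal_iff (by positivity)] at hfin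
  rw [div_mul_eq_mul_div, div_mul_eq_mul_div, le_div_iff₀ (by positivity)]
  have hτ2 : τ ^ 2 * (16 * D ^ 2 * G ^ 2) = O ^ 2 := by rw [hτ]; field_simp; norm_num
  have h1 := mul_le_mul_of_nonneg_right hfin (show 0 ≤ 16 * D ^ 2 * G ^ 2 by positivity)
  have h2 : O * (O ^ 3 * (V * m ^ 2)) ≤ O * (16 * M * D ^ 2 * ‖x - y‖ ^ 2 * G ^ 2) := by
    calc O * (O ^ 3 * (V * m ^ 2)) = τ ^ 2 * (16 * D ^ 2 * G ^ 2) * (m * O) ^ 2 * V := by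
          rw [hτ2]; ring
      _ = τ ^ 2 * ((m * O) ^ 2 * V) * (16 * D ^ 2 * G ^ 2) := by ring
      _ ≤ ‖x - y‖ ^ 2 * (M * O) * (16 * D ^ 2 * G ^ 2) := h1
      _ = O * (16 * M * D ^ 2 * ‖x - y‖ ^ 2 * G ^ 2) := by ring
  exact le_of_mul_le_mul_left h2 hO

/-- The gradient of a solution of the Neumann problem for `0 ≤ Δφ ≤ R` is bounded by a multiple of
`√R`. -/
theorem exists_gradient_le_sqrt {Ω : Set Plane} {L : ℝ} {r : ℝ → Plane}
    (hΩ : IsConvexC5Domain Ω L r) {h : Plane → ℝ} (hh : ContDiff ℝ 1 fun l => h (r l)) :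
    ∃ C > 0, ∃ R₁ > 0, ∀ (φ : Plane → ℝ) (R : ℝ), IsNeumannSolution Ω h R φ → R₁ ≤ R →
      ∀ x ∈ closure Ω, ‖gradientWithin φ (closure Ω) x‖ ≤ C * √R := by
  obtain ⟨C₀, hC₀, hosc⟩ := exists_oscillation_le hΩ hh
  obtain ⟨c, hc, C₁, hC₁, hbdry⟩ := exists_boundary_lipschitz hΩ hh
  set a : ℝ := 55 * (4 + C₁) with ha
  set C : ℝ := a + 495 * (1 + 4 * C₀ * (a + 495) ^ 2) with hC
  refine ⟨C, by positivity, 1 + 1 / c ^ 2, by positivity, ?_⟩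
  intro φ R hφ hR₁
  have hR1 : 1 ≤ R := le_trans (by linarith [show (0 : ℝ) ≤ 1 / c ^ 2 by positivity]) hR₁
  have hR0 : 0 < R := by linarith
  set δ : ℝ := 1 / √R with hδ
  have hsR : 0 < √R := Real.sqrt_pos.2 hR0
  have hδ0 : 0 < δ := by positivity
  have hRδ : R * δ ^ 2 = 1 := by rw [hδ, div_pow, Real.sq_sqrt hR0.le]; field_simp
  have hδ1 : δ ≤ 1 := by
    rw [hδ, div_le_one hsR]
    exact Real.one_le_sqrt.2 hR1
  have hδc : δ ≤ c := by
    rw [hδ, div_le_iff₀ hsR]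
    have h1 : 1 / c ≤ √R := by
      rw [Real.le_sqrt (by positivity) hR0.le, div_pow, one_pow]
      linarith
    rw [div_le_iff₀ hc] at h1
    linarith
  obtain ⟨xm, hxm, hmax⟩ := hΩ.isCompact_closure.exists_isMaxOn hΩ.nonempty.closure
    hφ.continuousOn_gradient.norm
  set G := ‖gradientWithin φ (closure Ω) xm‖ with hGdef
  have hG : ∀ x ∈ closure Ω, ‖gradientWithin φ (closure Ω) x‖ ≤ G := hmax
  have hG0 : 0 ≤ G := norm_nonneg _
  obtain ⟨O, hO0, hO3⟩ : ∃ O : ℝ, 0 ≤ O ∧ O ^ 3 = 4 * C₀ * (δ * G) ^ 2 :=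
    ⟨(4 * C₀ * (δ * G) ^ 2) ^ ((3 : ℕ) : ℝ)⁻¹, by positivity,
      Real.rpow_inv_natCast_pow (by positivity) (by norm_num)⟩
  have hoscO : ∀ x ∈ closure Ω, ∀ y ∈ closure Ω, ‖x - y‖ ≤ 2 * δ → φ x - φ y ≤ O := by
    intro x hx y hy hxy
    refine (le_abs_self _).trans ?_
    have h1 := hosc φ R G hφ hG x hx y hy
    have h2 : C₀ * ‖x - y‖ ^ 2 * G ^ 2 ≤ O ^ 3 := by
      rw [hO3]
      have h3 : ‖x - y‖ ^ 2 ≤ (2 * δ) ^ 2 := pow_le_pow_left₀ (norm_nonneg _) hxy 2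
      have h4 := mul_le_mul_of_nonneg_left h3 (mul_nonneg hC₀.le (sq_nonneg G))
      nlinarith
    exact le_of_pow_le_pow_left₀ three_ne_zero hO0 (h1.trans h2)
  set Kb : ℝ := 4 * R * δ + 9 * (O / δ) + C₁ with hKb
  have hKb0 : 0 < Kb := by positivity
  have hRδK : 4 * R * δ ≤ Kb := by
    have : 0 ≤ 9 * (O / δ) + C₁ := by positivity
    linarith
  have hOδK : 9 * (O / δ) ≤ Kb := by
    have : 0 ≤ 4 * R * δ + C₁ := by positivity
    linarith
  have hint : ∀ x ∈ Ω, ‖gradientWithin φ (closure Ω) x‖ ≤ 55 * Kb := by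
    intro x hx
    by_cases hball : closedBall x (δ / 2) ⊆ Ω
    · -- away from the boundary
      have h1 := hφ.gradient_le_of_ball hΩ hR0 (half_pos hδ0) hball hO0 (by
        intro u hu v hv
        refine hoscO u (subset_closure (hball hu)) v (subset_closure (hball hv)) ?_
        rw [mem_closedBall] at hu hv
        rw [← dist_eq_norm]
        linarith [dist_triangle_right u v x])
      have h2 : 9 * (O / (δ / 2)) = 2 * (9 * (O / δ)) := by field_simp
      rw [h2] at h1
      linarith
    · -- close to the boundary: the nearest boundary point controls the oscillation around `x`
      obtain ⟨u, hu, huΩ⟩ := not_subset.1 hball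
      obtain ⟨z, hz, hdist⟩ := hΩ.isOpen.isClosed_compl.exists_infDist_eq_dist ⟨u, huΩ⟩ x
      set t := dist x z with ht
      have hxz : x ≠ z := fun h => hz (h ▸ hx)
      have ht0 : 0 < t := dist_pos.2 hxz
      have htδ : t ≤ δ / 2 := by
        rw [← hdist]
        refine (infDist_le_dist_of_mem (show u ∈ Ωᶜ from huΩ)).trans ?_
        rw [dist_comm]; exact hu
      have hbt : ball x t ⊆ Ω := fun v hv => by
        by_contra hcon
        have := infDist_le_dist_of_mem (x := x) (show v ∈ Ωᶜ from hcon)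
        rw [hdist, dist_comm] at this
        exact absurd hv (by simpa using this)
      have hzf : z ∈ frontier Ω := by
        rw [hΩ.isOpen.frontier_eq]
        refine ⟨closure_mono hbt ?_, hz⟩
        rw [closure_ball x ht0.ne', mem_closedBall, dist_comm]
      have hbz := hbdry φ R O δ z hφ hR0 hδ0 hδc hzf hO0 (by
        intro u hu v hv huz hvz
        refine hoscO u hu v hv ?_
        have := norm_sub_le (u - z) (v - z)
        rw [sub_sub_sub_cancel_right] at this
        linarith)
      have hsmall : closedBall x (t / 2) ⊆ Ω :=
        (closedBall_subset_ball (half_lt_self ht0)).trans hbt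
      have hval : ∀ v ∈ closedBall x (t / 2), |φ v - φ z| ≤ Kb * (3 / 2 * t) := by
        intro v hv
        have hvz : ‖v - z‖ ≤ 3 / 2 * t := by
          rw [← dist_eq_norm]
          have := dist_triangle v x z
          rw [mem_closedBall] at hv
          linarith
        exact (hbz v (subset_closure (hsmall hv)) (by linarith)).trans
          (mul_le_mul_of_nonneg_left hvz hKb0.le)
      have h1 := hφ.gradient_le_of_ball hΩ hR0 (half_pos ht0) hsmall
        (O := 3 * Kb * t) (by positivity) (by
        intro u hu v hv
        have h2 := (abs_le.1 (hval u hu)).2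
        have h3 := (abs_le.1 (hval v hv)).1
        linarith)
      have h2 : 9 * (3 * Kb * t / (t / 2)) = 54 * Kb := by field_simp; norm_num
      have h3 : 4 * R * (t / 2) ≤ 4 * R * δ := by
        refine mul_le_mul_of_nonneg_left ?_ (by positivity)
        linarith
      rw [h2] at h1
      linarith
  have hGK : G ≤ 55 * Kb := by
    refine ContinuousWithinAt.closure_le hxm ?_ continuousWithinAt_const hint
    exact ((hφ.continuousOn_gradient xm hxm).mono subset_closure).norm
  -- `X ≤ a + 495 O` and `O ^ 3 = 4 C₀ X ^ 2` bound both `X` and `O`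
  set X := δ * G with hX
  have hX0 : 0 ≤ X := by positivity
  have hXa : X ≤ a + 495 * O := by
    have h1 := mul_le_mul_of_nonneg_left hGK hδ0.le
    have h2 : δ * (55 * Kb) = 55 * (4 * (R * δ ^ 2) + C₁ * δ) + 495 * O := by
      rw [hKb]; field_simp; ring
    rw [h2, hRδ] at h1
    have h3 : C₁ * δ ≤ C₁ := mul_le_of_le_one_right hC₁.le hδ1
    rw [hX, ha]
    linarith
  have hOb : O ≤ 1 + 4 * C₀ * (a + 495) ^ 2 := by
    have ha0 : 0 < a := by positivity
    rcases le_total O 1 with h1 | h1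
    · have : 0 ≤ 4 * C₀ * (a + 495) ^ 2 := by positivity
      linarith
    · have h2 : X ≤ (a + 495) * O := by nlinarith
      have h3 : O ^ 3 ≤ 4 * C₀ * ((a + 495) * O) ^ 2 := by
        rw [hO3]
        exact mul_le_mul_of_nonneg_left (pow_le_pow_left₀ hX0 h2 2) (by positivity)
      have h4 : O ^ 2 * O ≤ O ^ 2 * (4 * C₀ * (a + 495) ^ 2) := by nlinarith
      have h5 := le_of_mul_le_mul_left h4 (by positivity)
      linarith
  intro x hx
  refine (hG x hx).trans ?_
  have hGX : G = X * √R := by rw [hX, hδ]; field_simp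
  rw [hGX]
  refine mul_le_mul_of_nonneg_right ?_ hsR.le
  rw [hC]
  linarith

/-! ### A maximum principle for the Vlasov equation with specular reflection -/

/-- The energy `√(1 + |v|²)` of a particle of momentum `v`. -/
def energy (v : Plane) : ℝ := √(1 + ‖v‖ ^ 2)

lemma energy_pos (v : Plane) : 0 < energy v := Real.sqrt_pos.2 (by positivity)

lemma norm_le_energy (v : Plane) : ‖v‖ ≤ energy v :=
  Real.le_sqrt_of_sq_le (by linarith)

lemma continuous_energy : Continuous energy := by
  unfold energy
  fun_prop

lemma norm_velocity_le (v : Plane) : ‖velocity v‖ ≤ 1 := by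
  have h := energy_pos v
  rw [velocity, norm_smul, Real.norm_eq_abs, abs_of_pos (by positivity), one_div]
  exact (inv_mul_le_iff₀ h).2 (by rw [mul_one]; exact norm_le_energy v)

lemma hasFDerivAt_energy (v : Plane) : HasFDerivAt energy (innerSL ℝ (velocity v)) v := by
  have h := energy_pos v
  have h1 : HasFDerivAt (fun v : Plane => 1 + ‖v‖ ^ 2) (2 • innerSL ℝ v) v :=
    (hasStrictFDerivAt_norm_sq v).hasFDerivAt.const_add 1
  refine (h1.sqrt (by positivity)).congr_fderiv ?_
  ext u
  simp [velocity]
  field_simp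

lemma norm_reflect {n : Plane} (hn : ‖n‖ = 1) (v : Plane) : ‖reflect n v‖ = ‖v‖ := by
  have h : ‖reflect n v‖ ^ 2 = ‖v‖ ^ 2 := by
    rw [reflect, norm_sub_sq_real, norm_smul, inner_smul_right, hn, real_inner_comm n v,
      mul_one, Real.norm_eq_abs, sq_abs]
    ring
  exact (pow_left_inj₀ (norm_nonneg _) (norm_nonneg _) two_ne_zero).1 h

lemma energy_reflect {n : Plane} (hn : ‖n‖ = 1) (v : Plane) : energy (reflect n v) = energy v := by
  rw [energy, energy, norm_reflect hn]

lemma inner_reflect {n : Plane} (hn : ‖n‖ = 1) (v : Plane) :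
    inner ℝ n (reflect n v) = -inner ℝ n v := by
  rw [reflect, inner_sub_right, inner_smul_right, real_inner_self_eq_norm_sq, hn]
  ring

/-- A subsolution of the Vlasov equation that is invariant under specular reflection is bounded by
its initial values. At a boundary maximum the spatial gradient is a nonnegative multiple of the
outer normal, and of the two momenta exchanged by the reflection one points outwards. -/
theorem le_of_vlasov_subsolution {Ω : Set Plane} {L : ℝ} {r : ℝ → Plane}
    (hΩ : IsConvexC5Domain Ω L r) {T K M c : ℝ} (hT : 0 < T) {E : ℝ → Plane → Plane}
    (hE : ∀ t ∈ Icc 0 T, ∀ x ∈ closure Ω, ‖E t x‖ ≤ K) {w : ℝ → Plane → Plane → ℝ}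
    (hwc : ContinuousOn (fun q : ℝ × Plane × Plane => w q.1 q.2.1 q.2.2)
      (Icc 0 T ×ˢ closure Ω ×ˢ univ))
    (hwM : ∀ t ∈ Icc 0 T, ∀ x ∈ closure Ω, ∀ v, w t x v ≤ M)
    {wt : ℝ → Plane → Plane → ℝ} {wx wv : ℝ → Plane → Plane → Plane →L[ℝ] ℝ}
    (hwt : ∀ t ∈ Ioc 0 T, ∀ x ∈ closure Ω, ∀ v,
      HasDerivWithinAt (fun s => w s x v) (wt t x v) (Icc 0 T) t)
    (hwx : ∀ t ∈ Ioc 0 T, ∀ x ∈ closure Ω, ∀ v,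
      HasFDerivWithinAt (fun y => w t y v) (wx t x v) (closure Ω) x)
    (hwv : ∀ t ∈ Ioc 0 T, ∀ x ∈ closure Ω, ∀ v, HasFDerivAt (fun u => w t x u) (wv t x v) v)
    (heq : ∀ t ∈ Ioc 0 T, ∀ x ∈ closure Ω, ∀ v,
      wt t x v + wx t x v (velocity v) + wv t x v (E t x) ≤ 0)
    (hrefl : ∀ t ∈ Ioc 0 T, ∀ x ∈ frontier Ω, ∀ n, IsOuterUnitNormal Ω x n →
      ∀ v, w t x v = w t x (reflect n v))
    (h0 : ∀ x ∈ closure Ω, ∀ v, w 0 x v ≤ c) :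
    ∀ t ∈ Icc 0 T, ∀ x ∈ closure Ω, ∀ v, w t x v ≤ c := by
  intro t₁ ht₁ x₁ hx₁ v₁
  by_contra! hcon
  have hK : 0 ≤ K := (norm_nonneg _).trans (hE t₁ ht₁ x₁ hx₁)
  have hpen : 0 < energy v₁ + (K + 1) * t₁ := by
    have := energy_pos v₁
    have := ht₁.1
    positivity
  set δ : ℝ := (w t₁ x₁ v₁ - c) / (2 * (energy v₁ + (K + 1) * t₁)) with hδ
  have hδ0 : 0 < δ := div_pos (by linarith) (by positivity)
  -- the term with `t` outweighs the field acting on the energy, which grows at most at the rate `K`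
  set W : ℝ → Plane → Plane → ℝ := fun t x v => w t x v - δ * (energy v + (K + 1) * t) with hW
  have hW₁ : c < W t₁ x₁ v₁ := by
    have : δ * (energy v₁ + (K + 1) * t₁) = (w t₁ x₁ v₁ - c) / 2 := by rw [hδ]; field_simp
    simp only [hW, this]
    linarith
  -- the maximum of `W` is attained at a momentum below `V`
  set V : ℝ := max ‖v₁‖ ((M - c) / δ) with hV
  have hVle : M - δ * V ≤ c := by
    have : (M - c) / δ ≤ V := le_max_right _ _
    rw [div_le_iff₀ hδ0] at this
    linarith
  have hcomp : IsCompact (Icc 0 T ×ˢ closure Ω ×ˢ closedBall (0 : Plane) V) :=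
    isCompact_Icc.prod (hΩ.isCompact_closure.prod (isCompact_closedBall _ _))
  have hWc : ContinuousOn (fun q : ℝ × Plane × Plane => W q.1 q.2.1 q.2.2)
      (Icc 0 T ×ˢ closure Ω ×ˢ closedBall (0 : Plane) V) := by
    have he := continuous_energy
    exact (hwc.mono (prod_mono le_rfl (prod_mono le_rfl (subset_univ _)))).sub
      (Continuous.continuousOn (by fun_prop))
  have hmem₁ : (t₁, x₁, v₁) ∈ Icc 0 T ×ˢ closure Ω ×ˢ closedBall (0 : Plane) V :=
    ⟨ht₁, hx₁, by simp [hV]⟩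
  obtain ⟨⟨t₀, x₀, v₀⟩, ⟨ht₀, hx₀, hv₀⟩, hmax⟩ := hcomp.exists_isMaxOn ⟨_, hmem₁⟩ hWc
  simp only at ht₀ hx₀ hv₀
  have hmax' : ∀ t ∈ Icc 0 T, ∀ x ∈ closure Ω, ∀ v, ‖v‖ ≤ V → W t x v ≤ W t₀ x₀ v₀ :=
    fun t ht x hx v hv => hmax (show (t, x, v) ∈ _ from ⟨ht, hx, by simpa using hv⟩)
  have hW₀ : c < W t₀ x₀ v₀ := hW₁.trans_le (hmax hmem₁)
  have ht₀pos : 0 < t₀ := by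
    rcases ht₀.1.lt_or_eq with h | h
    · exact h
    · exfalso
      have h2 := h0 x₀ hx₀ v₀
      have h3 := mul_nonneg hδ0.le (energy_pos v₀).le
      simp only [hW, ← h, mul_zero, add_zero] at hW₀
      linarith
  have ht₀' : t₀ ∈ Ioc 0 T := ⟨ht₀pos, ht₀.2⟩
  -- no maximum at a momentum in whose direction the spatial derivative is nonnegative
  have hfalse : ∀ v, ‖v‖ ≤ V → W t₀ x₀ v = W t₀ x₀ v₀ → 0 ≤ wx t₀ x₀ v (velocity v) → False := by
    intro v hvV hWv hxv
    have hvlt : ‖v‖ < V := by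
      refine lt_of_le_of_ne hvV fun h => ?_
      have h1 := hwM t₀ ht₀ x₀ hx₀ v
      have h2 := mul_le_mul_of_nonneg_left (norm_le_energy v) hδ0.le
      have h3 : 0 ≤ δ * ((K + 1) * t₀) := by positivity
      rw [← hWv] at hW₀
      simp only [hW] at hW₀
      rw [h] at h2
      linarith
    have hdt : δ * (K + 1) ≤ wt t₀ x₀ v := by
      have hd : HasDerivWithinAt (fun s => W s x₀ v) (wt t₀ x₀ v - δ * ((K + 1) * 1))
          (Icc 0 T) t₀ :=
        (hwt t₀ ht₀' x₀ hx₀ v).sub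
          ((((hasDerivWithinAt_id t₀ _).const_mul (K + 1)).const_add (energy v)).const_mul δ)
      have hm : IsLocalMaxOn (fun s => W s x₀ v) (Icc 0 T) t₀ := by
        filter_upwards [self_mem_nhdsWithin] with s hs
        rw [hWv]
        exact hmax' s hs x₀ hx₀ v hvV
      have hcone : (0 : ℝ) - t₀ ∈ posTangentConeAt (Icc 0 T) t₀ := by
        refine mem_posTangentConeAt_of_segment_subset ?_
        rw [add_sub_cancel]
        exact (convex_Icc 0 T).segment_subset ht₀ ⟨le_rfl, hT.le⟩
      have h1 := hm.hasFDerivWithinAt_nonpos hd.hasFDerivWithinAt hcone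
      simp at h1
      nlinarith
    have hdv : wv t₀ x₀ v = δ • innerSL ℝ (velocity v) := by
      have hd : HasFDerivAt (fun u => W t₀ x₀ u) (wv t₀ x₀ v - δ • innerSL ℝ (velocity v)) v :=
        (hwv t₀ ht₀' x₀ hx₀ v).sub (((hasFDerivAt_energy v).add_const ((K + 1) * t₀)).const_mul δ)
      have hm : IsLocalMax (fun u => W t₀ x₀ u) v := by
        have : ∀ᶠ u in 𝓝 v, ‖u‖ < V :=
          continuous_norm.continuousAt.eventually_lt continuousAt_const hvlt
        filter_upwards [this] with u hu
        rw [hWv]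
        exact hmax' t₀ ht₀ x₀ hx₀ u hu.le
      exact sub_eq_zero.1 (hm.hasFDerivAt_eq_zero hd)
    have h1 := heq t₀ ht₀' x₀ hx₀ v
    rw [hdv] at h1
    have h2 : -K ≤ inner ℝ (velocity v) (E t₀ x₀) := by
      have h3 := abs_real_inner_le_norm (velocity v) (E t₀ x₀)
      have h4 := mul_le_mul (norm_velocity_le v) (hE t₀ ht₀ x₀ hx₀) (norm_nonneg _) zero_le_one
      linarith [neg_abs_le (inner ℝ (velocity v) (E t₀ x₀))]
    have h3 := mul_le_mul_of_nonneg_left h2 hδ0.le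
    simp only [smul_apply, innerSL_apply_apply, smul_eq_mul] at h1
    nlinarith
  have hWx : ∀ v, HasFDerivWithinAt (fun y => W t₀ y v) (wx t₀ x₀ v) (closure Ω) x₀ := fun v =>
    (hwx t₀ ht₀' x₀ hx₀ v).sub_const _
  have hWm : ∀ v, ‖v‖ ≤ V → W t₀ x₀ v = W t₀ x₀ v₀ →
      IsLocalMaxOn (fun y => W t₀ y v) (closure Ω) x₀ := fun v hv hWv => by
    filter_upwards [self_mem_nhdsWithin] with y hy
    rw [hWv]
    exact hmax' t₀ ht₀ y hy v hv
  have hv₀' : ‖v₀‖ ≤ V := by simpa using hv₀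
  rcases hΩ.mem_or_frontier hx₀ with hxΩ | hxf
  · have hnhds : closure Ω ∈ 𝓝 x₀ := mem_of_superset (hΩ.isOpen.mem_nhds hxΩ) subset_closure
    have hz : wx t₀ x₀ v₀ = 0 :=
      ((hWm v₀ hv₀' rfl).isLocalMax hnhds).hasFDerivAt_eq_zero ((hWx v₀).hasFDerivAt hnhds)
    exact hfalse v₀ hv₀' rfl (by rw [hz]; simp)
  · obtain ⟨n, hn⟩ := exists_isOuterUnitNormal hΩ.isOpen hΩ.convex hΩ.nonempty hxf
    have hout : ∀ v, ‖v‖ ≤ V → W t₀ x₀ v = W t₀ x₀ v₀ → 0 ≤ inner ℝ n v → False := by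
      intro v hv hWv hnv
      refine hfalse v hv hWv ?_
      obtain ⟨a, ha, hg⟩ := hΩ.gradient_of_isLocalMaxOn
        (g := (InnerProductSpace.toDual ℝ Plane).symm (wx t₀ x₀ v)) hxf hn
        (by
          rw [HasGradientWithinAt, HasGradientAtFilter, LinearIsometryEquiv.apply_symm_apply]
          exact hWx v) (hWm v hv hWv)
      have h1 : wx t₀ x₀ v (velocity v)
          = inner ℝ ((InnerProductSpace.toDual ℝ Plane).symm (wx t₀ x₀ v)) (velocity v) := by simp
      rw [h1, hg, velocity, real_inner_smul_left, inner_smul_right]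
      positivity
    rcases le_total 0 (inner ℝ n v₀) with h | h
    · exact hout v₀ hv₀' rfl h
    · refine hout (reflect n v₀) (by rwa [norm_reflect hn.1]) ?_
        (by rw [inner_reflect hn.1]; linarith)
      simp only [hW, energy_reflect hn.1, ← hrefl t₀ ht₀' x₀ hxf n hn v₀]

/-! ### Properties of classical solutions -/

lemma norm_grad_sub_le {Ω : Set Plane} {lam : ℝ} (hlam : 0 < lam) {g : Plane → Plane → ℝ} {S : ℝ≥0∞}
    (hS : S < ∞) (hg : gradHolderSeminorm Ω lam g ≤ S) {x x' : Plane} (hx : x ∈ closure Ω)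
    (hx' : x' ∈ closure Ω) (v : Plane) :
    ‖gradX Ω g x v - gradX Ω g x' v‖ ≤ S.toReal * ‖x - x'‖ ^ lam ∧
      ‖gradV g x v - gradV g x' v‖ ≤ S.toReal * ‖x - x'‖ ^ lam := by
  rcases eq_or_ne x x' with rfl | hne
  · simp [Real.zero_rpow hlam.ne']
  have hpos : 0 < ‖x - x'‖ ^ lam := Real.rpow_pos_of_pos (norm_pos_iff.2 (sub_ne_zero.2 hne)) _
  have h1 : ENNReal.ofReal
      (√(‖gradX Ω g x v - gradX Ω g x' v‖ ^ 2 + ‖gradV g x v - gradV g x' v‖ ^ 2) /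
        (‖x - x'‖ ^ lam + ‖v - v‖ ^ lam)) ≤ S := by
    refine le_trans ?_ hg
    unfold gradHolderSeminorm
    exact le_iSup₂_of_le x hx (le_iSup_of_le v (le_iSup₂_of_le x' hx' (le_iSup_of_le v le_rfl)))
  rw [ENNReal.ofReal_le_iff_le_toReal hS.ne, sub_self, norm_zero, Real.zero_rpow hlam.ne', add_zero,
    div_le_iff₀ hpos] at h1
  exact ⟨le_trans (Real.le_sqrt_of_sq_le (le_add_of_nonneg_right (sq_nonneg _))) h1,
    le_trans (Real.le_sqrt_of_sq_le (le_add_of_nonneg_left (sq_nonneg _))) h1⟩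

lemma continuousOn_of_norm_sub_le {s : Set Plane} {G : Plane → Plane} {C lam : ℝ} (hlam : 0 < lam)
    (hG : ∀ x ∈ s, ∀ y ∈ s, ‖G x - G y‖ ≤ C * ‖x - y‖ ^ lam) : ContinuousOn G s := by
  intro x hx
  rw [ContinuousWithinAt, tendsto_iff_norm_sub_tendsto_zero]
  have hc : Continuous fun y : Plane => C * ‖y - x‖ ^ lam :=
    continuous_const.mul ((by fun_prop : Continuous fun y : Plane => ‖y - x‖).rpow_const
      fun _ => Or.inr hlam.le)
  have h0 : Tendsto (fun y : Plane => C * ‖y - x‖ ^ lam) (𝓝[s] x) (𝓝 0) := by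
    have := hc.tendsto x
    simp only [sub_self, norm_zero, Real.zero_rpow hlam.ne', mul_zero] at this
    exact this.mono_left nhdsWithin_le_nhds
  refine squeeze_zero' (Eventually.of_forall fun _ => norm_nonneg _) ?_ h0
  filter_upwards [self_mem_nhdsWithin] with y hy using hG y hy x hx

lemma abs_le_of_supNorm_le {Ω : Set Plane} {g : Plane → Plane → ℝ} {S : ℝ≥0∞} (hS : S < ∞)
    (hg : supNorm Ω g ≤ S) {x : Plane} (hx : x ∈ closure Ω) (v : Plane) :
    |g x v| ≤ S.toReal := by
  rw [← ENNReal.ofReal_le_iff_le_toReal hS.ne]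
  refine le_trans ?_ hg
  unfold supNorm
  exact le_iSup₂_of_le x hx (le_iSup_of_le v le_rfl)

namespace IsClassicalSolution
variable {Ω : Set Plane} {L : ℝ} {r : ℝ → Plane} {h : Plane → ℝ} {T : ℝ} {f₀ : Plane → Plane → ℝ}
  {f : ℝ → Plane → Plane → ℝ} {φ : ℝ → Plane → ℝ}

lemma continuousOn (hs : IsClassicalSolution Ω h T f₀ f φ) :
    ContinuousOn (fun p : ℝ × Plane × Plane => f p.1 p.2.1 p.2.2)
      (Icc 0 T ×ˢ closure Ω ×ˢ univ) := by
  obtain ⟨lam, -, -, hreg⟩ := hs.regularity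
  exact hreg.continuousOn

lemma continuousOn_space (hs : IsClassicalSolution Ω h T f₀ f φ) {t : ℝ} (ht : t ∈ Icc 0 T)
    (v : Plane) : ContinuousOn (fun x => f t x v) (closure Ω) :=
  hs.continuousOn.comp (f := fun x : Plane => (t, x, v)) (by fun_prop)
    fun _ hx => ⟨ht, hx, mem_univ _⟩

lemma exists_bound (hs : IsClassicalSolution Ω h T f₀ f φ) :
    ∃ M, 0 ≤ M ∧ ∀ t ∈ Icc 0 T, ∀ x ∈ closure Ω, ∀ v, f t x v ≤ M := by
  obtain ⟨lam, -, -, hreg⟩ := hs.regularity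
  refine ⟨(⨆ t ∈ Icc 0 T, supNorm Ω (f t)).toReal, ENNReal.toReal_nonneg, fun t ht x hx v => ?_⟩
  have hlt : (⨆ t ∈ Icc 0 T, supNorm Ω (f t)) < ∞ :=
    lt_of_le_of_lt (le_add_self.trans le_self_add) hreg.norm_lt_top
  exact (le_abs_self _).trans (abs_le_of_supNorm_le hlt (le_iSup₂_of_le t ht le_rfl) hx v)

lemma exists_field_bound (hΩ : IsConvexC5Domain Ω L r) (hs : IsClassicalSolution Ω h T f₀ f φ) :
    ∃ K, 0 ≤ K ∧ ∀ t ∈ Icc 0 T, ∀ x ∈ closure Ω, ‖field Ω φ t x‖ ≤ K := by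
  obtain ⟨K, hK⟩ := (isCompact_Icc.prod hΩ.isCompact_closure).exists_bound_of_continuousOn
    hs.continuousOn_field
  exact ⟨max K 0, le_max_right _ _, fun t ht x hx => (hK (t, x) ⟨ht, hx⟩).trans (le_max_left _ _)⟩

lemma hasDerivWithinAt_time (hs : IsClassicalSolution Ω h T f₀ f φ) {t : ℝ} (ht : t ∈ Icc 0 T)
    {x : Plane} (hx : x ∈ closure Ω) (v : Plane) :
    HasDerivWithinAt (fun s => f s x v) (timeDeriv T f t x v) (Icc 0 T) t := by
  obtain ⟨lam, -, -, hreg⟩ := hs.regularity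
  exact (hreg.differentiable_time t ht x hx v).hasDerivWithinAt

lemma hasFDerivWithinAt_space (hs : IsClassicalSolution Ω h T f₀ f φ) {t : ℝ} (ht : t ∈ Icc 0 T)
    {x : Plane} (hx : x ∈ closure Ω) (v : Plane) :
    HasFDerivWithinAt (fun y => f t y v) (innerSL ℝ (gradX Ω (f t) x v)) (closure Ω) x := by
  obtain ⟨lam, -, -, hreg⟩ := hs.regularity
  exact (hreg.hasGradients t ht x hx v).1.hasGradientWithinAt

lemma hasFDerivAt_momentum (hs : IsClassicalSolution Ω h T f₀ f φ) {t : ℝ} (ht : t ∈ Icc 0 T)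
    {x : Plane} (hx : x ∈ closure Ω) (v : Plane) :
    HasFDerivAt (fun w => f t x w) (innerSL ℝ (gradV (f t) x v)) v := by
  obtain ⟨lam, -, -, hreg⟩ := hs.regularity
  exact (hreg.hasGradients t ht x hx v).2.hasGradientAt

/-- The Vlasov equation holds up to the boundary. -/
lemma vlasov_closure (hs : IsClassicalSolution Ω h T f₀ f φ) {t : ℝ} (ht : t ∈ Ioc 0 T)
    {x : Plane} (hx : x ∈ closure Ω) (v : Plane) :
    timeDeriv T f t x v + inner ℝ (velocity v) (gradX Ω (f t) x v)
      + inner ℝ (field Ω φ t x) (gradV (f t) x v) = 0 := by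
  obtain ⟨lam, hlam, -, hreg⟩ := hs.regularity
  -- all terms of the equation are continuous in `x` up to the boundary
  have ht' := Ioc_subset_Icc_self ht
  have hlt : (⨆ t ∈ Icc 0 T, gradHolderSeminorm Ω lam (f t)) < ∞ :=
    lt_of_le_of_lt (le_self_add.trans le_self_add) hreg.norm_lt_top
  have hle : gradHolderSeminorm Ω lam (f t) ≤ ⨆ t ∈ Icc 0 T, gradHolderSeminorm Ω lam (f t) :=
    le_iSup₂_of_le t ht' le_rfl
  have hgx : ContinuousOn (fun y => gradX Ω (f t) y v) (closure Ω) :=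
    continuousOn_of_norm_sub_le hlam fun y hy z hz =>
      (norm_grad_sub_le hlam hlt hle hy hz v).1
  have hgv : ContinuousOn (fun y => gradV (f t) y v) (closure Ω) :=
    continuousOn_of_norm_sub_le hlam fun y hy z hz =>
      (norm_grad_sub_le hlam hlt hle hy hz v).2
  have hgt : ContinuousOn (fun y => timeDeriv T f t y v) (closure Ω) :=
    hreg.continuousOn_timeDeriv.comp (f := fun y : Plane => (t, y, v)) (by fun_prop)
      fun _ hy => ⟨ht', hy, mem_univ _⟩
  have hgE : ContinuousOn (fun y => field Ω φ t y) (closure Ω) :=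
    hs.continuousOn_field.comp (f := fun y : Plane => (t, y)) (by fun_prop) fun _ hy => ⟨ht', hy⟩
  exact Set.EqOn.of_subset_closure (fun y hy => hs.vlasov t ht y hy v)
    ((hgt.add (continuousOn_const.inner hgx)).add (hgE.inner hgv)) continuousOn_const
    subset_closure le_rfl hx

/-- The initial values are bounded up to the boundary of `Ω`, where `f 0 = f₀` is not required. -/
lemma initial_closure (hs : IsClassicalSolution Ω h T f₀ f φ) (hT : 0 < T) {μ : ℝ}
    (hf₀ : c1HolderNorm Ω μ f₀ < ∞) {x : Plane} (hx : x ∈ closure Ω) (v : Plane) :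
    f 0 x v ≤ (c1HolderNorm Ω μ f₀).toReal := by
  refine ContinuousWithinAt.closure_le hx
    ((hs.continuousOn_space ⟨le_rfl, hT.le⟩ v x hx).mono subset_closure)
    continuousWithinAt_const fun y hy => ?_
  rw [hs.initial y hy v]
  exact (le_abs_self _).trans (abs_le_of_supNorm_le hf₀ le_add_self (subset_closure hy) v)

lemma le_of_initial_le (hΩ : IsConvexC5Domain Ω L r) (hs : IsClassicalSolution Ω h T f₀ f φ)
    (hT : 0 < T) {F : ℝ} (hF : ∀ x ∈ closure Ω, ∀ v, f 0 x v ≤ F) :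
    ∀ t ∈ Icc 0 T, ∀ x ∈ closure Ω, ∀ v, f t x v ≤ F := by
  obtain ⟨K, -, hK⟩ := hs.exists_field_bound hΩ
  obtain ⟨M, -, hM⟩ := hs.exists_bound
  refine le_of_vlasov_subsolution hΩ hT hK hs.continuousOn hM
    (fun t ht x hx v => hs.hasDerivWithinAt_time (Ioc_subset_Icc_self ht) hx v)
    (fun t ht x hx v => hs.hasFDerivWithinAt_space (Ioc_subset_Icc_self ht) hx v)
    (fun t ht x hx v => hs.hasFDerivAt_momentum (Ioc_subset_Icc_self ht) hx v)
    (fun t ht x hx v => ?_) hs.specular hF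
  rw [innerSL_apply_apply, innerSL_apply_apply, real_inner_comm, real_inner_comm (field Ω φ t x)]
  exact (hs.vlasov_closure ht hx v).le

/-- If the field is at most `Y'`, the energies in the support of the solution grow at most like
`Y`: the product of `f` and an increasing function `χ` of `energy v - Y t` is a subsolution, as the
energy grows at most at the rate of the field. -/
lemma eq_zero_of_lt_energy (hΩ : IsConvexC5Domain Ω L r) (hs : IsClassicalSolution Ω h T f₀ f φ)
    (hT : 0 < T) {Y Y' : ℝ → ℝ} (hY : ∀ t, HasDerivAt Y (Y' t) t)
    (hE : ∀ t ∈ Ioc 0 T, ∀ x ∈ closure Ω, ‖field Ω φ t x‖ ≤ Y' t)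
    (h0 : ∀ x ∈ closure Ω, ∀ v, Y 0 < energy v → f 0 x v = 0) :
    ∀ t ∈ Icc 0 T, ∀ x ∈ closure Ω, ∀ v, Y t < energy v → f t x v = 0 := by
  obtain ⟨K, -, hK⟩ := hs.exists_field_bound hΩ
  obtain ⟨M, hM0, hM⟩ := hs.exists_bound
  set χ := Real.smoothTransition with hχ
  have hχd : ∀ u, HasDerivAt χ (deriv χ u) u := fun u =>
    (Real.smoothTransition.contDiff.differentiable (n := 1) (by norm_num) u).hasDerivAt
  have hχ' : ∀ u, 0 ≤ deriv χ u := fun u => Real.smoothTransition.monotone.deriv_nonneg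
  have hYc : Continuous Y := continuous_iff_continuousAt.2 fun t => (hY t).continuousAt
  have key := le_of_vlasov_subsolution hΩ (c := 0) (M := M) hT hK
    (w := fun t x v => f t x v * χ (energy v - Y t))
    (wt := fun t x v => timeDeriv T f t x v * χ (energy v - Y t)
      + f t x v * (deriv χ (energy v - Y t) * (0 - Y' t)))
    (wx := fun t x v => χ (energy v - Y t) • innerSL ℝ (gradX Ω (f t) x v))
    (wv := fun t x v => f t x v • (deriv χ (energy v - Y t) • innerSL ℝ (velocity v))
      + χ (energy v - Y t) • innerSL ℝ (gradV (f t) x v))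
    (by
      refine hs.continuousOn.mul (Continuous.continuousOn ?_)
      have := continuous_energy
      exact Real.smoothTransition.continuous.comp (by fun_prop))
    (fun t ht x hx v => by
      have h1 := hM t ht x hx v
      have h2 := hs.nonneg t ht x hx v
      have h3 := Real.smoothTransition.le_one (energy v - Y t)
      exact (mul_le_of_le_one_right h2 h3).trans h1)
    (fun t ht x hx v => (hs.hasDerivWithinAt_time (Ioc_subset_Icc_self ht) hx v).mul
      (((hχd _).comp t ((hasDerivAt_const t (energy v)).sub (hY t))).hasDerivWithinAt))
    (fun t ht x hx v => (hs.hasFDerivWithinAt_space (Ioc_subset_Icc_self ht) hx v).mul_const _)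
    (fun t ht x hx v => (hs.hasFDerivAt_momentum (Ioc_subset_Icc_self ht) hx v).mul
      ((hχd _).comp_hasFDerivAt v ((hasFDerivAt_energy v).sub_const (Y t))))
    (fun t ht x hx v => by
      have h1 := hs.vlasov_closure ht hx v
      have h2 := hs.nonneg t (Ioc_subset_Icc_self ht) x hx v
      have h3 : inner ℝ (velocity v) (field Ω φ t x) ≤ Y' t := by
        refine (real_inner_le_norm _ _).trans (le_trans ?_ (hE t ht x hx))
        exact mul_le_of_le_one_left (norm_nonneg _) (norm_velocity_le v)
      have h4 := mul_nonneg (mul_nonneg h2 (hχ' (energy v - Y t))) (sub_nonneg.2 h3)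
      simp only [add_apply, smul_apply, innerSL_apply_apply, smul_eq_mul]
      rw [real_inner_comm (gradX Ω (f t) x v), real_inner_comm (gradV (f t) x v)] at h1
      linear_combination χ (energy v - Y t) * h1 + h4)
    (fun t ht x hx n hn v => by
      rw [energy_reflect hn.1, ← hs.specular t ht x hx n hn v])
    (fun x hx v => by
      rcases le_or_gt (energy v) (Y 0) with hle | hlt
      · simp [hχ, Real.smoothTransition.zero_of_nonpos (sub_nonpos.2 hle)]
      · simp [h0 x hx v hlt])
  intro t ht x hx v hlt
  have h1 := key t ht x hx v
  have h2 := Real.smoothTransition.pos_of_pos (sub_pos.2 hlt)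
  have h3 := hs.nonneg t ht x hx v
  exact le_antisymm (nonpos_of_mul_nonpos_left h1 h2) h3

lemma chargeDensity_le (hs : IsClassicalSolution Ω h T f₀ f φ) {t : ℝ} (ht : t ∈ Icc 0 T)
    {x : Plane} (hx : x ∈ closure Ω) {F P : ℝ} (hP0 : 0 ≤ P) (hF : ∀ v, f t x v ≤ F)
    (hP : ∀ v, P < energy v → f t x v = 0) : chargeDensity f t x ≤ F * (Real.pi * P ^ 2) := by
  have hvol : volume.real (closedBall (0 : Plane) P) = Real.pi * P ^ 2 := by
    rw [measureReal_def, EuclideanSpace.volume_closedBall_fin_two, ENNReal.toReal_mul,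
      ENNReal.toReal_pow, ENNReal.toReal_ofReal hP0]
    simp [mul_comm, Real.pi_pos.le]
  have hi : Integrable ((closedBall (0 : Plane) P).indicator fun _ => F) :=
    (continuousOn_const.integrableOn_compact (isCompact_closedBall 0 P)).integrable_indicator
      measurableSet_closedBall
  calc chargeDensity f t x ≤ ∫ v, (closedBall (0 : Plane) P).indicator (fun _ => F) v := by
        refine integral_mono (hs.integrable t ht x hx) hi fun v => ?_
        by_cases hv : v ∈ closedBall (0 : Plane) P
        · rw [indicator_of_mem hv]; exact hF v
        · rw [indicator_of_notMem hv]
          refine (hP v (lt_of_lt_of_le ?_ (norm_le_energy v))).le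
          simpa using hv
    _ = F * (Real.pi * P ^ 2) := by
        rw [integral_indicator measurableSet_closedBall, setIntegral_const, hvol, smul_eq_mul,
          mul_comm]

lemma isNeumannSolution (hs : IsClassicalSolution Ω h T f₀ f φ) {t R : ℝ} (ht : t ∈ Ioc 0 T)
    (hR : ∀ x ∈ Ω, chargeDensity f t x ≤ R) : IsNeumannSolution Ω h R (φ t) where
  contDiffOn := hs.contDiffOn_potential t (Ioc_subset_Icc_self ht)
  differentiableOn := hs.differentiableOn_potential t (Ioc_subset_Icc_self ht)
  continuousOn_gradient :=
    hs.continuousOn_field.comp (f := fun y : Plane => (t, y)) (by fun_prop)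
      fun _ hy => ⟨Ioc_subset_Icc_self ht, hy⟩
  laplacian_nonneg x hx := by
    rw [hs.poisson t ht x hx]
    exact integral_nonneg fun v => hs.nonneg t (Ioc_subset_Icc_self ht) x (subset_closure hx) v
  laplacian_le x hx := by
    rw [hs.poisson t ht x hx]
    exact hR x hx
  neumann := hs.neumann t ht

end IsClassicalSolution

/-! ### The momentum bound -/

lemma norm_le_momentumSupport {Ω : Set Plane} {f : ℝ → Plane → Plane → ℝ}
    (hQ : momentumSupport Ω f 0 < ∞) {x v : Plane} (hx : x ∈ closure Ω) (hv : f 0 x v ≠ 0) :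
    ‖v‖ ≤ (momentumSupport Ω f 0).toReal := by
  rw [← ENNReal.ofReal_le_iff_le_toReal hQ.ne]
  unfold momentumSupport
  exact le_iSup₂_of_le 0 ⟨le_rfl, le_rfl⟩
    (le_iSup₂_of_le (x, v) (subset_closure ⟨hx, hv⟩) le_rfl)

lemma momentumSupport_le {Ω : Set Plane} {f : ℝ → Plane → Plane → ℝ} {t Z : ℝ}
    (hf : ∀ s ∈ Icc 0 t, ∀ x ∈ closure Ω, ∀ v, f s x v ≠ 0 → ‖v‖ ≤ Z) :
    momentumSupport Ω f t ≤ ENNReal.ofReal Z := by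
  refine iSup₂_le fun s hs => iSup₂_le fun z hz => ENNReal.ofReal_le_ofReal ?_
  have hcl : IsClosed {z : Plane × Plane | ‖z.2‖ ≤ Z} :=
    isClosed_le (by fun_prop) continuous_const
  exact closure_minimal (fun w hw => hf s hs w.1 hw.1 w.2 hw.2) hcl hz

namespace IsClassicalSolution
variable {Ω : Set Plane} {L : ℝ} {r : ℝ → Plane} {h : Plane → ℝ} {T : ℝ} {f₀ : Plane → Plane → ℝ}
  {f : ℝ → Plane → Plane → ℝ} {φ : ℝ → Plane → ℝ}

/-- The gradient bound turns a bound `P` for the energies in the support into a bound for the field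
that is linear in `P`, as the charge density is at most quadratic in `P`. -/
lemma norm_field_le (hs : IsClassicalSolution Ω h T f₀ f φ) {C R₁ F : ℝ} (hC : 0 < C)
    (hR₁ : 0 < R₁) (hF0 : 0 ≤ F)
    (hgrad : ∀ (ψ : Plane → ℝ) (R : ℝ), IsNeumannSolution Ω h R ψ → R₁ ≤ R →
      ∀ x ∈ closure Ω, ‖gradientWithin ψ (closure Ω) x‖ ≤ C * √R)
    (hF : ∀ t ∈ Icc 0 T, ∀ x ∈ closure Ω, ∀ v, f t x v ≤ F) {t : ℝ} (ht : t ∈ Ioc 0 T) {P : ℝ}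
    (hP1 : 1 ≤ P) (hP : ∀ x ∈ closure Ω, ∀ v, P < energy v → f t x v = 0) {x : Plane}
    (hx : x ∈ closure Ω) : ‖field Ω φ t x‖ ≤ C * (√R₁ + √(Real.pi * F)) * P := by
  have hP0 : 0 ≤ P := zero_le_one.trans hP1
  have hpi := Real.pi_pos
  have ht' := Ioc_subset_Icc_self ht
  have hsq : √(F * (Real.pi * P ^ 2)) = √(Real.pi * F) * P := by
    rw [show F * (Real.pi * P ^ 2) = Real.pi * F * P ^ 2 by ring,
      Real.sqrt_mul (by positivity), Real.sqrt_sq hP0]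
  have hN : IsNeumannSolution Ω h (R₁ + F * (Real.pi * P ^ 2)) (φ t) :=
    hs.isNeumannSolution ht fun y hy =>
      (hs.chargeDensity_le ht' (subset_closure hy) hP0 (hF t ht' y (subset_closure hy))
        (hP y (subset_closure hy))).trans (le_add_of_nonneg_left hR₁.le)
  calc ‖field Ω φ t x‖ ≤ C * √(R₁ + F * (Real.pi * P ^ 2)) :=
        hgrad _ _ hN (le_add_of_nonneg_right (by positivity)) x hx
    _ ≤ C * (√R₁ * P + √(Real.pi * F) * P) := by
        refine mul_le_mul_of_nonneg_left ?_ hC.le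
        rw [← hsq]
        have h1 := le_mul_of_one_le_right (Real.sqrt_nonneg R₁) hP1
        have h2 := Real.sqrt_nonneg (F * (Real.pi * P ^ 2))
        have h3 := Real.sq_sqrt hR₁.le
        have h4 := Real.sq_sqrt (show 0 ≤ F * (Real.pi * P ^ 2) by positivity)
        refine (Real.sqrt_le_iff.2 ⟨by positivity, ?_⟩ :
          _ ≤ √R₁ + √(F * (Real.pi * P ^ 2))).trans (by linarith)
        nlinarith [mul_nonneg (Real.sqrt_nonneg R₁) h2]
    _ = C * (√R₁ + √(Real.pi * F)) * P := by ring

/-- Gronwall's inequality for the energies in the support of the solution. The bound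
`(a + K T) exp (β t)`, where `K` is an a priori bound of the field, holds to begin with; and if
`c exp (β t)` is a bound, the field is at most `β c exp (β t)`, so that `a + c (exp (β t) - 1)` is a
bound as well, which is at most `(a + (c - a) θ) exp (β t)` with `θ = 1 - exp (-β T) < 1`. -/
lemma eq_zero_of_exp_lt_energy (hΩ : IsConvexC5Domain Ω L r)
    (hs : IsClassicalSolution Ω h T f₀ f φ) (hT : 0 < T) {a β : ℝ} (ha : 1 ≤ a) (hβ : 0 ≤ β)
    (hE : ∀ t ∈ Ioc 0 T, ∀ P, 1 ≤ P → (∀ x ∈ closure Ω, ∀ v, P < energy v → f t x v = 0) →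
      ∀ x ∈ closure Ω, ‖field Ω φ t x‖ ≤ β * P)
    (h0 : ∀ x ∈ closure Ω, ∀ v, a < energy v → f 0 x v = 0) :
    ∀ t ∈ Icc 0 T, ∀ x ∈ closure Ω, ∀ v, a * Real.exp (β * t) < energy v → f t x v = 0 := by
  obtain ⟨K, hK0, hK⟩ := hs.exists_field_bound hΩ
  set θ : ℝ := 1 - Real.exp (-(β * T)) with hθ
  have hθ0 : 0 ≤ θ := sub_nonneg.2 (Real.exp_le_one_iff.2 (neg_nonpos.2 (by positivity)))
  have hθ1 : θ < 1 := sub_lt_self _ (Real.exp_pos _)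
  have hexp : ∀ t ∈ Icc 0 T, 1 ≤ Real.exp (β * t) := fun t ht =>
    Real.one_le_exp (mul_nonneg hβ ht.1)
  have hiter : ∀ n : ℕ, ∀ t ∈ Icc 0 T, ∀ x ∈ closure Ω, ∀ v,
      (a + K * T * θ ^ n) * Real.exp (β * t) < energy v → f t x v = 0 := by
    intro n
    induction n with
    | zero =>
      intro t ht x hx v hv
      refine hs.eq_zero_of_lt_energy hΩ hT (Y := fun t => a + K * t) (Y' := fun _ => K)
        (fun t => by simpa using ((hasDerivAt_id t).const_mul K).const_add a)
        (fun t ht x hx => hK t (Ioc_subset_Icc_self ht) x hx)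
        (fun x hx v hv => h0 x hx v (by simpa using hv)) t ht x hx v (lt_of_le_of_lt ?_ hv)
      have h1 : K * t ≤ K * T := mul_le_mul_of_nonneg_left ht.2 hK0
      have h2 : a + K * T ≤ (a + K * T) * Real.exp (β * t) :=
        le_mul_of_one_le_right (by positivity) (hexp t ht)
      simp only [pow_zero, mul_one]
      linarith
    | succ n ih =>
      intro t ht x hx v hv
      set c := a + K * T * θ ^ n with hc
      have hca : 0 ≤ c - a := by rw [hc, add_sub_cancel_left]; positivity
      refine hs.eq_zero_of_lt_energy hΩ hT (Y := fun t => a + c * (Real.exp (β * t) - 1))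
        (Y' := fun t => β * (c * Real.exp (β * t)))
        (fun t => ?_) (fun t ht x hx => ?_)
        (fun x hx v hv => h0 x hx v (by simpa using hv)) t ht x hx v (lt_of_le_of_lt ?_ hv)
      · have h1 := ((((hasDerivAt_id t).const_mul β).exp.sub_const 1).const_mul c).const_add a
        refine h1.congr_deriv ?_
        simp only [id]
        ring
      · have ht' := Ioc_subset_Icc_self ht
        have hc1 : 1 ≤ c := by linarith
        exact hE t ht _ (one_le_mul_of_one_le_of_one_le hc1 (hexp t ht')) (ih t ht') x hx
      · have h1 : Real.exp (-(β * T)) * Real.exp (β * t) ≤ 1 := by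
          rw [← Real.exp_add]
          exact Real.exp_le_one_iff.2 (by nlinarith [ht.2])
        have h2 : a + K * T * θ ^ (n + 1) = a + (c - a) * θ := by rw [hc]; ring
        have h3 := mul_nonneg hca (sub_nonneg.2 h1)
        rw [h2, hθ]
        linarith
  intro t ht x hx v hv
  have hlim : Tendsto (fun n : ℕ => (a + K * T * θ ^ n) * Real.exp (β * t)) atTop
      (𝓝 (a * Real.exp (β * t))) := by
    have h1 := (((tendsto_pow_atTop_nhds_zero_of_lt_one hθ0 hθ1).const_mul (K * T)).const_add
      a).mul_const (Real.exp (β * t))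
    simpa using h1
  obtain ⟨n, hn⟩ := (hlim.eventually_lt_const hv).exists
  exact hiter n t ht x hx v hn

end IsClassicalSolution

end RVP

end

theorem proposition8 (Ω : Set RVP.Plane) (L : ℝ) (r : ℝ → RVP.Plane)
    (hΩ : RVP.IsConvexC5Domain Ω L r)
    (h : RVP.Plane → ℝ) (h_pos : ∀ x ∈ frontier Ω, 0 < h x)
    (α : ℝ) (hα0 : 0 < α) (hα1 : α < 1) (h_reg : RVP.IsC1HolderOnCurve α r h) :
    ∃ ζ : ℝ → ℝ → ℝ → ℝ,
      ∀ (T : ℝ), 0 < T →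
      ∀ (μ : ℝ), 0 < μ → μ < 1 →
      ∀ (f₀ : RVP.Plane → RVP.Plane → ℝ), RVP.MemC1Holder Ω μ f₀ →
        (∫ x in Ω, ∫ v : RVP.Plane, f₀ x v) = ∫ l in (0 : ℝ)..L, h (r l) →
      ∀ (f : ℝ → RVP.Plane → RVP.Plane → ℝ) (φ : ℝ → RVP.Plane → ℝ),
        RVP.IsClassicalSolution Ω h T f₀ f φ →
        RVP.momentumSupport Ω f 0 < ⊤ →
        ∀ t : ℝ, 0 ≤ t → t ≤ T →
          RVP.momentumSupport Ω f t ≤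
            ENNReal.ofReal (ζ T (RVP.momentumSupport Ω f 0).toReal
              (RVP.c1HolderNorm Ω μ f₀).toReal) := by
  obtain ⟨C, hC, R₁, hR₁, hgrad⟩ := RVP.exists_gradient_le_sqrt hΩ h_reg.1
  refine ⟨fun T Q F => √(1 + Q ^ 2) * Real.exp (C * (√R₁ + √(Real.pi * F)) * T), ?_⟩
  intro T hT μ _ _ f₀ hf₀ _ f φ hs hQ t _ htT
  set F := (RVP.c1HolderNorm Ω μ f₀).toReal
  set Q := (RVP.momentumSupport Ω f 0).toReal
  have hF := hs.le_of_initial_le hΩ hT fun x hx v => hs.initial_closure hT hf₀.2 hx v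
  have hβ : 0 ≤ C * (√R₁ + √(Real.pi * F)) := by positivity
  have ha : 1 ≤ √(1 + Q ^ 2) := Real.one_le_sqrt.2 (le_add_of_nonneg_right (sq_nonneg Q))
  have hzero := hs.eq_zero_of_exp_lt_energy hΩ hT ha hβ
    (fun s hst P hP1 hP x hx =>
      hs.norm_field_le hC hR₁ ENNReal.toReal_nonneg hgrad hF hst hP1 hP hx)
    (fun x hx v hv => by
      by_contra hne
      have h1 := RVP.norm_le_momentumSupport hQ hx hne
      refine hv.not_ge (Real.sqrt_le_sqrt ?_)
      gcongr)
  refine RVP.momentumSupport_le fun s hst x hx v hne => ?_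
  have hsT : s ∈ Icc 0 T := ⟨hst.1, hst.2.trans htT⟩
  refine (RVP.norm_le_energy v).trans ((not_lt.1 fun hlt => hne (hzero s hsT x hx v hlt)).trans ?_)
  exact mul_le_mul_of_nonneg_left
    (Real.exp_le_exp.2 (mul_le_mul_of_nonneg_left hsT.2 hβ)) (Real.sqrt_nonneg _)
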